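/- Let $\mathcal S^{\sharp\flat}$ be the class of functions $F$ such that: (a) $F(s)=\sum_{n\ge1}a_F(n)n^{-s}$, absolutely convergent for $\operatorname{Re}s>1$; (b) for some integer $m\ge0$ the function $(s-1)^mF(s)$ is entire of finite order, the least such $m$ being denoted $m_F$; (c) $\xi_F(s)=w\,\overline{\xi_F(1-\bar s)}$, where $\xi_F(s)=s^{m_F}(1-s)^{m_F}F(s)Q_F^s\prod_{j=1}^r\Gamma(\lambda_js+\mu_j)$ with $Q_F>0$, $r\ge0$, $\lambda_j>0$, $|w|=1$, $\operatorname{Re}\mu_j>-\frac14$ and $\operatorname{Re}(\lambda_j+2\mu_j)>0$; (d) for $\operatorname{Re}s>1$, $F(s)\neq0$ and $\frac{F'}{F}(s)=-\sum_{n\ge2}c_F(n)n^{-s}$, absolutely convergent. Let $Z(F)$ be the multiset of zeros of $\xi_F$ (the non-trivial zeros of $F$), counted with multiplicity. Let $N_F(x)$ be the number of $\rho\in Z(F)$ with $|\operatorname{Im}\rho|\le x$, and, when $0\notin Z(F)$, let $$\lambda_F(n)=\lim_{T\to\infty}\sum_{\rho\in Z(F),\,|\operatorname{Im}\rho|\le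 T}\left(1-\left(1-\frac1\rho\right)^n\right).$$ GRH for $F$ is the statement that $\operatorname{Re}\rho=\frac12$ for all $\rho\in Z(F)$. For $t>0$ let $\mathcal S^{\sharp\flat}_t$ be the set of all $F\in\mathcal S^{\sharp\flat}$ such that every $\rho\in Z(F)$ with $\operatorname{Re}\rho\ne\frac12$ satisfies $|\operatorname{Im}\rho|>t$ (so that $0\notin Z(F)$). Let $T_2(x)=2x^2-1$. In the sums below $\rho=\sigma+i\gamma$. Theorem. (i) Let $F\in\mathcal S^{\sharp\flat}_{1/\sqrt3}$. Then $N_F$ is finite, and the limit $\lambda_F(1)$, the integral and the sums below converge. GRH for $F$ is equivalent to $$\operatorname{Re}\lambda_F(1)=16\int_0^\infty\frac{x}{(4x^2+1)^2}N_F(x)\,dx,$$ and it is also equivalent to $$\operatorname{Re}\lambda_F(1)=\sum_{\rho\in Z(F)}\left(1-\frac{4\gamma^2-1}{4\gamma^2+1}\right)=\sum_{\rho\in Z(F)}\frac{2}{4\gamma^2+1}.$$ (ii) Let, additionally, $F\in\mathcal S^{\sharp\flat}_{\sqrt6}$. Then the limit $\lambda_F(2)$, the integral and the sums below converge. GRH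 for $F$ is also equivalent to $$\operatorname{Re}\lambda_F(2)=64\int_0^\infty\frac{x(4x^2-1)}{(4x^2+1)^3}N_F(x)\,dx,$$ and it is also equivalent to $$\operatorname{Re}\lambda_F(2)=\sum_{\rho\in Z(F)}\left(1-T_2\!\left(\frac{4\gamma^2-1}{4\gamma^2+1}\right)\right)=\sum_{\rho\in Z(F)}\frac{32\gamma^2}{(4\gamma^2+1)^2}.$$ -/

import Mathlib

open Complex Filter Topology MeasureTheory

/-- An entire function of finite order. -/
def EntireOfFiniteOrder (G : ℂ → ℂ) : Prop :=
  Differentiable ℂ G ∧ ∃ A C : ℝ, ∀ s : ℂ, ‖G s‖ ≤ C * Real.exp (‖s‖ ^ A)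

/-- `(s - 1) ^ m * F s` is (after filling in its value at `s = 1`) an entire function of
finite order. The function `F` is thought of as a meromorphic function whose only possible pole
is `s = 1`; the value of `F` at that point carries no meaning. -/
def HasEntireMultiple (F : ℂ → ℂ) (m : ℕ) : Prop :=
  ∃ G : ℂ → ℂ, EntireOfFiniteOrder G ∧ ∀ s : ℂ, s ≠ 1 → G s = (s - 1) ^ m * F s

/-- The polar order `m_F`: the smallest `m` as above. -/
noncomputable def polarOrder (F : ℂ → ℂ) : ℕ := sInf {m : ℕ | HasEntireMultiple F m}

/-- The parameters of a functional equation: `Q > 0`, `r ≥ 0`, `λ_j > 0`, `|w| = 1`,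
`Re μ_j > -1/4` and `Re (λ_j + 2 μ_j) > 0`. -/
structure GammaData where
  r : ℕ
  Q : ℝ
  lam : Fin r → ℝ
  mu : Fin r → ℂ
  w : ℂ
  Q_pos : 0 < Q
  lam_pos : ∀ j, 0 < lam j
  norm_w : ‖w‖ = 1
  mu_re : ∀ j, -(1 / 4 : ℝ) < (mu j).re
  lam_add_mu_re : ∀ j, 0 < lam j + 2 * (mu j).re

/-- The product `s^m (1-s)^m F(s) Q^s ∏ Γ(λ_j s + μ_j)` with `m = m_F`, meaningful away from the
pole of `F` and the poles of the Gamma factors. -/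
noncomputable def completedProduct (F : ℂ → ℂ) (D : GammaData) (s : ℂ) : ℂ :=
  s ^ polarOrder F * (1 - s) ^ polarOrder F * F s * (D.Q : ℂ) ^ s *
    ∏ j : Fin D.r, Complex.Gamma ((D.lam j : ℂ) * s + D.mu j)

/-- The completed function `ξ_F`: the product above as a meromorphic function on `ℂ`, with its
removable singularities filled in. -/
noncomputable def completedXi (F : ℂ → ℂ) (D : GammaData) : ℂ → ℂ :=
  toMeromorphicNFOn (completedProduct F D) Set.univ

/-- `F` belongs to the class `S^{♯♭}`, with functional equation given by the parameters `D`. -/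
structure IsSharpFlat (F : ℂ → ℂ) (D : GammaData) : Prop where
  /-- An absolutely convergent Dirichlet series for `Re s > 1`. -/
  dirichlet_series : ∃ a : ℕ → ℂ, ∀ s : ℂ, 1 < s.re → LSeriesHasSum a s (F s)
  /-- Analytic continuation, with at most a pole at `s = 1`, and finite order. -/
  continuation : ∃ m : ℕ, HasEntireMultiple F m
  /-- The functional equation. -/
  functional_equation : ∀ s : ℂ, completedXi F D s =
    D.w * starRingEnd ℂ (completedXi F D (1 - starRingEnd ℂ s))
  /-- The Euler sum: `F'/F` is defined for `Re s > 1` and equals an absolutely convergent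
  Dirichlet series `-∑_{n ≥ 2} c(n) n^{-s}` there. -/
  euler_sum : ∃ c : ℕ → ℂ, c 1 = 0 ∧
    ∀ s : ℂ, 1 < s.re → F s ≠ 0 ∧ LSeriesHasSum c s (-(deriv F s / F s))

/-- The set `Z(F)` of non-trivial zeros: the zeros of `ξ_F`. -/
def nontrivialZeros (F : ℂ → ℂ) (D : GammaData) : Set ℂ := {ρ | completedXi F D ρ = 0}

/-- The multiplicity of a non-trivial zero. -/
noncomputable def zeroMult (F : ℂ → ℂ) (D : GammaData) (ρ : ℂ) : ℕ :=
  analyticOrderNatAt (completedXi F D) ρ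

/-- The non-trivial zeros with `|Im ρ| ≤ T`. -/
def zerosUpTo (F : ℂ → ℂ) (D : GammaData) (T : ℝ) : Set ℂ :=
  {ρ | ρ ∈ nontrivialZeros F D ∧ |ρ.im| ≤ T}

/-- The number `N_F(T)` of non-trivial zeros with `|Im ρ| ≤ T`, counted with multiplicity. -/
noncomputable def zeroCount (F : ℂ → ℂ) (D : GammaData) (T : ℝ) : ℕ :=
  ∑ᶠ ρ ∈ zerosUpTo F D T, zeroMult F D ρ

/-- The truncated sum `∑_{|Im ρ| ≤ T} (1 - (1 - 1/ρ)^n)`, with multiplicities. -/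
noncomputable def liPartialSum (F : ℂ → ℂ) (D : GammaData) (n : ℤ) (T : ℝ) : ℂ :=
  ∑ᶠ ρ ∈ zerosUpTo F D T, (zeroMult F D ρ : ℂ) * (1 - (1 - 1 / ρ) ^ n)

/-- The generalized Li coefficient `λ_F(n)`: the limit of the truncated sums as `T → ∞`. -/
noncomputable def liCoeff (F : ℂ → ℂ) (D : GammaData) (n : ℤ) : ℂ :=
  limUnder atTop (liPartialSum F D n)

/-- All non-trivial zeros off the critical line have `|Im ρ| > t`; for `F` in `S^{♯♭}` this is
membership in `S^{♯♭}_t`. -/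
def OffLineZerosAbove (F : ℂ → ℂ) (D : GammaData) (t : ℝ) : Prop :=
  ∀ ρ ∈ nontrivialZeros F D, ρ.re ≠ 1 / 2 → t < |ρ.im|

/-- The Generalized Riemann Hypothesis for `F`. -/
def GRH (F : ℂ → ℂ) (D : GammaData) : Prop :=
  ∀ ρ ∈ nontrivialZeros F D, ρ.re = 1 / 2

/-- The sum `∑_{ρ = σ + iγ ∈ Z(F)} f(γ)`, with multiplicities: its family of terms. -/
noncomputable def ordinateTerm (F : ℂ → ℂ) (D : GammaData) (f : ℝ → ℝ)
    (ρ : nontrivialZeros F D) : ℝ :=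
  (zeroMult F D ρ : ℝ) * f (ρ : ℂ).im

/-!
Write `ξ` for `completedXi F D` and `ρ = σ + iγ` for its zeros, counted with multiplicity.

*The criteria.* The zeros are permuted by `ρ ↦ 1 - conj ρ`, which keeps `γ`, preserves
multiplicities and exchanges `σ` with `1 - σ`. The real parts of `1 - (1 - 1/ρ)^n` for `n = 1, 2`
are `O(1/γ²)`, so `Re λ_F(n)` is an absolutely convergent sum over the zeros, which may be averaged
with respect to this reflection. A zero on the critical line contributes exactly `2 / (4γ² + 1)`,
respectively `32γ² / (4γ² + 1)²`. An elementary computation shows that a pair of reflected zeros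
off the line contributes strictly less than two zeros on the line with the same ordinate, as soon
as `γ² > 1/3`, respectively `γ² > 6` (`re_inv_add_re_inv_reflect_lt`, `re_li_two_add_reflect_lt`).
Hence the sum over the zeros equals the sum over their ordinates if and only if no zero lies off
the line (`IsSharpFlat.grh_iff_tsum_eq`). The integrals of the two kernels over `(|γ|, ∞)` are
elementary, and summing them over the zeros turns the sums over ordinates into integrals against
`N_F` (`IsSharpFlat.integral_mul_zeroCount`).

*Convergence of `λ_F(n)`.* The imaginary part of `1/ρ` only decays like `1/γ`, so the existence of
the limit needs the zeros to be nearly symmetric about the real axis, although the functional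
equation gives no such symmetry. This is `exists_abs_truncatedSum_sign_le`: the numbers of zeros
with ordinate in `(0, t]` and in `[-t, 0)` differ by `O(t^(7/8))`; partial summation then gives the
limit (`exists_tendsto_truncatedSum_sign_div`). A sharp Riemann–von Mangoldt formula is not needed.
On the line `Re s = 2`, the function `φ(t) = Re (ξ'/ξ)(2 + it)` is, up to a constant, a sum of
Poisson kernels centred at the ordinates. Integrating its odd part over `[0, t]` counts the zeros
above the axis minus those below, up to an error controlled by `φ(±t)` itself. On the other hand
`ξ'/ξ` is explicit there: the odd part of the rational terms and of `log Q` vanishes, the Dirichlet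
series of `F'/F` has no constant term and therefore a bounded primitive, and a digamma term
contributes only integrals over two windows of fixed length
(`IsSharpFlat.exists_bounds_logDeriv_xi`).

*Analytic input.* The function `ξ` is entire (`IsSharpFlat.differentiable_xi`) and at most
`exp (C (1 + ‖s‖)^(5/4))` in size (`IsSharpFlat.exists_growth`, by the Phragmén–Lindelöf principle
and a crude form of Stirling's formula). By Jensen's formula and the Borel–Carathéodory theorem such
a function has `∑ (1 + ‖ρ‖)^(-3/2) < ∞`, and differences of values of its logarithmic derivative
have a partial fraction expansion (`Differentiable.hasSum_logDeriv_sub`). The exponents `5/4`,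
`3/2` and `1/8` have no significance beyond `1 < 5/4 < 3/2 < 2` and `3/4 + 1/8 < 1`.
-/

/-! ### Logarithmic derivatives on zero-free discs -/

/-- A function without zeros on a disc that is bounded there by `exp M` times its value at the
centre has a holomorphic logarithm (normalized to vanish at the centre) which is at most `2 M` on
the disc of half the radius, by the Borel–Carathéodory theorem. -/
theorem exists_log_norm_le {g : ℂ → ℂ} {c : ℂ} {R M : ℝ} (hR : 0 < R) (hM : 0 < M)
    (hg : DifferentiableOn ℂ g (Metric.ball c R)) (h0 : ∀ z ∈ Metric.ball c R, g z ≠ 0)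
    (hb : ∀ z ∈ Metric.ball c R, ‖g z‖ ≤ Real.exp M * ‖g c‖) :
    ∃ l : ℂ → ℂ, (∀ z ∈ Metric.ball c R, HasDerivAt l (logDeriv g z) z) ∧
      ∀ z ∈ Metric.closedBall c (R / 2), ‖l z‖ ≤ 2 * M := by
  have hc : c ∈ Metric.ball c R := Metric.mem_ball_self hR
  have hd : DifferentiableOn ℂ (logDeriv g) (Metric.ball c R) := by
    have := (hg.deriv Metric.isOpen_ball).div hg h0
    exact this
  obtain ⟨l, hlc, hl⟩ := hd.isExactOn_ball.with_val_at c 0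
  have hgd : ∀ z ∈ Metric.ball c R, HasDerivAt g (deriv g z) z := fun z hz =>
    (hg.differentiableAt (Metric.isOpen_ball.mem_nhds hz)).hasDerivAt
  have hconst : ∀ z ∈ Metric.ball c R, g z * Complex.exp (-l z) = g c := by
    intro z hz
    have hder : ∀ w ∈ Metric.ball c R, HasDerivAt (fun w => g w * Complex.exp (-l w)) 0 w := by
      intro w hw
      have h1 := (hgd w hw).mul ((hl w hw).neg.cexp)
      refine HasDerivAt.congr_deriv h1 ?_
      have := h0 w hw
      simp only [Pi.neg_apply, logDeriv_apply]
      field_simp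
      ring
    have := (convex_ball c R).is_const_of_fderivWithin_eq_zero (𝕜 := ℂ)
      (f := fun w => g w * Complex.exp (-l w))
      (fun w hw => (hder w hw).differentiableAt.differentiableWithinAt)
      (fun w hw => by
        rw [fderivWithin_of_isOpen Metric.isOpen_ball hw, (hder w hw).hasFDerivAt.fderiv]
        simp) hz hc
    simpa [hlc] using this
  refine ⟨l, hl, fun z hz => ?_⟩
  have hre : ∀ z ∈ Metric.ball c R, (l z).re ≤ M := by
    intro z hz
    have h1 : g z = g c * Complex.exp (l z) := by
      rw [← hconst z hz, mul_assoc, ← Complex.exp_add]; simp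
    have h2 := hb z hz
    rw [h1, norm_mul, Complex.norm_exp, mul_comm] at h2
    exact Real.exp_le_exp.1 (le_of_mul_le_mul_right h2 (norm_pos_iff.2 (h0 c hc)))
  have hmem : ∀ w ∈ Metric.ball (0 : ℂ) R, c + w ∈ Metric.ball c R := by
    intro w hw; simpa [dist_eq_norm] using hw
  have hz' : ‖z - c‖ ≤ R / 2 := by simpa [dist_eq_norm] using hz
  have := Complex.borelCaratheodory_zero (f := fun w => l (c + w)) (z := z - c) (R := R) hM
    (fun w hw => ((hl _ (hmem w hw)).differentiableAt.comp w
      (by fun_prop : DifferentiableAt ℂ (fun w => c + w) w)).differentiableWithinAt)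
    (fun w hw => hre _ (hmem w hw)) hR (by simp; linarith) (by simpa using hlc)
  simp only [add_sub_cancel] at this
  refine this.trans ?_
  rw [div_le_iff₀ (by linarith)]
  nlinarith

/-- Cauchy's estimate for a logarithmic derivative at the centre of a disc without zeros. -/
theorem norm_logDeriv_le_of_bound {g : ℂ → ℂ} {c : ℂ} {R M : ℝ} (hR : 0 < R) (hM : 0 < M)
    (hg : DifferentiableOn ℂ g (Metric.ball c R)) (h0 : ∀ z ∈ Metric.ball c R, g z ≠ 0)
    (hb : ∀ z ∈ Metric.ball c R, ‖g z‖ ≤ Real.exp M * ‖g c‖) :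
    ‖logDeriv g c‖ ≤ 4 * M / R := by
  obtain ⟨l, hl, hlb⟩ := exists_log_norm_le hR hM hg h0 hb
  have hd : DifferentiableOn ℂ l (Metric.ball c R) :=
    fun z hz => (hl z hz).differentiableAt.differentiableWithinAt
  have := Complex.norm_deriv_le_of_forall_mem_sphere_norm_le (f := l) (c := c) (C := 2 * M)
    (R := R / 2) (by positivity)
    ((hd.mono (Metric.closedBall_subset_ball (by linarith))).diffContOnCl_ball subset_rfl)
    (fun z hz => hlb z (Metric.sphere_subset_closedBall hz))
  rw [(hl c (Metric.mem_ball_self hR)).deriv] at this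
  refine this.trans (le_of_eq ?_)
  field_simp
  ring

/-- A logarithmic derivative varies slowly deep inside a disc without zeros. -/
theorem norm_logDeriv_sub_le_of_bound {g : ℂ → ℂ} {c : ℂ} {R M : ℝ} (hR : 0 < R) (hM : 0 < M)
    (hg : DifferentiableOn ℂ g (Metric.ball c R)) (h0 : ∀ z ∈ Metric.ball c R, g z ≠ 0)
    (hb : ∀ z ∈ Metric.ball c R, ‖g z‖ ≤ Real.exp M * ‖g c‖) {s t : ℂ}
    (hs : s ∈ Metric.ball c (R / 4)) (ht : t ∈ Metric.ball c (R / 4)) :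
    ‖logDeriv g s - logDeriv g t‖ ≤ 128 * M / R ^ 2 * ‖s - t‖ := by
  obtain ⟨l, hl, hlb⟩ := exists_log_norm_le hR hM hg h0 hb
  have hd : DifferentiableOn ℂ l (Metric.ball c R) :=
    fun z hz => (hl z hz).differentiableAt.differentiableWithinAt
  have hd' : DifferentiableOn ℂ (logDeriv g) (Metric.ball c R) :=
    (hg.deriv Metric.isOpen_ball).div hg h0
  have h1 : ∀ z ∈ Metric.closedBall c (3 * R / 8), ‖logDeriv g z‖ ≤ 2 * M / (R / 8) := by
    intro z hz
    have hsub : Metric.closedBall z (R / 8) ⊆ Metric.closedBall c (R / 2) :=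
      Metric.closedBall_subset_closedBall' (by
        have := Metric.mem_closedBall.1 hz; linarith)
    have := Complex.norm_deriv_le_of_forall_mem_sphere_norm_le (f := l) (c := z) (C := 2 * M)
      (R := R / 8) (by positivity)
      ((hd.mono (hsub.trans (Metric.closedBall_subset_ball (by linarith)))).diffContOnCl_ball
        subset_rfl)
      (fun w hw => hlb w (hsub (Metric.sphere_subset_closedBall hw)))
    rwa [(hl z (Metric.closedBall_subset_ball (by linarith) hz)).deriv] at this
  have h2 : ∀ z ∈ Metric.ball c (R / 4), ‖deriv (logDeriv g) z‖ ≤ 128 * M / R ^ 2 := by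
    intro z hz
    have hsub : Metric.closedBall z (R / 8) ⊆ Metric.closedBall c (3 * R / 8) :=
      Metric.closedBall_subset_closedBall' (by
        have := Metric.mem_ball.1 hz; linarith)
    have := Complex.norm_deriv_le_of_forall_mem_sphere_norm_le (f := logDeriv g) (c := z)
      (C := 2 * M / (R / 8)) (R := R / 8) (by positivity)
      ((hd'.mono (hsub.trans (Metric.closedBall_subset_ball (by linarith)))).diffContOnCl_ball
        subset_rfl)
      (fun w hw => h1 w (hsub (Metric.sphere_subset_closedBall hw)))
    refine this.trans (le_of_eq ?_)
    field_simp
    ring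
  exact (convex_ball c (R / 4)).norm_image_sub_le_of_norm_deriv_le
    (fun z hz => hd'.differentiableAt (Metric.isOpen_ball.mem_nhds
      (Metric.ball_subset_ball (by linarith) hz))) h2 ht hs

/-! ### Zeros of entire functions -/

/-- A zero of finite order of an entire function can be divided out. -/
theorem Differentiable.exists_eq_pow_mul {f : ℂ → ℂ} (hf : Differentiable ℂ f) (a : ℂ) (n : ℕ)
    (hn : analyticOrderAt f a = n) :
    ∃ g : ℂ → ℂ, Differentiable ℂ g ∧ g a ≠ 0 ∧ ∀ z, f z = (z - a) ^ n * g z := by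
  induction n generalizing f with
  | zero =>
    refine ⟨f, hf, ?_, by simp⟩
    exact (hf.analyticAt a).analyticOrderAt_eq_zero.1 (by simpa using hn)
  | succ n ih =>
    have hfa : f a = 0 := by
      by_contra h
      rw [(hf.analyticAt a).analyticOrderAt_eq_zero.2 h] at hn
      exact absurd hn.symm (by exact_mod_cast n.succ_ne_zero)
    have hd : Differentiable ℂ (dslope f a) := by
      rw [← differentiableOn_univ] at hf ⊢
      exact (Complex.differentiableOn_dslope univ_mem).2 hf
    have hmul : ∀ z, f z = (z - a) * dslope f a z := by
      intro z
      have := sub_smul_dslope f a z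
      rw [smul_eq_mul, hfa, sub_zero] at this
      exact this.symm
    have hord : analyticOrderAt (dslope f a) a = n := by
      have h1 : f = (fun z => z - a) * dslope f a := funext hmul
      have h2 : analyticOrderAt (fun z : ℂ => z - a) a = 1 := by
        have : AnalyticAt ℂ (fun z : ℂ => z - a) a := by fun_prop
        exact_mod_cast (this.analyticOrderAt_eq_natCast (n := 1)).2
          ⟨fun _ => 1, analyticAt_const, one_ne_zero, by simp⟩
      rw [h1, analyticOrderAt_mul (by fun_prop) (hd.analyticAt a), h2] at hn
      have h3 : analyticOrderAt (dslope f a) a ≠ ⊤ := by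
        intro h; rw [h] at hn; exact absurd hn.symm (by norm_cast)
      lift analyticOrderAt (dslope f a) a to ℕ using h3 with k
      norm_cast at hn ⊢
      omega
    obtain ⟨g, hg, hga, hfg⟩ := ih hd hord
    exact ⟨g, hg, hga, fun z => by rw [hmul, hfg]; ring⟩

theorem Differentiable.analyticOrderAt_ne_top {f : ℂ → ℂ} (hf : Differentiable ℂ f) {c : ℂ}
    (hc : f c ≠ 0) (a : ℂ) : analyticOrderAt f a ≠ ⊤ := by
  intro h
  have h1 : f =ᶠ[𝓝 a] 0 := analyticOrderAt_eq_top.1 h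
  have := (hf.differentiableOn (s := Set.univ)).analyticOnNhd isOpen_univ
    |>.eq_of_eventuallyEq (g := 0) analyticOnNhd_const h1
  exact hc (by rw [this]; rfl)

/-- The zeros of an entire function in a finite set can be divided out simultaneously. -/
theorem Differentiable.exists_eq_prod_mul {f : ℂ → ℂ} (hf : Differentiable ℂ f) {c : ℂ}
    (hc : f c ≠ 0) (S : Finset ℂ) :
    ∃ g : ℂ → ℂ, Differentiable ℂ g ∧ (∀ a ∈ S, g a ≠ 0) ∧
      ∀ z, f z = (∏ a ∈ S, (z - a) ^ analyticOrderNatAt f a) * g z := by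
  classical
  induction S using Finset.induction_on with
  | empty => exact ⟨f, hf, by simp, by simp⟩
  | insert a S ha ih =>
    obtain ⟨g, hg, hgS, hfg⟩ := ih
    have hcg : g c ≠ 0 := by
      intro h; exact hc (by rw [hfg, h, mul_zero])
    have hga := hg.analyticOrderAt_ne_top hcg a
    have hP : AnalyticAt ℂ (fun z => ∏ b ∈ S, (z - b) ^ analyticOrderNatAt f b) a := by fun_prop
    have hord : analyticOrderAt g a = analyticOrderNatAt f a := by
      have h1 : f = (fun z => ∏ b ∈ S, (z - b) ^ analyticOrderNatAt f b) * g := funext hfg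
      have h2 : analyticOrderAt (fun z => ∏ b ∈ S, (z - b) ^ analyticOrderNatAt f b) a = 0 := by
        rw [hP.analyticOrderAt_eq_zero, Finset.prod_ne_zero_iff]
        intro b hb
        exact pow_ne_zero _ (sub_ne_zero.2 (fun h => ha (h ▸ hb)))
      have h3 : analyticOrderAt f a = analyticOrderAt g a := by
        conv_lhs => rw [h1]
        rw [analyticOrderAt_mul hP (hg.analyticAt a), h2, zero_add]
      rw [← h3, Nat.cast_analyticOrderNatAt (hf.analyticOrderAt_ne_top hc a)]
    obtain ⟨k, hk, hka, hgk⟩ := hg.exists_eq_pow_mul a _ hord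
    refine ⟨k, hk, ?_, fun z => ?_⟩
    · intro b hb
      rcases Finset.mem_insert.1 hb with rfl | hb
      · exact hka
      · intro h
        exact hgS b hb (by rw [hgk, h, mul_zero])
    · rw [hfg, hgk, Finset.prod_insert ha]; ring

/-- The zeros of a nonzero entire function do not accumulate. The point `c` only serves to exclude
the zero function. -/
theorem Differentiable.finite_zeros_inter_of_isCompact {f : ℂ → ℂ} (hf : Differentiable ℂ f)
    {c : ℂ} (hc : f c ≠ 0) {K : Set ℂ} (hK : IsCompact K) : (K ∩ f ⁻¹' {0}).Finite := by
  have han : AnalyticOnNhd ℂ f K := fun z _ => hf.analyticAt z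
  rw [han.meromorphicNFOn.zero_set_eq_divisor_support]
  · exact (MeromorphicOn.divisor f K).finiteSupport hK
  · intro u h
    rw [(hf.analyticAt _).meromorphicOrderAt_eq] at h
    exact hf.analyticOrderAt_ne_top hc u (by simpa using h)

/-- Jensen's bound for the number of zeros in a disc, counted with multiplicity. -/
theorem Differentiable.sum_analyticOrderNatAt_le {f : ℂ → ℂ} (hf : Differentiable ℂ f) {c : ℂ}
    (hc : f c ≠ 0) {r M : ℝ} (hr : 0 < r) (hM : 1 ≤ M)
    (hb : ∀ z ∈ Metric.sphere c (2 * r), ‖f z‖ ≤ M) (S : Finset ℂ)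
    (hS : ∀ a ∈ S, a ∈ Metric.closedBall c r) :
    ∑ a ∈ S, (analyticOrderNatAt f a : ℝ) ≤ Real.log (M / ‖f c‖) / Real.log 2 := by
  classical
  have han : ∀ K, AnalyticOnNhd ℂ f K := fun K z _ => hf.analyticAt z
  have h2r : |2 * r| = 2 * r := abs_of_pos (by positivity)
  have hr' : |r| = r := abs_of_pos hr
  have := AnalyticOnNhd.sum_divisor_le (c := c) (r := r) (R := 2 * r) (M := M) (f := f)
    (by rwa [hr']) (by rw [h2r, hr']; linarith) hM (han _) hc (by rwa [h2r])
  rw [mul_div_assoc, div_self hr.ne', mul_one, hr'] at this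
  refine le_trans ?_ this
  have hdiv : ∀ a ∈ Metric.closedBall c r,
      MeromorphicOn.divisor f (Metric.closedBall c r) a = (analyticOrderNatAt f a : ℤ) := by
    intro a ha
    rw [MeromorphicOn.AnalyticOnNhd.divisor_apply (han _) ha,
      ← Nat.cast_analyticOrderNatAt (hf.analyticOrderAt_ne_top hc a)]
    rfl
  set d := MeromorphicOn.divisor f (Metric.closedBall c r) with hd
  have hfin := d.finiteSupport (isCompact_closedBall c r)
  rw [finsum_eq_sum_of_support_subset (s := hfin.toFinset ∪ S) d (by
    intro a ha; simp only [Finset.coe_union, Set.Finite.coe_toFinset]; exact Or.inl ha)]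
  have h1 : ∑ a ∈ S, (analyticOrderNatAt f a : ℝ) = ((∑ a ∈ S, d a : ℤ) : ℝ) := by
    push_cast
    exact Finset.sum_congr rfl fun a ha => by rw [hdiv a (hS a ha)]; simp
  rw [h1]
  exact_mod_cast Finset.sum_le_sum_of_subset_of_nonneg Finset.subset_union_right
    fun a _ _ => (MeromorphicOn.AnalyticOnNhd.divisor_nonneg (han _)) a

/-- If the mass within radius `R` is `O(R ^ a)`, then the sum of the masses weighted by `r ^ (-b)`
converges for `b > a` (dyadic decomposition). -/
theorem summable_mul_rpow_neg_of_sum_le {ι : Type*} {m r : ι → ℝ} (hm : ∀ i, 0 ≤ m i)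
    (hr : ∀ i, 1 ≤ r i) {K a b : ℝ} (hK : 0 ≤ K) (hb : 0 ≤ b) (hab : a < b)
    (h : ∀ R : ℝ, 1 ≤ R → ∀ S : Finset ι, (∀ i ∈ S, r i ≤ R) → ∑ i ∈ S, m i ≤ K * R ^ a) :
    Summable fun i => m i * r i ^ (-b) := by
  classical
  choose k hk1 hk2 using fun i => exists_nat_pow_near (hr i) (one_lt_two : (1 : ℝ) < 2)
  have hr0 : ∀ i, 0 < r i := fun i => lt_of_lt_of_le one_pos (hr i)
  set q : ℝ := 2 ^ (a - b) with hq
  have hq0 : 0 ≤ q := by positivity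
  have hq1 : q < 1 := Real.rpow_lt_one_of_one_lt_of_neg one_lt_two (by linarith)
  have hgeo := summable_geometric_of_lt_one hq0 hq1
  refine summable_of_sum_le (c := ∑' n : ℕ, K * 2 ^ a * q ^ n)
    (fun i => mul_nonneg (hm i) (Real.rpow_nonneg (hr0 i).le _)) fun S => ?_
  rw [← Finset.sum_fiberwise_of_maps_to (t := S.image k) (g := k)
    fun i hi => Finset.mem_image_of_mem k hi]
  refine le_trans (Finset.sum_le_sum fun n _ => ?_)
    ((hgeo.mul_left (K * 2 ^ a)).sum_le_tsum _ fun n _ => by positivity)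
  have h1 : ∑ i ∈ S with k i = n, m i ≤ K * ((2 : ℝ) ^ (n + 1)) ^ a :=
    h _ (one_le_pow₀ one_le_two) _ fun i hi => by
      rw [Finset.mem_filter] at hi
      rw [← hi.2]; exact (hk2 i).le
  calc ∑ i ∈ S with k i = n, m i * r i ^ (-b)
      ≤ ∑ i ∈ S with k i = n, m i * ((2 : ℝ) ^ n) ^ (-b) := by
        refine Finset.sum_le_sum fun i hi => mul_le_mul_of_nonneg_left ?_ (hm i)
        rw [Finset.mem_filter] at hi
        refine Real.rpow_le_rpow_of_nonpos (by positivity) ?_ (by linarith)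
        rw [← hi.2]; exact hk1 i
    _ = (∑ i ∈ S with k i = n, m i) * ((2 : ℝ) ^ n) ^ (-b) := by rw [Finset.sum_mul]
    _ ≤ K * ((2 : ℝ) ^ (n + 1)) ^ a * ((2 : ℝ) ^ n) ^ (-b) := by gcongr
    _ = K * 2 ^ a * q ^ n := by
        rw [hq, ← Real.rpow_natCast, ← Real.rpow_natCast, ← Real.rpow_natCast,
          ← Real.rpow_mul zero_le_two, ← Real.rpow_mul zero_le_two, ← Real.rpow_mul zero_le_two,
          mul_assoc, mul_assoc, ← Real.rpow_add two_pos, ← Real.rpow_add two_pos]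
        congr 2
        push_cast
        ring

/-! ### Partial fractions of logarithmic derivatives -/

section Growth

variable {f : ℂ → ℂ} {c : ℂ} {C : ℝ}

/-- The zeros of an entire function of order at most `5/4` have exponent of convergence at most
`3/2`. -/
theorem Differentiable.summable_zeros_of_growth (hf : Differentiable ℂ f) (hc : f c ≠ 0)
    (hC : 0 ≤ C) (hgr : ∀ s, ‖f s‖ ≤ Real.exp (C * (1 + ‖s‖) ^ (5 / 4 : ℝ))) :
    Summable fun a : {a // f a = 0} =>
      (analyticOrderNatAt f a : ℝ) * (1 + ‖(a : ℂ) - c‖) ^ (-(3 / 2) : ℝ) := by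
  have hl2 : 0 < Real.log 2 := Real.log_pos one_lt_two
  refine summable_mul_rpow_neg_of_sum_le (a := 5 / 4)
    (K := (C * (3 + ‖c‖) ^ (5 / 4 : ℝ) + |Real.log ‖f c‖|) / Real.log 2)
    (fun _ => Nat.cast_nonneg _) (fun a => by linarith [norm_nonneg ((a : ℂ) - c)]) (by positivity)
    (by norm_num) (by norm_num) fun R hR S hS => ?_
  have hR0 : 0 < R := by linarith
  set M := Real.exp (C * ((3 + ‖c‖) * R) ^ (5 / 4 : ℝ)) with hMdef
  have h1 := hf.sum_analyticOrderNatAt_le hc (r := R) (M := M) hR0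
    (Real.one_le_exp (by positivity)) (fun z hz => (hgr z).trans ?_)
    (S.map ⟨_, Subtype.val_injective⟩) ?_
  · rw [Finset.sum_map] at h1
    refine h1.trans ?_
    rw [div_mul_eq_mul_div]
    gcongr
    rw [Real.log_div (Real.exp_pos _).ne' (norm_ne_zero_iff.2 hc), Real.log_exp,
      Real.mul_rpow (by positivity) hR0.le]
    have h2 : 1 ≤ R ^ (5 / 4 : ℝ) := Real.one_le_rpow hR (by norm_num)
    have h3 : -Real.log ‖f c‖ ≤ |Real.log ‖f c‖| := neg_le_abs _
    nlinarith [abs_nonneg (Real.log ‖f c‖)]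
  · rw [hMdef]
    gcongr
    have h2 : ‖z‖ ≤ ‖z - c‖ + ‖c‖ := by simpa using norm_add_le (z - c) c
    rw [mem_sphere_iff_norm] at hz
    nlinarith [norm_nonneg c]
  · intro a ha
    obtain ⟨b, hb, rfl⟩ := Finset.mem_map.1 ha
    have := hS b hb
    simp only [Function.Embedding.coeFn_mk, Metric.mem_closedBall, dist_eq_norm]
    linarith

theorem tendsto_finset_subtype_closedBall {p : ℂ → Prop} [DecidablePred p] {c : ℂ}
    (hfin : ∀ R : ℝ, (Metric.closedBall c R ∩ {a | p a}).Finite) :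
    Tendsto (fun n : ℕ => (hfin n).toFinset.subtype p) atTop atTop := by
  refine tendsto_atTop_finset_of_monotone (fun n k hnk a ha => ?_) fun a => ?_
  · simp only [Finset.mem_subtype, Set.Finite.mem_toFinset] at ha ⊢
    exact ⟨Metric.closedBall_subset_closedBall (by exact_mod_cast hnk) ha.1, ha.2⟩
  · obtain ⟨n, hn⟩ := exists_nat_ge (dist (a : ℂ) c)
    exact ⟨n, by simpa using hn⟩

/-- The terms `1/(s - a) - 1/(t - a)` are `O(‖a - c‖⁻²)`, hence summable over the zeros. -/
theorem Differentiable.summable_sub_inv_zeros (hf : Differentiable ℂ f) (hc : f c ≠ 0)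
    (hC : 0 ≤ C) (hgr : ∀ s, ‖f s‖ ≤ Real.exp (C * (1 + ‖s‖) ^ (5 / 4 : ℝ))) (s t : ℂ) :
    Summable fun a : {a // f a = 0} =>
      (analyticOrderNatAt f a : ℂ) * (1 / (s - a) - 1 / (t - a)) := by
  have hsum := hf.summable_zeros_of_growth hc hC hgr
  set B : ℝ := ‖s - c‖ + ‖t - c‖ + 1 with hB
  have hB1 : 1 ≤ B := by linarith [norm_nonneg (s - c), norm_nonneg (t - c)]
  refine Summable.of_norm_bounded_eventually
    (hsum.mul_left (‖t - s‖ * 16)) ?_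
  have hfin := hf.finite_zeros_inter_of_isCompact hc (isCompact_closedBall c (2 * B))
  have hfin' : {a : {a // f a = 0} | (a : ℂ) ∈ Metric.closedBall c (2 * B)}.Finite := by
    refine Set.Finite.of_finite_image (f := Subtype.val) (hfin.subset ?_)
      Subtype.val_injective.injOn
    rintro _ ⟨a, ha, rfl⟩
    exact ⟨ha, a.2⟩
  refine hfin'.subset fun a ha => ?_
  by_contra hnot
  apply ha
  simp only [Set.mem_ofPred_eq, Metric.mem_closedBall, dist_eq_norm, not_le] at hnot
  set x := ‖(a : ℂ) - c‖ with hx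
  have hs1 : x / 2 ≤ ‖s - a‖ := by
    have : x ≤ ‖s - a‖ + ‖s - c‖ := by
      rw [hx, norm_sub_rev s]; simpa using norm_add_le ((a : ℂ) - s) (s - c)
    linarith [norm_nonneg (t - c)]
  have ht1 : x / 2 ≤ ‖t - a‖ := by
    have : x ≤ ‖t - a‖ + ‖t - c‖ := by
      rw [hx, norm_sub_rev t]; simpa using norm_add_le ((a : ℂ) - t) (t - c)
    linarith [norm_nonneg (s - c)]
  have hx2 : 2 ≤ x := by linarith
  have hs0 : s - a ≠ 0 := by rw [← norm_pos_iff]; linarith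
  have ht0 : t - a ≠ 0 := by rw [← norm_pos_iff]; linarith
  have heq : 1 / (s - a) - 1 / (t - a) = (t - s) / ((s - a) * (t - a)) := by
    field_simp; ring
  change ‖(analyticOrderNatAt f a : ℂ) * (1 / (s - a) - 1 / (t - a))‖ ≤ _
  rw [heq, norm_mul, norm_div, norm_mul, Complex.norm_natCast, mul_left_comm]
  refine mul_le_mul_of_nonneg_left ?_ (Nat.cast_nonneg _)
  have h1 : (1 + x) ^ (-2 : ℝ) ≤ (1 + x) ^ (-(3 / 2) : ℝ) :=
    Real.rpow_le_rpow_of_exponent_le (by linarith) (by norm_num)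
  refine le_trans ?_ (mul_le_mul_of_nonneg_left h1 (by positivity))
  rw [Real.rpow_neg (by linarith), Real.rpow_two, div_eq_mul_inv, mul_assoc]
  refine mul_le_mul_of_nonneg_left ?_ (norm_nonneg _)
  have h2 : (1 + x) ^ 2 / 16 ≤ ‖s - a‖ * ‖t - a‖ := by
    have : (x / 2) * (x / 2) ≤ ‖s - a‖ * ‖t - a‖ := by gcongr
    nlinarith
  calc (‖s - a‖ * ‖t - a‖)⁻¹ ≤ ((1 + x) ^ 2 / 16)⁻¹ := by gcongr
    _ = 16 * ((1 + x) ^ 2)⁻¹ := by field_simp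

/-- The error made by keeping only the zeros with `‖a - c‖ ≤ R` in the partial fraction expansion
of the logarithmic derivative. -/
theorem Differentiable.norm_logDeriv_sub_sum_le (hf : Differentiable ℂ f) (hc : f c ≠ 0)
    (hC : 0 ≤ C) (hgr : ∀ s, ‖f s‖ ≤ Real.exp (C * (1 + ‖s‖) ^ (5 / 4 : ℝ))) {s t : ℂ}
    (hs : f s ≠ 0) (ht : f t ≠ 0) {R : ℝ} (hR : 1 ≤ R) (hsR : s ∈ Metric.ball c (R / 4))
    (htR : t ∈ Metric.ball c (R / 4)) (S : Finset ℂ)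
    (hS : ∀ a, a ∈ S ↔ a ∈ Metric.closedBall c R ∧ f a = 0) :
    ‖logDeriv f s - logDeriv f t -
        ∑ a ∈ S, (analyticOrderNatAt f a : ℂ) * (1 / (s - a) - 1 / (t - a))‖ ≤
      128 * (C * (4 + ‖c‖) ^ (5 / 4 : ℝ) + |Real.log ‖f c‖| + 1) * R ^ (-(3 / 4) : ℝ) *
        ‖s - t‖ := by
  have hR0 : 0 < R := by linarith
  obtain ⟨g, hg, hgS, hfg⟩ := hf.exists_eq_prod_mul hc S
  have hg0 : ∀ z, f z ≠ 0 → g z ≠ 0 := fun z hz h => hz (by rw [hfg, h, mul_zero])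
  have hgb : ∀ z ∈ Metric.ball c R, g z ≠ 0 := by
    intro z hz
    by_cases h : f z = 0
    · exact hgS z ((hS z).2 ⟨Metric.ball_subset_closedBall hz, h⟩)
    · exact hg0 z h
  have hlog : ∀ z, f z ≠ 0 → logDeriv f z =
      ∑ a ∈ S, (analyticOrderNatAt f a : ℂ) * (1 / (z - a)) + logDeriv g z := by
    intro z hz
    have hza : ∀ a ∈ S, z - a ≠ 0 := fun a ha h =>
      hz (by rw [sub_eq_zero.1 h]; exact ((hS a).1 ha).2)
    have hfe : f = fun z => (∏ a ∈ S, (z - a) ^ analyticOrderNatAt f a) * g z := funext hfg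
    conv_lhs => rw [hfe]
    rw [logDeriv_mul z (Finset.prod_ne_zero_iff.2 fun a ha => pow_ne_zero _ (hza a ha)) (hg0 z hz)
      (by fun_prop) hg.differentiableAt]
    congr 1
    rw [logDeriv_prod (f := fun a z => (z - a) ^ analyticOrderNatAt f a)
      (fun a ha => pow_ne_zero _ (hza a ha)) (fun a _ => by fun_prop)]
    refine Finset.sum_congr rfl fun a ha => ?_
    rw [logDeriv_fun_pow (f := fun z => z - a) (by fun_prop)]
    congr 1
    rw [logDeriv_apply]
    simp
  set M := (C * (4 + ‖c‖) ^ (5 / 4 : ℝ) + |Real.log ‖f c‖| + 1) * R ^ (5 / 4 : ℝ) with hMdef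
  have hM : 0 < M := by positivity
  -- at distance `3 * R` from `c` the factors `z - a` divided out are larger than at `c`
  have hsphere : ∀ z ∈ Metric.sphere c (3 * R), ‖g z‖ ≤ Real.exp M * ‖g c‖ := by
    intro z hz
    rw [mem_sphere_iff_norm] at hz
    have hP : ∏ a ∈ S, ‖c - a‖ ^ analyticOrderNatAt f a ≤
        ∏ a ∈ S, ‖z - a‖ ^ analyticOrderNatAt f a := by
      refine Finset.prod_le_prod (fun _ _ => by positivity) fun a ha => ?_
      gcongr
      have h1 := ((hS a).1 ha).1
      rw [mem_closedBall_iff_norm, norm_sub_rev] at h1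
      have h2 : ‖z - c‖ ≤ ‖z - a‖ + ‖c - a‖ := by
        rw [norm_sub_rev c]; simpa using norm_add_le (z - a) (a - c)
      linarith
    have hfz : ‖f z‖ = (∏ a ∈ S, ‖z - a‖ ^ analyticOrderNatAt f a) * ‖g z‖ := by
      rw [hfg z, norm_mul, norm_prod]; simp
    have hfc : ‖f c‖ = (∏ a ∈ S, ‖c - a‖ ^ analyticOrderNatAt f a) * ‖g c‖ := by
      rw [hfg c, norm_mul, norm_prod]; simp
    have hfc0 : 0 < ‖f c‖ := norm_pos_iff.2 hc
    have h1 : ‖g z‖ * ‖f c‖ ≤ ‖f z‖ * ‖g c‖ := by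
      rw [hfz, hfc]
      calc ‖g z‖ * ((∏ a ∈ S, ‖c - a‖ ^ analyticOrderNatAt f a) * ‖g c‖)
          ≤ ‖g z‖ * ((∏ a ∈ S, ‖z - a‖ ^ analyticOrderNatAt f a) * ‖g c‖) := by gcongr
        _ = _ := by ring
    have h2 : ‖f z‖ ≤ Real.exp M * ‖f c‖ := by
      refine (hgr z).trans ?_
      conv_rhs => rw [← Real.exp_log hfc0, ← Real.exp_add]
      refine Real.exp_le_exp.2 ?_
      have h3 : (1 + ‖z‖) ^ (5 / 4 : ℝ) ≤ (4 + ‖c‖) ^ (5 / 4 : ℝ) * R ^ (5 / 4 : ℝ) := by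
        rw [← Real.mul_rpow (by positivity) hR0.le]
        gcongr
        have : ‖z‖ ≤ ‖z - c‖ + ‖c‖ := by simpa using norm_add_le (z - c) c
        nlinarith [norm_nonneg c]
      have h4 : 1 ≤ R ^ (5 / 4 : ℝ) := Real.one_le_rpow hR (by norm_num)
      have h5 := neg_abs_le (Real.log ‖f c‖)
      have h6 := mul_le_mul_of_nonneg_left h3 hC
      have h7 : |Real.log ‖f c‖| ≤ |Real.log ‖f c‖| * R ^ (5 / 4 : ℝ) :=
        le_mul_of_one_le_right (abs_nonneg _) h4
      rw [hMdef]
      nlinarith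
    have h3 : ‖g z‖ * ‖f c‖ ≤ (Real.exp M * ‖g c‖) * ‖f c‖ :=
      h1.trans (by nlinarith [norm_nonneg (g c)])
    exact le_of_mul_le_mul_right h3 hfc0
  -- the maximum principle carries the bound into the disc where `g` has no zeros
  have hball : ∀ z ∈ Metric.ball c R, ‖g z‖ ≤ Real.exp M * ‖g c‖ := by
    intro z hz
    refine Complex.norm_le_of_forall_mem_frontier_norm_le (U := Metric.ball c (3 * R))
      Metric.isBounded_ball hg.diffContOnCl (fun w hw => ?_)
      (subset_closure (Metric.ball_subset_ball (by linarith) hz))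
    rw [frontier_ball _ (by positivity)] at hw
    exact hsphere w hw
  have hmain := norm_logDeriv_sub_le_of_bound hR0 hM hg.differentiableOn hgb hball hsR htR
  rw [hlog s hs, hlog t ht]
  have : ∑ a ∈ S, (analyticOrderNatAt f a : ℂ) * (1 / (s - a)) + logDeriv g s -
      (∑ a ∈ S, (analyticOrderNatAt f a : ℂ) * (1 / (t - a)) + logDeriv g t) -
      ∑ a ∈ S, (analyticOrderNatAt f a : ℂ) * (1 / (s - a) - 1 / (t - a)) =
      logDeriv g s - logDeriv g t := by
    simp only [mul_sub, Finset.sum_sub_distrib]; ring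
  rw [this]
  refine hmain.trans (le_of_eq ?_)
  have : R ^ (5 / 4 : ℝ) / R ^ 2 = R ^ (-(3 / 4) : ℝ) := by
    rw [← Real.rpow_two, ← Real.rpow_sub hR0]; norm_num
  rw [hMdef, ← this]
  ring

/-- The partial fraction expansion of the logarithmic derivative of an entire function of order
at most `5/4`. Differences of two values are taken, so that no constant from the Hadamard
product appears. -/
theorem Differentiable.hasSum_logDeriv_sub (hf : Differentiable ℂ f) (hc : f c ≠ 0)
    (hC : 0 ≤ C) (hgr : ∀ s, ‖f s‖ ≤ Real.exp (C * (1 + ‖s‖) ^ (5 / 4 : ℝ))) {s t : ℂ}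
    (hs : f s ≠ 0) (ht : f t ≠ 0) :
    HasSum (fun a : {a // f a = 0} =>
      (analyticOrderNatAt f a : ℂ) * (1 / (s - a) - 1 / (t - a)))
      (logDeriv f s - logDeriv f t) := by
  classical
  have hsum := hf.summable_sub_inv_zeros hc hC hgr s t
  have hfin : ∀ R : ℝ, (Metric.closedBall c R ∩ {a | f a = 0}).Finite := fun R =>
    hf.finite_zeros_inter_of_isCompact hc (isCompact_closedBall c R)
  have hlim := hsum.hasSum.comp (tendsto_finset_subtype_closedBall hfin)
  have hlim2 : Tendsto (fun n : ℕ => ∑ a ∈ (hfin n).toFinset.subtype (fun a => f a = 0),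
      (analyticOrderNatAt f a : ℂ) * (1 / (s - a) - 1 / (t - a))) atTop
      (𝓝 (logDeriv f s - logDeriv f t)) := by
    rw [tendsto_iff_norm_sub_tendsto_zero]
    set B := 128 * (C * (4 + ‖c‖) ^ (5 / 4 : ℝ) + |Real.log ‖f c‖| + 1)
    have hz : Tendsto (fun n : ℕ => B * (n : ℝ) ^ (-(3 / 4) : ℝ) * ‖s - t‖) atTop (𝓝 0) := by
      have := (tendsto_rpow_neg_atTop (y := 3 / 4) (by norm_num)).comp
        (tendsto_natCast_atTop_atTop (R := ℝ))
      simpa using (this.const_mul B).mul_const ‖s - t‖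
    refine squeeze_zero' (Eventually.of_forall fun _ => norm_nonneg _) ?_ hz
    obtain ⟨N, hN⟩ := exists_nat_gt (4 * (‖s - c‖ + ‖t - c‖) + 1)
    filter_upwards [eventually_ge_atTop N] with n hn
    have hn' : (N : ℝ) ≤ n := by exact_mod_cast hn
    have hs' := norm_nonneg (s - c)
    have ht' := norm_nonneg (t - c)
    rw [Finset.sum_subtype_of_mem (p := fun a => f a = 0)
      (fun a => (analyticOrderNatAt f a : ℂ) * (1 / (s - a) - 1 / (t - a)))
      (fun a ha => ((hfin n).mem_toFinset.1 ha).2), norm_sub_rev]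
    refine hf.norm_logDeriv_sub_sum_le hc hC hgr hs ht (R := n) (by linarith) ?_ ?_ _ ?_
    · rw [mem_ball_iff_norm]; linarith
    · rw [mem_ball_iff_norm]; linarith
    · intro a; simp
  have := tendsto_nhds_unique hlim hlim2
  rw [← this]
  exact hsum.hasSum

end Growth

/-! ### Bounds for the Gamma and digamma functions -/

theorem Complex.differentiableAt_Gamma_of_re_pos {s : ℂ} (hs : 0 < s.re) :
    DifferentiableAt ℂ Gamma s := by
  refine Complex.differentiableAt_Gamma s fun m h => ?_
  rw [h] at hs
  have : (0 : ℝ) ≤ m := Nat.cast_nonneg m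
  simp at hs
  linarith

/-- `‖B(u, v)‖ ≤ B(Re u, Re v)`, which decreases in both arguments. -/
theorem exists_norm_betaIntegral_le {a b : ℝ} (ha : 0 < a) (hb : 0 < b) :
    ∃ K : ℝ, 0 ≤ K ∧ ∀ u v : ℂ, a ≤ u.re → b ≤ v.re → ‖Complex.betaIntegral u v‖ ≤ K := by
  have hint := (Complex.betaIntegral_convergent (u := a) (v := b) (by simpa) (by simpa)).norm
  refine ⟨|∫ x in (0 : ℝ)..1, ‖(x : ℂ) ^ ((a : ℂ) - 1) * (1 - (x : ℂ)) ^ ((b : ℂ) - 1)‖|,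
    abs_nonneg _, fun u v hu hv => ?_⟩
  refine (intervalIntegral.norm_integral_le_of_norm_le zero_le_one ?_ hint).trans (le_abs_self _)
  filter_upwards [(measure_singleton (1 : ℝ) : volume {(1 : ℝ)} = 0) |> compl_mem_ae_iff.2]
    with x hx1 hx
  have hx1' : x < 1 := lt_of_le_of_ne hx.2 hx1
  have hx0 : 0 < 1 - x := by linarith
  have hc : (1 - x : ℂ) = ((1 - x : ℝ) : ℂ) := by push_cast; ring
  rw [norm_mul, norm_mul, hc, Complex.norm_cpow_eq_rpow_re_of_pos hx.1,
    Complex.norm_cpow_eq_rpow_re_of_pos hx.1, Complex.norm_cpow_eq_rpow_re_of_pos hx0,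
    Complex.norm_cpow_eq_rpow_re_of_pos hx0]
  refine mul_le_mul (Real.rpow_le_rpow_of_exponent_ge hx.1 hx.2 ?_)
    (Real.rpow_le_rpow_of_exponent_ge hx0 (by linarith [hx.1]) ?_) (Real.rpow_nonneg hx0.le _)
    (Real.rpow_nonneg hx.1.le _)
  · simpa using hu
  · simpa using hv

/-- Slow growth of the digamma function along vertical lines. Near `z` the Beta integral bounds
`Γ(w) / Γ(z)` by a multiple of `‖z‖`, and the Borel–Carathéodory theorem turns this into a
logarithmic bound for `Γ'/Γ`. -/
theorem exists_norm_digamma_le {a : ℝ} (ha : 0 < a) :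
    ∃ C : ℝ, 0 ≤ C ∧ ∀ z : ℂ, z.re = a → ‖digamma z‖ ≤ C * (1 + |z.im|) ^ (1 / 8 : ℝ) := by
  set r : ℝ := min a 1 / 2 with hr
  have hr0 : 0 < r := by positivity
  have hra : r ≤ a / 2 := by rw [hr]; gcongr; exact min_le_left _ _
  have hr1 : r ≤ 1 / 2 := by rw [hr]; gcongr; exact min_le_right _ _
  obtain ⟨K, hK0, hK⟩ := exists_norm_betaIntegral_le (a := a / 2) (b := 1 / 2) (by positivity)
    (by norm_num)
  obtain ⟨B, hB⟩ := (isCompact_closedBall (1 : ℂ) (1 / 2)).exists_bound_of_continuousOn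
    Complex.differentiable_one_div_Gamma.continuous.continuousOn
  have hB0 : 0 ≤ B := (norm_nonneg _).trans (hB 1 (by simp))
  -- `Γ(w) Γ(1 + z - w) = Γ(z + 1) B(w, 1 + z - w)`, where `1 + z - w` stays near `1`
  have hmain : ∀ z : ℂ, z.re = a → ∀ w ∈ Metric.ball z r,
      0 < w.re ∧ ‖Gamma w‖ ≤ K * B * ‖z‖ * ‖Gamma z‖ := by
    intro z hz w hw
    rw [mem_ball_iff_norm] at hw
    have hre : |w.re - a| < r := by
      rw [← hz, ← Complex.sub_re]; exact (Complex.abs_re_le_norm _).trans_lt hw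
    have hre' := abs_lt.1 hre
    have hz0 : z ≠ 0 := fun h => by rw [h] at hz; simp at hz; linarith
    have hv : (1 + z - w).re ≥ 1 / 2 := by
      simp only [Complex.sub_re, Complex.add_re, Complex.one_re, hz]; linarith
    have hvb : 1 + z - w ∈ Metric.closedBall (1 : ℂ) (1 / 2) := by
      rw [mem_closedBall_iff_norm, add_sub_assoc, add_sub_cancel_left, norm_sub_rev]
      linarith
    have hwre : 0 < w.re := by linarith
    refine ⟨hwre, ?_⟩
    have h1 := Complex.Gamma_mul_Gamma_eq_betaIntegral hwre (t := 1 + z - w) (by linarith)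
    rw [show w + (1 + z - w) = z + 1 by ring, Complex.Gamma_add_one z hz0] at h1
    have hne : Gamma (1 + z - w) ≠ 0 := Complex.Gamma_ne_zero_of_re_pos (by linarith)
    have h2 : Gamma w = z * Gamma z * betaIntegral w (1 + z - w) * (Gamma (1 + z - w))⁻¹ := by
      rw [← h1]; field_simp
    rw [h2, norm_mul, norm_mul, norm_mul]
    have h3 := hB _ hvb
    have h4 := hK w (1 + z - w) (by linarith) hv
    calc ‖z‖ * ‖Gamma z‖ * ‖betaIntegral w (1 + z - w)‖ * ‖(Gamma (1 + z - w))⁻¹‖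
        ≤ ‖z‖ * ‖Gamma z‖ * K * B := by gcongr
      _ = _ := by ring
  set A := 2 + K * B * (a + 1) with hA
  refine ⟨4 * (A ^ (1 / 8 : ℝ) / (1 / 8)) / r, by positivity, fun z hz => ?_⟩
  set M := Real.log (2 + K * B * ‖z‖) with hM
  have hM0 : 0 < M := Real.log_pos (by
    have : 0 ≤ K * B * ‖z‖ := by positivity
    linarith)
  have hexp : Real.exp M = 2 + K * B * ‖z‖ := Real.exp_log (by positivity)
  have hd := norm_logDeriv_le_of_bound (g := Gamma) (c := z) hr0 hM0
    (fun w hw => (Complex.differentiableAt_Gamma_of_re_pos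
      (hmain z hz w hw).1).differentiableWithinAt)
    (fun w hw => Complex.Gamma_ne_zero_of_re_pos (hmain z hz w hw).1)
    (fun w hw => (hmain z hz w hw).2.trans (by
      rw [hexp]
      gcongr
      linarith))
  rw [digamma_def]
  refine hd.trans ?_
  have hMle : M ≤ A ^ (1 / 8 : ℝ) / (1 / 8) * (1 + |z.im|) ^ (1 / 8 : ℝ) := by
    have h1 : M ≤ (2 + K * B * ‖z‖) ^ (1 / 8 : ℝ) / (1 / 8) :=
      Real.log_le_rpow_div (by positivity) (by norm_num)
    have h2 : 2 + K * B * ‖z‖ ≤ A * (1 + |z.im|) := by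
      have h3 : ‖z‖ ≤ a + |z.im| := by
        have := Complex.norm_le_abs_re_add_abs_im z
        rwa [hz, abs_of_pos ha] at this
      have h4 : K * B * ‖z‖ ≤ K * B * (a + |z.im|) := by gcongr
      have h5 := abs_nonneg z.im
      have h6 : 0 ≤ K * B := by positivity
      rw [hA]
      nlinarith [mul_nonneg h6 h5, mul_nonneg (mul_nonneg h6 ha.le) h5]
    calc M ≤ (2 + K * B * ‖z‖) ^ (1 / 8 : ℝ) / (1 / 8) := h1
      _ ≤ (A * (1 + |z.im|)) ^ (1 / 8 : ℝ) / (1 / 8) := by gcongr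
      _ = _ := by rw [Real.mul_rpow (by positivity) (by positivity)]; ring
  calc 4 * M / r ≤ 4 * (A ^ (1 / 8 : ℝ) / (1 / 8) * (1 + |z.im|) ^ (1 / 8 : ℝ)) / r := by gcongr
    _ = _ := by ring

/-- A crude form of Stirling's upper bound on the positive real axis. -/
theorem exists_Gamma_le_exp {a : ℝ} (ha : 0 < a) :
    ∃ C : ℝ, 0 ≤ C ∧ ∀ x : ℝ, a ≤ x → Real.Gamma x ≤ Real.exp (C * (1 + x) ^ (5 / 4 : ℝ)) := by
  obtain ⟨B, hB⟩ := (isCompact_Icc (a := a) (b := 2)).exists_bound_of_continuousOn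
    (f := Real.Gamma) fun x hx =>
      (Real.differentiableAt_Gamma fun m => by
        have : (0 : ℝ) ≤ m := Nat.cast_nonneg m
        linarith [hx.1]).continuousAt.continuousWithinAt
  refine ⟨16 + |Real.log B|, by positivity, fun x hx => ?_⟩
  have hx0 : 0 < x := lt_of_lt_of_le ha hx
  have hone : 1 ≤ (1 + x) ^ (5 / 4 : ℝ) := Real.one_le_rpow (by linarith) (by norm_num)
  rcases le_total x 2 with h2 | h2
  · have h3 := hB x ⟨hx, h2⟩
    have h4 : 0 < Real.Gamma x := Real.Gamma_pos_of_pos hx0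
    rw [Real.norm_of_nonneg h4.le] at h3
    refine h3.trans ?_
    rw [← Real.exp_log (h4.trans_le h3)]
    rw [Real.exp_le_exp, Real.log_exp]
    nlinarith [le_abs_self (Real.log B), abs_nonneg (Real.log B)]
  · set n := ⌈x⌉₊ with hn
    have hxn : x ≤ n := Nat.le_ceil x
    have hnx : (n : ℝ) ≤ 1 + x := by linarith [Nat.ceil_lt_add_one hx0.le]
    have hn0 : (0 : ℝ) < n := by linarith
    have h3 : Real.Gamma x ≤ Real.Gamma (n + 1) :=
      Real.Gamma_strictMonoOn_Ici.monotoneOn h2 (by simp only [Set.mem_Ici]; linarith) (by linarith)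
    rw [Real.Gamma_nat_eq_factorial] at h3
    have h4 : ((n.factorial : ℕ) : ℝ) ≤ (n : ℝ) ^ n := by exact_mod_cast Nat.factorial_le_pow n
    refine (h3.trans h4).trans ?_
    rw [← Real.rpow_natCast, Real.rpow_def_of_pos hn0, Real.exp_le_exp]
    have h5 : Real.log n ≤ (1 + x) ^ (1 / 4 : ℝ) / (1 / 4) :=
      (Real.log_le_log hn0 hnx).trans (Real.log_le_rpow_div (by linarith) (by norm_num))
    have h6 : (1 + x) ^ (5 / 4 : ℝ) = (1 + x) ^ (1 / 4 : ℝ) * (1 + x) := by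
      rw [← Real.rpow_add_one (by linarith)]; norm_num
    have h7 : 0 ≤ (1 + x) ^ (1 / 4 : ℝ) := by positivity
    have h8 : 0 ≤ Real.log n := Real.log_nonneg (by linarith)
    rw [h6]
    have h9 : Real.log n * n ≤ (1 + x) ^ (1 / 4 : ℝ) / (1 / 4) * (1 + x) := by gcongr
    nlinarith [abs_nonneg (Real.log B), mul_nonneg h7 (by linarith : 0 ≤ 1 + x),
      mul_nonneg (abs_nonneg (Real.log B)) (mul_nonneg h7 (by linarith : 0 ≤ 1 + x))]

theorem norm_Gamma_le_Gamma_re {s : ℂ} (hs : 0 < s.re) : ‖Gamma s‖ ≤ Real.Gamma s.re := by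
  rw [Complex.Gamma_eq_integral hs, Real.Gamma_eq_integral hs, Complex.GammaIntegral]
  refine (norm_integral_le_integral_norm _).trans (le_of_eq ?_)
  refine setIntegral_congr_fun measurableSet_Ioi fun x hx => ?_
  simp only [norm_mul, Complex.norm_cpow_eq_rpow_re_of_pos hx, Complex.sub_re, Complex.one_re]
  rw [Complex.norm_real, Real.norm_of_nonneg (Real.exp_pos _).le]

/-! ### The completed function and its functional equation -/

/-- The holomorphic model of `ξ_F` on the half-plane `Re s ≥ 1/2`, in terms of the entire function
`G s = (s - 1) ^ m * F s`. Unlike the product defining `ξ_F`, it takes the right value at `s = 1`,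
where `F` itself may be arbitrary. -/
noncomputable def xiModel (G : ℂ → ℂ) (m : ℕ) (D : GammaData) (s : ℂ) : ℂ :=
  s ^ m * ((-1) ^ m * G s) * (D.Q : ℂ) ^ s *
    ∏ j : Fin D.r, Complex.Gamma ((D.lam j : ℂ) * s + D.mu j)

/-- The condition `Re (λ + 2μ) > 0` keeps the poles of the Gamma factors out of `Re s ≥ 1/2`. -/
theorem GammaData.re_arg_pos (D : GammaData) (j : Fin D.r) {s : ℂ} (hs : 1 / 2 ≤ s.re) :
    0 < ((D.lam j : ℂ) * s + D.mu j).re := by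
  have h1 := D.lam_pos j
  have h2 := D.lam_add_mu_re j
  simp only [Complex.add_re, Complex.mul_re, Complex.ofReal_re, Complex.ofReal_im, zero_mul,
    sub_zero]
  nlinarith

theorem GammaData.Q_ne_zero (D : GammaData) : (D.Q : ℂ) ≠ 0 := by
  exact_mod_cast D.Q_pos.ne'

theorem differentiableAt_xiModel {G : ℂ → ℂ} (hG : Differentiable ℂ G) (m : ℕ) (D : GammaData)
    {s : ℂ} (hs : ∀ j, 0 < ((D.lam j : ℂ) * s + D.mu j).re) :
    DifferentiableAt ℂ (xiModel G m D) s := by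
  have h1 : DifferentiableAt ℂ (fun s : ℂ => (D.Q : ℂ) ^ s) s :=
    differentiableAt_id.const_cpow (Or.inl D.Q_ne_zero)
  have h2 : DifferentiableAt ℂ
      (fun s : ℂ => ∏ j : Fin D.r, Complex.Gamma ((D.lam j : ℂ) * s + D.mu j)) s := by
    refine DifferentiableAt.fun_finsetProd fun j _ => ?_
    exact (Complex.differentiableAt_Gamma_of_re_pos (hs j)).comp s
      (f := fun s : ℂ => (D.lam j : ℂ) * s + D.mu j) (by fun_prop)
  have h3 : DifferentiableAt ℂ (fun s : ℂ => s ^ m * ((-1) ^ m * G s)) s := by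
    have := hG s
    fun_prop
  exact (h3.mul h1).mul h2

theorem meromorphic_xiModel {G : ℂ → ℂ} (hG : Differentiable ℂ G) (m : ℕ) (D : GammaData) :
    Meromorphic (xiModel G m D) := by
  intro s
  have h1 : AnalyticAt ℂ (fun s : ℂ => s ^ m * ((-1) ^ m * G s) * (D.Q : ℂ) ^ s) s := by
    have h : Differentiable ℂ (fun s : ℂ => s ^ m * ((-1) ^ m * G s) * (D.Q : ℂ) ^ s) := by
      have h1 : Differentiable ℂ (fun s : ℂ => (D.Q : ℂ) ^ s) :=
        differentiable_id.const_cpow (Or.inl D.Q_ne_zero)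
      fun_prop
    exact h.analyticAt s
  have h2 : MeromorphicAt
      (fun s : ℂ => ∏ j : Fin D.r, Complex.Gamma ((D.lam j : ℂ) * s + D.mu j)) s := by
    refine MeromorphicAt.fun_prod fun j _ => ?_
    exact (Meromorphic.Gamma _).comp_analyticAt
      (g := fun s : ℂ => (D.lam j : ℂ) * s + D.mu j) (by fun_prop)
  exact h1.meromorphicAt.mul h2

section SharpFlat

variable {F : ℂ → ℂ} {D : GammaData}

theorem IsSharpFlat.hasEntireMultiple (hF : IsSharpFlat F D) :
    HasEntireMultiple F (polarOrder F) :=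
  Nat.sInf_mem hF.continuation

theorem completedProduct_eq_xiModel {G : ℂ → ℂ} (D : GammaData)
    (hG : ∀ s : ℂ, s ≠ 1 → G s = (s - 1) ^ polarOrder F * F s) {s : ℂ} (hs : s ≠ 1) :
    completedProduct F D s = xiModel G (polarOrder F) D s := by
  rw [completedProduct, xiModel, hG s hs, show (1 - s) = (-1) * (s - 1) by ring, mul_pow]
  ring

/-- Near a point of `Re s ≥ 1/2` the completed function is its holomorphic model: both are in
meromorphic normal form there and agree off a discrete set. -/
theorem completedXi_eventuallyEq {G : ℂ → ℂ} (D : GammaData) (hGd : Differentiable ℂ G)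
    (hG : ∀ s : ℂ, s ≠ 1 → G s = (s - 1) ^ polarOrder F * F s) {s : ℂ} (hs : 1 / 2 ≤ s.re) :
    completedXi F D =ᶠ[𝓝 s] xiModel G (polarOrder F) D := by
  have hcongr : ∀ z, completedProduct F D =ᶠ[𝓝[≠] z] xiModel G (polarOrder F) D := by
    intro z
    have h1 : ∀ᶠ w in 𝓝[≠] z, w ≠ 1 := by
      by_cases hz : z = 1
      · rw [hz]; exact self_mem_nhdsWithin
      · exact (isOpen_ne.mem_nhds hz) |> mem_nhdsWithin_of_mem_nhds
    filter_upwards [h1] with w hw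
    exact completedProduct_eq_xiModel D hG hw
  have hmer : MeromorphicOn (completedProduct F D) Set.univ := fun z _ =>
    (meromorphic_xiModel hGd _ D z).congr (hcongr z).symm
  have han : AnalyticAt ℂ (xiModel G (polarOrder F) D) s := by
    have hopen : IsOpen {z : ℂ | ∀ j, 0 < ((D.lam j : ℂ) * z + D.mu j).re} := by
      simp only [Set.ofPred_forall]
      exact isOpen_iInter_of_finite fun j => isOpen_lt continuous_const (by fun_prop)
    have hd : DifferentiableOn ℂ (xiModel G (polarOrder F) D)
        {z : ℂ | ∀ j, 0 < ((D.lam j : ℂ) * z + D.mu j).re} :=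
      fun z hz => (differentiableAt_xiModel hGd _ D hz).differentiableWithinAt
    exact hd.analyticAt (hopen.mem_nhds fun j => D.re_arg_pos j hs)
  have h1 := toMeromorphicNFOn_eq_toMeromorphicNFAt_on_nhds hmer (Set.mem_univ s)
  have h2 := toMeromorphicNFAt_eventuallyEq_nhds_congr (hcongr s)
  rw [toMeromorphicNFAt_eq_self.2 han.meromorphicNFAt] at h2
  exact h1.trans h2

theorem DifferentiableAt.conj_reflect {g : ℂ → ℂ} {z : ℂ}
    (hg : DifferentiableAt ℂ g (1 - starRingEnd ℂ z)) :
    DifferentiableAt ℂ (fun z => starRingEnd ℂ (g (1 - starRingEnd ℂ z))) z := by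
  have h : DifferentiableAt ℂ (fun z => g (1 - z)) (starRingEnd ℂ z) :=
    hg.comp _ (f := fun z : ℂ => 1 - z) (by fun_prop)
  have := h.conj_conj
  rw [starRingEnd_self_apply] at this
  exact this

/-- The completed function is entire: on `Re s ≥ 1/2` by its holomorphic model, elsewhere by the
functional equation. -/
theorem IsSharpFlat.differentiable_xi (hF : IsSharpFlat F D) :
    Differentiable ℂ (completedXi F D) := by
  obtain ⟨G, hGo, hG⟩ := hF.hasEntireMultiple
  have hright : ∀ s : ℂ, 1 / 2 ≤ s.re → DifferentiableAt ℂ (completedXi F D) s := fun s hs =>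
    (differentiableAt_xiModel hGo.1 _ D fun j => D.re_arg_pos j hs).congr_of_eventuallyEq
      (completedXi_eventuallyEq D hGo.1 hG hs)
  intro s
  rcases le_total (1 / 2) s.re with hs | hs
  · exact hright s hs
  · have h1 : completedXi F D =
        fun s => D.w * starRingEnd ℂ (completedXi F D (1 - starRingEnd ℂ s)) :=
      funext hF.functional_equation
    have h2 := (hright (1 - starRingEnd ℂ s) (by simp; linarith)).conj_reflect
    rw [h1]
    exact h2.const_mul _

theorem GammaData.w_ne_zero (D : GammaData) : D.w ≠ 0 := by
  rw [← norm_pos_iff, D.norm_w]; exact one_pos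

theorem IsSharpFlat.norm_xi_reflect (hF : IsSharpFlat F D) (s : ℂ) :
    ‖completedXi F D (1 - starRingEnd ℂ s)‖ = ‖completedXi F D s‖ := by
  rw [hF.functional_equation s, norm_mul, D.norm_w, one_mul, RCLike.norm_conj]

theorem IsSharpFlat.xi_reflect_eq_zero_iff (hF : IsSharpFlat F D) (s : ℂ) :
    completedXi F D (1 - starRingEnd ℂ s) = 0 ↔ completedXi F D s = 0 := by
  rw [← norm_eq_zero, hF.norm_xi_reflect, norm_eq_zero]

theorem IsSharpFlat.xi_ne_zero (hF : IsSharpFlat F D) {s : ℂ} (hs : 1 < s.re) :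
    completedXi F D s ≠ 0 := by
  obtain ⟨G, hGo, hG⟩ := hF.hasEntireMultiple
  rw [(completedXi_eventuallyEq D hGo.1 hG (by linarith)).eq_of_nhds]
  have hs1 : s ≠ 1 := fun h => by rw [h] at hs; simp at hs
  have hs0 : s ≠ 0 := fun h => by rw [h] at hs; simp at hs; linarith
  obtain ⟨c, _, hc⟩ := hF.euler_sum
  rw [xiModel, hG s hs1]
  refine mul_ne_zero (mul_ne_zero (mul_ne_zero (pow_ne_zero _ hs0) (mul_ne_zero
    (pow_ne_zero _ (by norm_num)) (mul_ne_zero (pow_ne_zero _ (sub_ne_zero.2 hs1)) (hc s hs).1)))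
    ?_) (Finset.prod_ne_zero_iff.2 fun j _ =>
      Complex.Gamma_ne_zero_of_re_pos (D.re_arg_pos j (by linarith)))
  rw [Complex.cpow_def_of_ne_zero D.Q_ne_zero]
  exact Complex.exp_ne_zero _

theorem IsSharpFlat.re_le_one (hF : IsSharpFlat F D) {s : ℂ} (hs : completedXi F D s = 0) :
    s.re ≤ 1 := by
  by_contra! h
  exact hF.xi_ne_zero h hs

theorem IsSharpFlat.re_nonneg (hF : IsSharpFlat F D) {s : ℂ} (hs : completedXi F D s = 0) :
    0 ≤ s.re := by
  have := hF.re_le_one ((hF.xi_reflect_eq_zero_iff s).2 hs)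
  simp at this
  exact this

theorem IsSharpFlat.xi_two_ne_zero (hF : IsSharpFlat F D) : completedXi F D 2 ≠ 0 :=
  hF.xi_ne_zero (by norm_num)

theorem IsSharpFlat.analyticOrderAt_eq (hF : IsSharpFlat F D) (s : ℂ) :
    analyticOrderAt (completedXi F D) s = zeroMult F D s :=
  (Nat.cast_analyticOrderNatAt
    (hF.differentiable_xi.analyticOrderAt_ne_top hF.xi_two_ne_zero s)).symm

/-- The functional equation preserves multiplicities. -/
theorem IsSharpFlat.zeroMult_reflect (hF : IsSharpFlat F D) (s : ℂ) :
    zeroMult F D (1 - starRingEnd ℂ s) = zeroMult F D s := by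
  obtain ⟨g, hg, hgs, hfg⟩ :=
    hF.differentiable_xi.exists_eq_pow_mul s _ (hF.analyticOrderAt_eq s)
  set n := zeroMult F D s with hn
  -- the reflection of the cofactor of `(z - s) ^ n` is a cofactor at the reflected point
  have hd : Differentiable ℂ
      (fun z => D.w * (-1) ^ n * starRingEnd ℂ (g (1 - starRingEnd ℂ z))) := fun z =>
    (hg _).conj_reflect.const_mul _
  have h := (hF.differentiable_xi.analyticAt (1 - starRingEnd ℂ s)).analyticOrderAt_eq_natCast
    (n := n) |>.2 ⟨_, hd.analyticAt _, ?_, Eventually.of_forall fun z => ?_⟩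
  · rw [hF.analyticOrderAt_eq] at h
    exact_mod_cast h
  · refine mul_ne_zero (mul_ne_zero D.w_ne_zero (pow_ne_zero _ (by norm_num))) ?_
    simpa using hgs
  · rw [hF.functional_equation z, hfg, smul_eq_mul, map_mul, map_pow]
    simp only [map_sub, map_one, Complex.conj_conj]
    rw [show 1 - z - starRingEnd ℂ s = (-1) * (z - (1 - starRingEnd ℂ s)) by ring, mul_pow]
    ring

theorem IsSharpFlat.zeroMult_pos (hF : IsSharpFlat F D) {s : ℂ} (hs : completedXi F D s = 0) :
    0 < zeroMult F D s := by
  rw [Nat.pos_iff_ne_zero]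
  intro h
  have := hF.analyticOrderAt_eq s
  rw [h, Nat.cast_zero, (hF.differentiable_xi.analyticAt s).analyticOrderAt_eq_zero] at this
  exact this hs

theorem IsSharpFlat.exists_norm_le (hF : IsSharpFlat F D) :
    ∃ M : ℝ, 0 ≤ M ∧ ∀ s : ℂ, 2 ≤ s.re → ‖F s‖ ≤ M := by
  obtain ⟨a, ha⟩ := hF.dirichlet_series
  have h2 : Summable fun n => ‖LSeries.term a 2 n‖ := (ha 2 (by norm_num)).summable.norm
  refine ⟨∑' n, ‖LSeries.term a 2 n‖, tsum_nonneg fun _ => norm_nonneg _, fun s hs => ?_⟩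
  have h := ha s (by linarith)
  rw [← HasSum.tsum_eq h]
  exact tsum_of_norm_bounded h2.hasSum fun n => LSeries.norm_term_le_of_re_le_re a (by simpa) n

end SharpFlat

/-! ### Growth of the completed function -/

/-- `f` grows on `S` at most like an entire function of order `5/4`. -/
def GrowthOn (S : Set ℂ) (f : ℂ → ℂ) : Prop :=
  ∃ C : ℝ, 0 ≤ C ∧ ∀ s ∈ S, ‖f s‖ ≤ Real.exp (C * (1 + ‖s‖) ^ (5 / 4 : ℝ))

theorem one_add_norm_le_rpow (s : ℂ) : 1 + ‖s‖ ≤ (1 + ‖s‖) ^ (5 / 4 : ℝ) :=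
  Real.self_le_rpow_of_one_le (by linarith [norm_nonneg s]) (by norm_num)

namespace GrowthOn

variable {S : Set ℂ} {f g : ℂ → ℂ}

theorem mul (hf : GrowthOn S f) (hg : GrowthOn S g) : GrowthOn S fun s => f s * g s := by
  obtain ⟨A, hA, hfA⟩ := hf
  obtain ⟨B, hB, hgB⟩ := hg
  refine ⟨A + B, by positivity, fun s hs => ?_⟩
  rw [norm_mul, add_mul, Real.exp_add]
  exact mul_le_mul (hfA s hs) (hgB s hs) (norm_nonneg _) (Real.exp_pos _).le

theorem of_le_const {K : ℝ} (h : ∀ s ∈ S, ‖f s‖ ≤ K) : GrowthOn S f := by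
  refine ⟨|K|, abs_nonneg K, fun s hs => (h s hs).trans ?_⟩
  have h1 := one_add_norm_le_rpow s
  have h2 : |K| ≤ |K| * (1 + ‖s‖) ^ (5 / 4 : ℝ) :=
    le_mul_of_one_le_right (abs_nonneg _) (by linarith [norm_nonneg s])
  linarith [Real.add_one_le_exp (|K| * (1 + ‖s‖) ^ (5 / 4 : ℝ)), le_abs_self K]

theorem prod {ι : Type*} (T : Finset ι) {f : ι → ℂ → ℂ} (h : ∀ i ∈ T, GrowthOn S (f i)) :
    GrowthOn S fun s => ∏ i ∈ T, f i s := by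
  classical
  induction T using Finset.induction_on with
  | empty => exact of_le_const (K := 1) (by simp)
  | insert i T hi ih =>
    simp only [Finset.prod_insert hi]
    exact (h i (Finset.mem_insert_self _ _)).mul
      (ih fun j hj => h j (Finset.mem_insert_of_mem hj))

theorem pow (hf : GrowthOn S f) (n : ℕ) : GrowthOn S fun s => f s ^ n := by
  simpa using prod (Finset.range n) (f := fun _ => f) fun _ _ => hf

theorem of_norm_le {K : ℝ} (hK : 0 ≤ K) (h : ∀ s ∈ S, ‖f s‖ ≤ K * (1 + ‖s‖)) : GrowthOn S f := by
  refine ⟨K, hK, fun s hs => (h s hs).trans ?_⟩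
  have h1 := mul_le_mul_of_nonneg_left (one_add_norm_le_rpow s) hK
  linarith [Real.add_one_le_exp (K * (1 + ‖s‖) ^ (5 / 4 : ℝ))]

theorem congr (hf : GrowthOn S f) (h : ∀ s ∈ S, ‖g s‖ ≤ ‖f s‖) : GrowthOn S g := by
  obtain ⟨A, hA, hfA⟩ := hf
  exact ⟨A, hA, fun s hs => (h s hs).trans (hfA s hs)⟩

theorem union {T : Set ℂ} (hf : GrowthOn S f) (hg : GrowthOn T f) : GrowthOn (S ∪ T) f := by
  obtain ⟨A, hA, hfA⟩ := hf
  obtain ⟨B, hB, hgB⟩ := hg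
  refine ⟨max A B, le_max_of_le_left hA, fun s hs => ?_⟩
  rcases hs with hs | hs
  · refine (hfA s hs).trans ?_
    gcongr
    exact le_max_left _ _
  · refine (hgB s hs).trans ?_
    gcongr
    exact le_max_right _ _

theorem comp_reflect (hf : GrowthOn S f) :
    GrowthOn {s | 1 - starRingEnd ℂ s ∈ S} fun s => f (1 - starRingEnd ℂ s) := by
  obtain ⟨A, hA, hfA⟩ := hf
  refine ⟨A * 2 ^ (5 / 4 : ℝ), by positivity, fun s hs => (hfA _ hs).trans ?_⟩
  rw [mul_assoc, ← Real.mul_rpow zero_le_two (by positivity)]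
  gcongr
  have : ‖1 - starRingEnd ℂ s‖ ≤ 1 + ‖s‖ := by
    simpa using norm_sub_le (1 : ℂ) (starRingEnd ℂ s)
  linarith [norm_nonneg s]

end GrowthOn

theorem GammaData.norm_Q_cpow (D : GammaData) (s : ℂ) : ‖(D.Q : ℂ) ^ s‖ = D.Q ^ s.re :=
  Complex.norm_cpow_eq_rpow_re_of_pos D.Q_pos s

theorem GammaData.growthOn_Q_cpow (D : GammaData) (S : Set ℂ) :
    GrowthOn S fun s => (D.Q : ℂ) ^ s := by
  refine ⟨|Real.log D.Q|, abs_nonneg _, fun s _ => ?_⟩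
  rw [D.norm_Q_cpow, Real.rpow_def_of_pos D.Q_pos, Real.exp_le_exp]
  calc Real.log D.Q * s.re ≤ |Real.log D.Q * s.re| := le_abs_self _
    _ = |Real.log D.Q| * |s.re| := abs_mul _ _
    _ ≤ _ := by
      gcongr
      linarith [Complex.abs_re_le_norm s, one_add_norm_le_rpow s]

theorem GammaData.growthOn_Gamma (D : GammaData) (j : Fin D.r) :
    GrowthOn {s | 1 / 2 ≤ s.re} fun s => Complex.Gamma ((D.lam j : ℂ) * s + D.mu j) := by
  have hl := D.lam_pos j
  obtain ⟨C, hC, hCx⟩ := exists_Gamma_le_exp (a := D.lam j / 2 + (D.mu j).re)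
    (by linarith [D.lam_add_mu_re j])
  refine ⟨C * (1 + D.lam j + |(D.mu j).re|) ^ (5 / 4 : ℝ), by positivity, fun s hs => ?_⟩
  have hs' : 1 / 2 ≤ s.re := hs
  have hre : ((D.lam j : ℂ) * s + D.mu j).re = D.lam j * s.re + (D.mu j).re := by simp
  have hpos := D.re_arg_pos j hs'
  refine (norm_Gamma_le_Gamma_re hpos).trans ?_
  rw [hre] at hpos ⊢
  refine (hCx _ (by nlinarith)).trans ?_
  rw [mul_assoc, ← Real.mul_rpow (by positivity) (by positivity)]
  gcongr
  have h1 := Complex.re_le_norm s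
  have h2 := le_abs_self (D.mu j).re
  nlinarith [norm_nonneg s, abs_nonneg (D.mu j).re,
    mul_nonneg (abs_nonneg (D.mu j).re) (norm_nonneg s),
    mul_le_mul_of_nonneg_left h1 hl.le]

section SharpFlat

variable {F : ℂ → ℂ} {D : GammaData}

theorem IsSharpFlat.growthOn_two_le_re (hF : IsSharpFlat F D) :
    GrowthOn {s | 2 ≤ s.re} (completedXi F D) := by
  obtain ⟨G, hGo, hG⟩ := hF.hasEntireMultiple
  obtain ⟨M, hM0, hM⟩ := hF.exists_norm_le
  have h1 : GrowthOn {s | 2 ≤ s.re} fun s => s :=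
    GrowthOn.of_norm_le zero_le_one fun s _ => by linarith
  have h2 : GrowthOn {s | 2 ≤ s.re} fun s => s - 1 :=
    GrowthOn.of_norm_le zero_le_one fun s _ => by
      have := norm_sub_le s 1
      simp at this; linarith
  have h3 : GrowthOn {s | 2 ≤ s.re} F := GrowthOn.of_le_const hM
  have h4 : GrowthOn {s | 2 ≤ s.re} fun s =>
      ∏ j : Fin D.r, Complex.Gamma ((D.lam j : ℂ) * s + D.mu j) :=
    GrowthOn.prod _ fun j _ => by
      obtain ⟨C, hC, h⟩ := D.growthOn_Gamma j
      exact ⟨C, hC, fun s hs => h s (by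
        have : 2 ≤ s.re := hs
        show 1 / 2 ≤ s.re
        linarith)⟩
  refine ((((h1.pow (polarOrder F)).mul ((h2.pow (polarOrder F)).mul h3)).mul
    (D.growthOn_Q_cpow _)).mul h4).congr fun s hs => le_of_eq ?_
  have hs' : 2 ≤ s.re := hs
  have hs1 : s ≠ 1 := fun h => by rw [h] at hs'; norm_num at hs'
  rw [(completedXi_eventuallyEq D hGo.1 hG (by linarith)).eq_of_nhds, xiModel, hG s hs1]
  simp only [norm_mul, norm_pow, norm_neg, norm_one, one_pow, one_mul]

theorem GammaData.exists_bound_strip (D : GammaData) :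
    ∃ B : ℝ, 0 ≤ B ∧ ∀ s : ℂ, 1 / 2 ≤ s.re → s.re ≤ 2 →
      ‖(D.Q : ℂ) ^ s * ∏ j : Fin D.r, Complex.Gamma ((D.lam j : ℂ) * s + D.mu j)‖ ≤ B := by
  have hpos : ∀ x ∈ Set.Icc (1 / 2 : ℝ) 2, ∀ j, 0 < D.lam j * x + (D.mu j).re := by
    intro x hx j
    have := D.re_arg_pos j (s := x) (by simpa using hx.1)
    simpa using this
  have hcont : ContinuousOn
      (fun x : ℝ => D.Q ^ x * ∏ j, Real.Gamma (D.lam j * x + (D.mu j).re))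
      (Set.Icc (1 / 2) 2) := by
    refine ContinuousOn.mul
      (continuous_const.rpow continuous_id fun _ => Or.inl D.Q_pos.ne').continuousOn ?_
    refine continuousOn_finsetProd _ fun j _ x hx => ?_
    have h := (Real.differentiableAt_Gamma (s := D.lam j * x + (D.mu j).re) fun m => by
      have h1 := hpos x hx j
      have h2 : (0 : ℝ) ≤ m := Nat.cast_nonneg m
      linarith).continuousAt
    exact (ContinuousAt.comp (f := fun x : ℝ => D.lam j * x + (D.mu j).re) h
      (by fun_prop)).continuousWithinAt
  obtain ⟨B, hB⟩ := isCompact_Icc.exists_bound_of_continuousOn hcont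
  refine ⟨B, (norm_nonneg _).trans (hB 1 (by norm_num)), fun s h1 h2 => ?_⟩
  refine le_trans ?_ (hB s.re ⟨h1, h2⟩)
  rw [norm_mul, norm_mul, D.norm_Q_cpow, norm_prod, norm_prod]
  refine mul_le_mul (le_abs_self _) (Finset.prod_le_prod (fun _ _ => norm_nonneg _) fun j _ => ?_)
    (by positivity) (by positivity)
  refine (norm_Gamma_le_Gamma_re (D.re_arg_pos j h1)).trans (le_trans (le_of_eq ?_) (le_abs_self _))
  simp

/-- Far up in the strip `1/2 ≤ Re s ≤ 2` the function `ξ_F` is at most doubly exponential; this is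
the a priori bound needed for the Phragmén–Lindelöf principle. -/
theorem IsSharpFlat.exists_double_exp_bound (hF : IsSharpFlat F D) :
    ∃ K B : ℝ, 0 ≤ K ∧ ∃ T₀ : ℝ, ∀ s : ℂ, 1 / 2 ≤ s.re → s.re ≤ 2 → T₀ ≤ |s.im| →
      ‖completedXi F D s‖ ≤ K * Real.exp (B * Real.exp (1 * |s.im|)) := by
  obtain ⟨G, ⟨hGd, A, C, hGb⟩, hG⟩ := hF.hasEntireMultiple
  obtain ⟨B, hB0, hB⟩ := D.exists_bound_strip
  set m := polarOrder F
  have hC0 : 0 ≤ C := by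
    have := (norm_nonneg _).trans (hGb 0)
    exact nonneg_of_mul_nonneg_left this (Real.exp_pos _)
  have hle : ∀ p : ℝ, ∀ᶠ x : ℝ in atTop, x ^ p ≤ Real.exp x := fun p => by
    filter_upwards [(isLittleO_rpow_exp_atTop p).bound one_pos] with x hx
    rw [one_mul, Real.norm_of_nonneg (Real.exp_pos _).le] at hx
    exact (le_abs_self _).trans hx
  obtain ⟨N, hN⟩ := eventually_atTop.1 ((hle (max A 0)).and (hle m))
  refine ⟨C * B, 2 * Real.exp 2, by positivity, max N 1, fun s h1 h2 hT => ?_⟩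
  set T := |s.im| with hTdef
  have hT1 : 1 ≤ T := (le_max_right _ _).trans hT
  have hTN : N ≤ T := (le_max_left _ _).trans hT
  obtain ⟨hA, hm⟩ := hN (T + 2) (by linarith)
  have hs1 : 1 ≤ ‖s‖ := hT1.trans (Complex.abs_im_le_norm s)
  have hs2 : ‖s‖ ≤ T + 2 := by
    have := Complex.norm_le_abs_re_add_abs_im s
    rw [abs_of_nonneg (by linarith : 0 ≤ s.re)] at this
    linarith
  have hGs : ‖G s‖ ≤ C * Real.exp (Real.exp (T + 2)) := by
    refine (hGb s).trans ?_
    gcongr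
    calc ‖s‖ ^ A ≤ ‖s‖ ^ (max A 0) := Real.rpow_le_rpow_of_exponent_le hs1 (le_max_left _ _)
      _ ≤ (T + 2) ^ (max A 0) := Real.rpow_le_rpow (norm_nonneg _) hs2 (le_max_right _ _)
      _ ≤ _ := hA
  have hsm : ‖s‖ ^ m ≤ Real.exp (Real.exp (T + 2)) := by
    rw [Real.rpow_natCast] at hm
    calc ‖s‖ ^ m ≤ (T + 2) ^ m := by gcongr
      _ ≤ Real.exp (T + 2) := hm
      _ ≤ _ := Real.exp_le_exp.2 (by linarith [Real.add_one_le_exp (T + 2)])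
  rw [(completedXi_eventuallyEq D hGd hG h1).eq_of_nhds, xiModel, mul_assoc, norm_mul, norm_mul,
    norm_mul, norm_pow, norm_pow, norm_neg, norm_one, one_pow, one_mul]
  calc ‖s‖ ^ m * ‖G s‖ * _
      ≤ Real.exp (Real.exp (T + 2)) * (C * Real.exp (Real.exp (T + 2))) * B := by
        gcongr
        exact hB s h1 h2
    _ = C * B * (Real.exp (Real.exp (T + 2)) * Real.exp (Real.exp (T + 2))) := by ring
    _ = _ := by
        rw [← Real.exp_add, Real.exp_add T 2, one_mul]
        congr 2
        ring

/-- On the line `Re s = 2` the completed function has polynomial growth, as `F` is bounded and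
`|Γ(z)| ≤ Γ(Re z)`. -/
theorem IsSharpFlat.exists_line_bound (hF : IsSharpFlat F D) :
    ∃ K : ℝ, 0 ≤ K ∧ ∀ s : ℂ, s.re = 2 →
      ‖completedXi F D s‖ ≤ K * (‖s‖ ^ polarOrder F * ‖1 - s‖ ^ polarOrder F) := by
  obtain ⟨G, ⟨hGd, A, C, hGb⟩, hG⟩ := hF.hasEntireMultiple
  obtain ⟨B, hB0, hB⟩ := D.exists_bound_strip
  obtain ⟨M, hM0, hM⟩ := hF.exists_norm_le
  refine ⟨M * B, by positivity, fun s hs => ?_⟩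
  have hs1 : s ≠ 1 := fun h => by rw [h] at hs; simp at hs
  rw [(completedXi_eventuallyEq D hGd hG (by linarith)).eq_of_nhds, xiModel, mul_assoc, norm_mul,
    norm_mul, norm_mul, norm_pow, norm_pow, norm_neg, norm_one, one_pow, one_mul, hG s hs1,
    norm_mul, norm_pow, norm_sub_rev s 1]
  calc _ ≤ ‖s‖ ^ polarOrder F * (‖1 - s‖ ^ polarOrder F * M) * B := by
        gcongr
        · exact hM s hs.ge
        · exact hB s (by linarith) hs.le
    _ = _ := by ring

/-- Polynomial growth of `ξ_F` in the strip `-1 ≤ Re s ≤ 2`, by the Phragmén–Lindelöf principle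
for `ξ_F(s) / (s + 3)^(2m)`; the functional equation exchanges the two boundary lines. -/
theorem IsSharpFlat.exists_strip_bound (hF : IsSharpFlat F D) :
    ∃ K : ℝ, 0 ≤ K ∧ ∀ s : ℂ, -1 ≤ s.re → s.re ≤ 2 →
      ‖completedXi F D s‖ ≤ K * ‖s + 3‖ ^ (2 * polarOrder F) := by
  obtain ⟨K, hK0, hK⟩ := hF.exists_line_bound
  obtain ⟨K', B, hK'0, T₀, hK'⟩ := hF.exists_double_exp_bound
  set m := polarOrder F
  have hthree : ∀ s : ℂ, -1 ≤ s.re → 1 ≤ ‖s + 3‖ := fun s hs => by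
    have := Complex.re_le_norm (s + 3)
    simp at this; linarith
  have hne : ∀ s : ℂ, -1 ≤ s.re → s + 3 ≠ 0 := fun s hs => by
    rw [← norm_pos_iff]; linarith [hthree s hs]
  have hsq : ∀ s t : ℂ, s.re ^ 2 + s.im ^ 2 ≤ t.re ^ 2 + t.im ^ 2 → ‖s‖ ≤ ‖t‖ := fun s t h => by
    rw [Complex.norm_eq_sqrt_sq_add_sq, Complex.norm_eq_sqrt_sq_add_sq]
    exact Real.sqrt_le_sqrt h
  refine ⟨K, hK0, fun s h1 h2 => ?_⟩
  have hmain := PhragmenLindelof.vertical_strip (a := -1) (b := 2) (C := K) (z := s)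
    (f := fun s => completedXi F D s / (s + 3) ^ (2 * m)) ?_ ?_ ?_ ?_ h1 h2
  · rwa [norm_div, norm_pow, div_le_iff₀ (pow_pos (norm_pos_iff.2 (hne s h1)) _)] at hmain
  · refine DifferentiableOn.diffContOnCl fun z hz => ?_
    have hz' : -1 ≤ z.re := by
      have hsub : closure (re ⁻¹' Set.Ioo (-1 : ℝ) 2) ⊆ re ⁻¹' Set.Ici (-1) :=
        closure_minimal (fun w hw => le_of_lt hw.1) (isClosed_Ici.preimage continuous_re)
      exact hsub hz
    have hd : DifferentiableAt ℂ (fun s : ℂ => (s + 3) ^ (2 * m)) z := by fun_prop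
    exact ((hF.differentiable_xi z).fun_div hd
      (pow_ne_zero _ (hne z hz'))).differentiableWithinAt
  · refine ⟨1, by rw [lt_div_iff₀ (by norm_num)]; linarith [Real.pi_gt_three], B, ?_⟩
    refine Asymptotics.IsBigO.of_bound K' ?_
    rw [eventually_inf_principal]
    filter_upwards [tendsto_comap.eventually (eventually_ge_atTop T₀)] with z hz hzs
    have hz' : T₀ ≤ |z.im| := hz
    have hzs' : -1 < z.re ∧ z.re < 2 := hzs
    rw [Real.norm_of_nonneg (Real.exp_pos _).le, norm_div, norm_pow]
    refine (div_le_self (norm_nonneg _) (one_le_pow₀ (hthree z hzs'.1.le))).trans ?_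
    rcases le_total (1 / 2) z.re with h | h
    · exact hK' z h hzs'.2.le hz'
    · have := hK' (1 - starRingEnd ℂ z) (by simp; linarith) (by simp; linarith)
        (by simpa using hz')
      rw [hF.norm_xi_reflect] at this
      simpa using this
  · intro z hz
    have hz1 : -1 ≤ z.re := hz.ge
    rw [norm_div, norm_pow, div_le_iff₀ (pow_pos (norm_pos_iff.2 (hne z hz1)) _),
      ← hF.norm_xi_reflect]
    refine (hK _ (by simp [hz]; norm_num)).trans ?_
    rw [two_mul, pow_add]
    gcongr
    · refine hsq _ _ ?_
      simp [hz]; norm_num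
    · refine hsq _ _ ?_
      simp [hz]; norm_num
  · intro z hz
    have hz1 : -1 ≤ z.re := by linarith
    rw [norm_div, norm_pow, div_le_iff₀ (pow_pos (norm_pos_iff.2 (hne z hz1)) _)]
    refine (hK z hz).trans ?_
    rw [two_mul, pow_add]
    gcongr
    · refine hsq _ _ ?_
      simp [hz]; norm_num
    · refine hsq _ _ ?_
      simp [hz]; norm_num

theorem IsSharpFlat.exists_growth (hF : IsSharpFlat F D) :
    ∃ C : ℝ, 0 ≤ C ∧ ∀ s, ‖completedXi F D s‖ ≤ Real.exp (C * (1 + ‖s‖) ^ (5 / 4 : ℝ)) := by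
  obtain ⟨K, hK0, hK⟩ := hF.exists_strip_bound
  have hstrip : GrowthOn {s | -1 ≤ s.re ∧ s.re ≤ 2} (completedXi F D) := by
    have h1 : GrowthOn {s | -1 ≤ s.re ∧ s.re ≤ 2} fun s => s + 3 :=
      GrowthOn.of_norm_le (K := 3) (by norm_num) fun s _ => by
        have := norm_add_le s 3
        simp at this
        linarith [norm_nonneg s]
    refine ((GrowthOn.of_le_const (f := fun _ => (K : ℂ)) (K := K) fun _ _ => by
      simp [abs_of_nonneg hK0]).mul (h1.pow (2 * polarOrder F))).congr fun s hs => ?_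
    rw [norm_mul, norm_pow, Complex.norm_real, Real.norm_of_nonneg hK0]
    exact hK s hs.1 hs.2
  have hleft : GrowthOn {s | 1 - starRingEnd ℂ s ∈ {s : ℂ | 2 ≤ s.re}} (completedXi F D) :=
    hF.growthOn_two_le_re.comp_reflect.congr fun s _ => (hF.norm_xi_reflect s).ge
  obtain ⟨C, hC0, hC⟩ := (hstrip.union hF.growthOn_two_le_re).union hleft
  refine ⟨C, hC0, fun s => hC s ?_⟩
  simp only [Set.mem_union, Set.mem_ofPred_eq, Complex.sub_re, Complex.one_re, Complex.conj_re]
  rcases le_total (-1) s.re with h | h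
  · rcases le_total s.re 2 with h' | h'
    · exact Or.inl (Or.inl ⟨h, h'⟩)
    · exact Or.inl (Or.inr h')
  · exact Or.inr (by linarith)

end SharpFlat

/-! ### The logarithmic derivative on the line `Re s = 2` -/

/-- Termwise integration of a series dominated by a convergent series of constants. -/
theorem hasSum_intervalIntegral_of_norm_le {ι E : Type*} [Countable ι] [NormedAddCommGroup E]
    [NormedSpace ℝ E] {f : ι → ℝ → E} {g : ℝ → E} {b : ι → ℝ} (hb : Summable b)
    (hc : ∀ i, Continuous (f i)) {x y : ℝ} (h : ∀ i, ∀ t ∈ Set.uIoc x y, ‖f i t‖ ≤ b i)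
    (hs : ∀ t, HasSum (fun i => f i t) (g t)) :
    HasSum (fun i => ∫ t in x..y, f i t) (∫ t in x..y, g t) :=
  intervalIntegral.hasSum_integral_of_dominated_convergence (fun i _ => b i)
    (fun i => (hc i).aestronglyMeasurable) (fun i => Eventually.of_forall fun t ht => h i t ht)
    (Eventually.of_forall fun _ _ => hb) intervalIntegrable_const
    (Eventually.of_forall fun t _ => hs t)

/-- An even function of slow growth, sampled along an arithmetic progression that is not symmetric
about the origin: the integral of its odd part only sees two windows of fixed length. -/
theorem exists_abs_integral_odd_part_le {q : ℝ → ℝ} (hq : Continuous q) (heven : ∀ y, q (-y) = q y)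
    {C p : ℝ} (hC : 0 ≤ C) (hp : 0 ≤ p) (hb : ∀ y, |q y| ≤ C * (1 + |y|) ^ p) {l : ℝ} (hl : 0 < l)
    (b : ℝ) :
    ∃ K : ℝ, 0 ≤ K ∧ ∀ t : ℝ,
      |∫ x in (0 : ℝ)..t, l * (q (l * x + b) - q (l * -x + b))| ≤ K * (1 + |t|) ^ p := by
  have hwin : ∀ x : ℝ, |∫ y in (x - b)..(x + b), q y| ≤ C * (1 + |x| + |b|) ^ p * (2 * |b|) := by
    intro x
    have h1 := intervalIntegral.norm_integral_le_of_norm_le_const (f := q) (a := x - b)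
      (b := x + b) (C := C * (1 + |x| + |b|) ^ p) (fun y hy => by
        refine (hb y).trans ?_
        gcongr C * ?_ ^ p
        have h2 : |y - x| ≤ |b| := by
          rcases Set.mem_uIoc.1 hy with h | h
          · rw [abs_le]; constructor <;> linarith [le_abs_self b]
          · rw [abs_le]; constructor <;> linarith [neg_abs_le b]
        have h3 := abs_add_le (y - x) x
        rw [sub_add_cancel] at h3
        linarith)
    rw [Real.norm_eq_abs] at h1
    refine h1.trans (le_of_eq ?_)
    rw [show x + b - (x - b) = 2 * b by ring, abs_mul, abs_two]
  refine ⟨4 * |b| * C * (1 + l + |b|) ^ p, by positivity, fun t => ?_⟩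
  have hi : ∀ u v, IntervalIntegrable q volume u v := fun u v => hq.intervalIntegrable u v
  have h1 : ∫ x in (0 : ℝ)..t, l * (q (l * x + b) - q (l * -x + b)) =
      (∫ y in (l * t - b)..(l * t + b), q y) - ∫ y in (0 - b)..(0 + b), q y := by
    have h2 : ∀ x, q (l * -x + b) = q (l * x - b) := fun x => by
      rw [← heven]; congr 1; ring
    simp_rw [h2]
    rw [intervalIntegral.integral_const_mul, intervalIntegral.integral_sub
      (Continuous.intervalIntegrable (by fun_prop) _ _)
      (Continuous.intervalIntegrable (by fun_prop) _ _),
      intervalIntegral.integral_comp_mul_add _ hl.ne',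
      intervalIntegral.integral_comp_mul_sub _ hl.ne',
      ← smul_sub, smul_eq_mul, ← mul_assoc, mul_inv_cancel₀ hl.ne', one_mul, mul_zero]
    have e1 := intervalIntegral.integral_add_adjacent_intervals (hi (0 - b) (0 + b))
      (hi (0 + b) (l * t + b))
    have e2 := intervalIntegral.integral_add_adjacent_intervals (hi (0 - b) (l * t - b))
      (hi (l * t - b) (l * t + b))
    linarith
  rw [h1]
  refine (abs_sub _ _).trans ?_
  have h3 := hwin (l * t)
  have h4 := hwin 0
  have h5 : (1 + |l * t| + |b|) ^ p ≤ (1 + l + |b|) ^ p * (1 + |t|) ^ p := by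
    rw [← Real.mul_rpow (by positivity) (by positivity), abs_mul, abs_of_pos hl]
    gcongr
    nlinarith [abs_nonneg t, abs_nonneg b, mul_nonneg (abs_nonneg t) (abs_nonneg b)]
  have h6 : (1 + |(0 : ℝ)| + |b|) ^ p ≤ (1 + l + |b|) ^ p * (1 + |t|) ^ p := by
    rw [← Real.mul_rpow (by positivity) (by positivity), abs_zero, add_zero]
    gcongr
    nlinarith [abs_nonneg t, abs_nonneg b, mul_nonneg (abs_nonneg t) (abs_nonneg b)]
  have h7 := mul_le_mul_of_nonneg_left h5 (by positivity : 0 ≤ C * (2 * |b|))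
  have h8 := mul_le_mul_of_nonneg_left h6 (by positivity : 0 ≤ C * (2 * |b|))
  linarith

theorem digamma_conj (z : ℂ) : digamma (starRingEnd ℂ z) = starRingEnd ℂ (digamma z) := by
  have h : starRingEnd ℂ ∘ Gamma ∘ starRingEnd ℂ = Gamma := by
    ext w
    simp [Complex.Gamma_conj]
  rw [digamma_def, logDeriv_apply, logDeriv_apply, Complex.Gamma_conj, map_div₀]
  congr 1
  conv_lhs => rw [← h]
  rw [deriv_conj_conj]
  simp

theorem continuous_digamma_vertical {a : ℝ} (ha : 0 < a) :
    Continuous fun y : ℝ => digamma (a + y * I) := by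
  have hopen : IsOpen {z : ℂ | 0 < z.re} := isOpen_lt continuous_const continuous_re
  have hd : DifferentiableOn ℂ Gamma {z : ℂ | 0 < z.re} := fun z hz =>
    (Complex.differentiableAt_Gamma_of_re_pos hz).differentiableWithinAt
  have hc : ContinuousOn digamma {z : ℂ | 0 < z.re} :=
    ((hd.deriv hopen).div hd fun z hz => Complex.Gamma_ne_zero_of_re_pos hz).continuousOn
  exact hc.comp_continuous (by fun_prop) fun y => by simpa using ha

/-- The integral of a Dirichlet series without constant term along a vertical line is bounded. -/
theorem norm_integral_LSeries_le {c : ℕ → ℂ} (hc1 : c 1 = 0) (hs : Summable (LSeries.term c 2))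
    {L : ℝ → ℂ} (hL : ∀ x : ℝ, HasSum (LSeries.term c (2 + x * I)) (L x)) (t : ℝ) :
    ‖∫ x in (0 : ℝ)..t, L x‖ ≤ ∑' n, ‖LSeries.term c 2 n‖ * (2 / Real.log 2) := by
  have hl2 : 0 < Real.log 2 := Real.log_pos one_lt_two
  have hterm : ∀ (n : ℕ) (x : ℝ), LSeries.term c (2 + x * I) n =
      LSeries.term c 2 n * Complex.exp (-(Real.log n) * I * x) := by
    intro n x
    rcases eq_or_ne n 0 with rfl | hn
    · simp
    have hn' : (n : ℂ) ≠ 0 := by exact_mod_cast hn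
    rw [LSeries.term_of_ne_zero hn, LSeries.term_of_ne_zero hn, Complex.cpow_add _ _ hn',
      div_mul_eq_div_div, div_eq_mul_inv _ ((n : ℂ) ^ (x * I)), ← Complex.cpow_neg,
      Complex.cpow_def_of_ne_zero hn' (-(x * I)), Complex.natCast_log]
    congr 2
    ring
  have hsum := hasSum_intervalIntegral_of_norm_le (x := 0) (y := t) hs.norm
    (f := fun n x => LSeries.term c (2 + x * I) n) (fun n => by
      simp_rw [hterm]; fun_prop) (fun n x _ => by
        refine LSeries.norm_term_le_of_re_le_re c ?_ n
        simp) hL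
  rw [← hsum.tsum_eq]
  refine tsum_of_norm_bounded (hs.norm.mul_right _).hasSum fun n => ?_
  simp_rw [hterm]
  rw [intervalIntegral.integral_const_mul, norm_mul]
  rcases lt_or_ge n 2 with hn | hn
  · have : LSeries.term c 2 n = 0 := by
      interval_cases n
      · simp
      · rw [LSeries.term_of_ne_zero one_ne_zero, hc1, zero_div]
    rw [this]; simp
  · refine mul_le_mul_of_nonneg_left ?_ (norm_nonneg _)
    have hlog : Real.log 2 ≤ Real.log n := Real.log_le_log two_pos (by exact_mod_cast hn)
    have hlog0 : (Real.log n : ℂ) ≠ 0 := by exact_mod_cast (hl2.trans_le hlog).ne'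
    have hne : -(Real.log n : ℂ) * I ≠ 0 := mul_ne_zero (neg_ne_zero.2 hlog0) I_ne_zero
    rw [integral_exp_mul_complex hne, norm_div]
    have h1 : ‖-(Real.log n : ℂ) * I‖ = Real.log n := by
      rw [norm_mul, norm_neg, Complex.norm_I, mul_one, Complex.norm_real,
        Real.norm_of_nonneg (hl2.le.trans hlog)]
    have h2 : ∀ x : ℝ, ‖Complex.exp (-(Real.log n : ℂ) * I * x)‖ = 1 := fun x => by
      rw [show -(Real.log n : ℂ) * I * x = ((-(Real.log n * x) : ℝ) : ℂ) * I by push_cast; ring,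
        Complex.norm_exp_ofReal_mul_I]
    rw [h1]
    have h3 : ‖Complex.exp (-(Real.log n : ℂ) * I * t) -
        Complex.exp (-(Real.log n : ℂ) * I * (0 : ℝ))‖ ≤ 2 := by
      refine (norm_sub_le _ _).trans ?_
      rw [h2, h2]; norm_num
    gcongr

section SharpFlat

variable {F : ℂ → ℂ} {D : GammaData}

theorem IsSharpFlat.logDeriv_xi (hF : IsSharpFlat F D) {s : ℂ} (hs : 1 < s.re) :
    logDeriv (completedXi F D) s = polarOrder F / s + polarOrder F / (s - 1) + deriv F s / F s +
      Real.log D.Q + ∑ j, (D.lam j : ℂ) * digamma ((D.lam j : ℂ) * s + D.mu j) := by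
  obtain ⟨G, ⟨hGd, _⟩, hG⟩ := hF.hasEntireMultiple
  obtain ⟨c, _, hc⟩ := hF.euler_sum
  set m := polarOrder F with hm
  have hs1 : s ≠ 1 := fun h => by rw [h] at hs; simp at hs
  have hs0 : s ≠ 0 := fun h => by rw [h] at hs; simp at hs; linarith
  have hs1' : s - 1 ≠ 0 := sub_ne_zero.2 hs1
  have hFs : F s ≠ 0 := (hc s hs).1
  have hGs : G s ≠ 0 := by
    rw [hG s hs1]; exact mul_ne_zero (pow_ne_zero _ hs1') hFs
  have hev : ∀ᶠ z in 𝓝 s, z ≠ 1 := isOpen_ne.mem_nhds hs1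
  have hFG : F =ᶠ[𝓝 s] fun z => G z / (z - 1) ^ m := by
    filter_upwards [hev] with z hz
    rw [hG z hz, mul_div_cancel_left₀ _ (pow_ne_zero _ (sub_ne_zero.2 hz))]
  have hlogG : deriv F s / F s = logDeriv G s - m / (s - 1) := by
    rw [← logDeriv_apply, (logDeriv_congr_nhds hFG).eq_of_nhds,
      logDeriv_div (f := G) (g := fun z => (z - 1) ^ m) s hGs (pow_ne_zero _ hs1') (hGd s)
      (by fun_prop), logDeriv_fun_pow (f := fun z => z - 1) (by fun_prop)]
    congr 1
    rw [logDeriv_apply]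
    simp [div_eq_mul_inv]
  have hQ : HasDerivAt (fun z : ℂ => (D.Q : ℂ) ^ z) ((D.Q : ℂ) ^ s * Complex.log D.Q) s := by
    simpa using (hasDerivAt_id s).const_cpow (Or.inl D.Q_ne_zero)
  have hQs : (D.Q : ℂ) ^ s ≠ 0 := by
    rw [Complex.cpow_def_of_ne_zero D.Q_ne_zero]; exact Complex.exp_ne_zero _
  have hre : ∀ j, 0 < ((D.lam j : ℂ) * s + D.mu j).re := fun j => D.re_arg_pos j (by linarith)
  have hΓd : ∀ j, HasDerivAt (fun z : ℂ => Gamma ((D.lam j : ℂ) * z + D.mu j))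
      (deriv Gamma ((D.lam j : ℂ) * s + D.mu j) * D.lam j) s := fun j => by
    have h1 := (Complex.differentiableAt_Gamma_of_re_pos (hre j)).hasDerivAt
    have h2 : HasDerivAt (fun z : ℂ => (D.lam j : ℂ) * z + D.mu j) (D.lam j) s := by
      simpa using ((hasDerivAt_id s).const_mul (D.lam j : ℂ)).add_const (D.mu j)
    exact h1.comp s h2
  have hΓ0 : ∀ j, Gamma ((D.lam j : ℂ) * s + D.mu j) ≠ 0 := fun j =>
    Complex.Gamma_ne_zero_of_re_pos (hre j)
  have hprodd : DifferentiableAt ℂ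
      (fun z : ℂ => ∏ j : Fin D.r, Gamma ((D.lam j : ℂ) * z + D.mu j)) s :=
    DifferentiableAt.fun_finsetProd fun j _ => (hΓd j).differentiableAt
  have hprod0 : ∏ j : Fin D.r, Gamma ((D.lam j : ℂ) * s + D.mu j) ≠ 0 :=
    Finset.prod_ne_zero_iff.2 fun j _ => hΓ0 j
  have hGs' := hGd s
  have hne1 : (-1 : ℂ) ^ m ≠ 0 := pow_ne_zero _ (by norm_num)
  rw [(logDeriv_congr_nhds (completedXi_eventuallyEq D hGd hG (by linarith))).eq_of_nhds]
  have hmodel : xiModel G (polarOrder F) D = fun z => z ^ m * ((-1) ^ m * G z) * (D.Q : ℂ) ^ z *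
    ∏ j : Fin D.r, Gamma ((D.lam j : ℂ) * z + D.mu j) := rfl
  rw [hmodel, logDeriv_mul (f := fun z => z ^ m * ((-1) ^ m * G z) * (D.Q : ℂ) ^ z)
      (g := fun z => ∏ j : Fin D.r, Gamma ((D.lam j : ℂ) * z + D.mu j)) s
      (mul_ne_zero (mul_ne_zero (pow_ne_zero _ hs0) (mul_ne_zero hne1 hGs)) hQs) hprod0
      (DifferentiableAt.fun_mul (by fun_prop) hQ.differentiableAt) hprodd,
    logDeriv_mul (f := fun z => z ^ m * ((-1) ^ m * G z)) (g := fun z => (D.Q : ℂ) ^ z) s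
      (mul_ne_zero (pow_ne_zero _ hs0) (mul_ne_zero hne1 hGs)) hQs (by fun_prop)
      hQ.differentiableAt,
    logDeriv_mul (f := fun z => z ^ m) (g := fun z => (-1) ^ m * G z) s
      (pow_ne_zero _ hs0) (mul_ne_zero hne1 hGs) (by fun_prop) (by fun_prop),
    logDeriv_const_mul s _ hne1, logDeriv_fun_pow (f := fun z => z) (by fun_prop),
    logDeriv_prod (f := fun j (z : ℂ) => Gamma ((D.lam j : ℂ) * z + D.mu j)) (fun j _ => hΓ0 j)
      fun j _ => (hΓd j).differentiableAt, hlogG]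
  have e1 : logDeriv (fun z : ℂ => (D.Q : ℂ) ^ z) s = Real.log D.Q := by
    rw [logDeriv_apply, hQ.deriv, mul_div_cancel_left₀ _ hQs, Complex.ofReal_log D.Q_pos.le]
  have e2 : ∀ j, logDeriv (fun z : ℂ => Gamma ((D.lam j : ℂ) * z + D.mu j)) s =
      (D.lam j : ℂ) * digamma ((D.lam j : ℂ) * s + D.mu j) := fun j => by
    rw [logDeriv_apply, (hΓd j).deriv, digamma_def, logDeriv_apply]
    ring
  rw [e1, Finset.sum_congr rfl fun j _ => e2 j, logDeriv_id']
  ring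

/-- Bounds for `Re (ξ'/ξ)` on the line `Re s = 2`: the function itself grows slowly, and so does
the primitive of its odd part. In the odd part the rational terms and `log Q` cancel, the
Dirichlet series has a bounded primitive, and the Gamma factors contribute two short windows. -/
theorem IsSharpFlat.exists_bounds_logDeriv_xi (hF : IsSharpFlat F D) :
    ∃ K : ℝ, 0 ≤ K ∧
      (∀ t : ℝ, |(logDeriv (completedXi F D) (2 + t * I)).re| ≤ K * (1 + |t|) ^ (1 / 8 : ℝ)) ∧
      ∀ t : ℝ, |∫ x in (0 : ℝ)..t, ((logDeriv (completedXi F D) (2 + x * I)).re -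
        (logDeriv (completedXi F D) (2 + (-x : ℝ) * I)).re)| ≤ K * (1 + |t|) ^ (1 / 8 : ℝ) := by
  obtain ⟨c, hc1, hc⟩ := hF.euler_sum
  set m := polarOrder F with hm
  have hcs : Summable (LSeries.term c 2) := (hc 2 (by norm_num)).2.summable
  set L : ℝ → ℂ := fun x => ∑' n, LSeries.term c (2 + x * I) n with hL
  have hLs : ∀ x : ℝ, HasSum (LSeries.term c (2 + x * I)) (L x) := fun x =>
    (hc (2 + x * I) (by simp)).2.summable.hasSum
  have hLF : ∀ x : ℝ, deriv F (2 + x * I) / F (2 + x * I) = -L x := fun x => by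
    rw [(hLs x).unique (hc (2 + x * I) (by simp)).2, neg_neg]
  have hLb : ∀ x : ℝ, ‖L x‖ ≤ ∑' n, ‖LSeries.term c 2 n‖ := fun x =>
    tsum_of_norm_bounded hcs.norm.hasSum fun n =>
      LSeries.norm_term_le_of_re_le_re c (by simp) n
  have hLc : Continuous L := by
    refine continuous_tsum (fun n => ?_) hcs.norm
      fun n x => LSeries.norm_term_le_of_re_le_re c (by simp) n
    rcases eq_or_ne n 0 with rfl | hn
    · simpa using continuous_const
    · have hn' : (n : ℂ) ≠ 0 := by exact_mod_cast hn
      simp only [LSeries.term_of_ne_zero hn]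
      refine Continuous.div continuous_const
        (Continuous.const_cpow (by fun_prop) (Or.inl hn')) fun x => ?_
      rw [Complex.cpow_def_of_ne_zero hn']
      exact Complex.exp_ne_zero _
  set r : ℝ → ℝ := fun t => ((m : ℂ) / (2 + t * I) + (m : ℂ) / (2 + t * I - 1)).re with hr
  have hreven : ∀ t, r (-t) = r t := fun t => by
    rw [hr]
    simp only
    rw [← Complex.conj_re]
    congr 1
    simp only [map_add, map_div₀, map_sub, map_mul, map_natCast, map_ofNat, map_one,
      Complex.conj_I, Complex.ofReal_neg, map_neg, Complex.conj_ofReal]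
    ring
  have hrb : ∀ t, |r t| ≤ 2 * m := fun t => by
    refine (Complex.abs_re_le_norm _).trans ((norm_add_le _ _).trans ?_)
    have h1 : (1 : ℝ) ≤ ‖2 + (t : ℂ) * I‖ := by
      have := Complex.re_le_norm (2 + (t : ℂ) * I)
      simp at this; linarith
    have h2 : (1 : ℝ) ≤ ‖2 + (t : ℂ) * I - 1‖ := by
      have := Complex.re_le_norm (2 + (t : ℂ) * I - 1)
      simp at this; linarith
    rw [norm_div, norm_div, Complex.norm_natCast, two_mul]
    exact add_le_add (div_le_self (Nat.cast_nonneg _) h1) (div_le_self (Nat.cast_nonneg _) h2)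
  set a : Fin D.r → ℝ := fun j => 2 * D.lam j + (D.mu j).re with ha
  have ha0 : ∀ j, 0 < a j := fun j => by
    have h1 := D.lam_add_mu_re j
    have h2 := D.lam_pos j
    simp only [ha]; linarith
  set q : Fin D.r → ℝ → ℝ := fun j y => (digamma (a j + y * I)).re with hq
  have hqc : ∀ j, Continuous (q j) := fun j =>
    Complex.continuous_re.comp (continuous_digamma_vertical (ha0 j))
  have hqe : ∀ j y, q j (-y) = q j y := fun j y => by
    simp only [hq]
    rw [← Complex.conj_re (digamma (a j + y * I)), ← digamma_conj]
    congr 2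
    simp
  choose C hC0 hC using fun j => exists_norm_digamma_le (ha0 j)
  have hqb : ∀ j y, |q j y| ≤ C j * (1 + |y|) ^ (1 / 8 : ℝ) := fun j y => by
    have := hC j (a j + y * I) (by simp)
    simp only [Complex.add_im, Complex.ofReal_im, Complex.mul_im, Complex.ofReal_re,
      Complex.I_im, mul_one, Complex.I_re, mul_zero, add_zero, zero_add] at this
    exact (Complex.abs_re_le_norm _).trans this
  have hform : ∀ t : ℝ, (logDeriv (completedXi F D) (2 + t * I)).re =
      r t - (L t).re + Real.log D.Q + ∑ j, D.lam j * q j (D.lam j * t + (D.mu j).im) := by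
    intro t
    rw [hF.logDeriv_xi (by simp), hLF]
    simp only [Complex.add_re, Complex.neg_re, Complex.ofReal_re, Complex.re_sum,
      Complex.re_ofReal_mul, hr, ← hm]
    rw [← sub_eq_add_neg]
    congr 1
    refine Finset.sum_congr rfl fun j _ => ?_
    simp only [hq, ha]
    congr 3
    apply Complex.ext <;> simp [mul_comm]
  choose K hK0 hK using fun j => exists_abs_integral_odd_part_le (hqc j) (hqe j) (hC0 j)
    (by norm_num : (0 : ℝ) ≤ 1 / 8) (hqb j) (D.lam_pos j) (D.mu j).im
  set S := ∑' n, ‖LSeries.term c 2 n‖ with hS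
  have hS0 : 0 ≤ S := tsum_nonneg fun _ => norm_nonneg _
  set S' := ∑' n, ‖LSeries.term c 2 n‖ * (2 / Real.log 2) with hS'
  have hl2 : 0 < Real.log 2 := Real.log_pos one_lt_two
  have hS'0 : 0 ≤ S' := tsum_nonneg fun _ => by positivity
  set K₁ := 2 * m + S + |Real.log D.Q| +
    ∑ j, D.lam j * (C j * (1 + D.lam j + |(D.mu j).im|) ^ (1 / 8 : ℝ)) with hK₁
  set K₂ := 2 * S' + ∑ j, K j with hK₂
  have hlam := fun j => (D.lam_pos j).le
  have hone : ∀ t : ℝ, 1 ≤ (1 + |t|) ^ (1 / 8 : ℝ) := fun t =>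
    Real.one_le_rpow (by linarith [abs_nonneg t]) (by norm_num)
  have hK₁0 : 0 ≤ K₁ := by
    have : 0 ≤ ∑ j, D.lam j * (C j * (1 + D.lam j + |(D.mu j).im|) ^ (1 / 8 : ℝ)) :=
      Finset.sum_nonneg fun j _ => by
        have := hlam j; have := hC0 j; positivity
    positivity
  have hK₂0 : 0 ≤ K₂ := by
    have : 0 ≤ ∑ j, K j := Finset.sum_nonneg fun j _ => hK0 j
    positivity
  refine ⟨K₁ + K₂, by positivity, fun t => ?_, fun t => ?_⟩
  · have h1 : |∑ j, D.lam j * q j (D.lam j * t + (D.mu j).im)| ≤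
        (∑ j, D.lam j * (C j * (1 + D.lam j + |(D.mu j).im|) ^ (1 / 8 : ℝ))) *
          (1 + |t|) ^ (1 / 8 : ℝ) := by
      rw [Finset.sum_mul]
      refine (Finset.abs_sum_le_sum_abs _ _).trans (Finset.sum_le_sum fun j _ => ?_)
      have hl := hlam j
      rw [abs_mul, abs_of_nonneg hl, mul_assoc]
      refine mul_le_mul_of_nonneg_left ((hqb j _).trans ?_) hl
      rw [mul_assoc, ← Real.mul_rpow (by positivity) (by positivity)]
      refine mul_le_mul_of_nonneg_left (Real.rpow_le_rpow (by positivity) ?_ (by norm_num)) (hC0 j)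
      have h2 := abs_add_le (D.lam j * t) (D.mu j).im
      rw [abs_mul, abs_of_nonneg hl] at h2
      nlinarith [abs_nonneg t, abs_nonneg (D.mu j).im,
        mul_nonneg (abs_nonneg t) (abs_nonneg (D.mu j).im)]
    rw [hform]
    have h2 : |(L t).re| ≤ S := (Complex.abs_re_le_norm _).trans (hLb t)
    have h3 : |r t - (L t).re + Real.log D.Q| ≤ (2 * m + S + |Real.log D.Q|) := by
      refine (abs_add_le _ _).trans (add_le_add_left ((abs_sub _ _).trans ?_) _)
      exact add_le_add (hrb t) h2
    refine (abs_add_le _ _).trans ((add_le_add h3 h1).trans ?_)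
    have h4 : 2 * m + S + |Real.log D.Q| ≤
        (2 * m + S + |Real.log D.Q|) * (1 + |t|) ^ (1 / 8 : ℝ) :=
      le_mul_of_one_le_right (by positivity) (hone t)
    have h5 := mul_nonneg hK₂0 (zero_le_one.trans (hone t))
    rw [hK₁] at *
    linarith
  · have hcont : ∀ j, Continuous fun x : ℝ => D.lam j * (q j (D.lam j * x + (D.mu j).im) -
        q j (D.lam j * -x + (D.mu j).im)) := fun j => by
      have := hqc j
      fun_prop
    have hint : ∀ x : ℝ, (logDeriv (completedXi F D) (2 + x * I)).re -
        (logDeriv (completedXi F D) (2 + (-x : ℝ) * I)).re =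
        ((L (-x)).re - (L x).re) + ∑ j, D.lam j * (q j (D.lam j * x + (D.mu j).im) -
          q j (D.lam j * -x + (D.mu j).im)) := fun x => by
      rw [hform, hform, hreven]
      simp only [mul_sub, Finset.sum_sub_distrib]
      ring
    simp_rw [hint]
    have hLc1 : Continuous fun x => (L x).re := Complex.continuous_re.comp hLc
    have hLc2 : Continuous fun x => (L (-x)).re := hLc1.comp continuous_neg
    rw [intervalIntegral.integral_add ((hLc2.fun_sub hLc1).intervalIntegrable _ _)
      ((continuous_finsetSum _ fun j _ => hcont j).intervalIntegrable _ _),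
      intervalIntegral.integral_sub (hLc2.intervalIntegrable _ _) (hLc1.intervalIntegrable _ _),
      intervalIntegral.integral_finsetSum fun j _ => (hcont j).intervalIntegrable _ _]
    have hre : ∀ u : ℝ, |∫ x in (0 : ℝ)..u, (L x).re| ≤ S' := fun u => by
      have h1 : ∫ x in (0 : ℝ)..u, (L x).re = (∫ x in (0 : ℝ)..u, L x).re :=
        Complex.reCLM.intervalIntegral_comp_comm (hLc.intervalIntegrable _ _)
      rw [h1]
      exact (Complex.abs_re_le_norm _).trans (norm_integral_LSeries_le hc1 hcs hLs u)
    have h1 : |∫ x in (0 : ℝ)..t, (L (-x)).re| ≤ S' := by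
      have h2 : ∫ x in (0 : ℝ)..t, (L (-x)).re = ∫ x in (-t)..(-0), (L x).re :=
        intervalIntegral.integral_comp_neg fun x => (L x).re
      rw [h2, neg_zero, intervalIntegral.integral_symm, abs_neg]
      exact hre _
    have h3 : |∑ j, ∫ x in (0 : ℝ)..t, D.lam j * (q j (D.lam j * x + (D.mu j).im) -
        q j (D.lam j * -x + (D.mu j).im))| ≤ (∑ j, K j) * (1 + |t|) ^ (1 / 8 : ℝ) := by
      rw [Finset.sum_mul]
      exact (Finset.abs_sum_le_sum_abs _ _).trans (Finset.sum_le_sum fun j _ => hK j t)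
    refine (abs_add_le _ _).trans
      ((add_le_add ((abs_sub _ _).trans (add_le_add h1 (hre t))) h3).trans ?_)
    have h4 : 2 * S' ≤ 2 * S' * (1 + |t|) ^ (1 / 8 : ℝ) :=
      le_mul_of_one_le_right (by positivity) (hone t)
    have h5 := mul_nonneg hK₁0 (zero_le_one.trans (hone t))
    rw [hK₂] at *
    linarith

end SharpFlat

/-! ### Integrals of Poisson kernels -/

theorem Real.arctan_le_self_of_nonneg {x : ℝ} (hx : 0 ≤ x) : Real.arctan x ≤ x := by
  have h1 := Real.arctan_nonneg.2 hx
  have h2 := Real.arctan_lt_pi_div_two x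
  calc Real.arctan x ≤ Real.tan (Real.arctan x) := Real.le_tan h1 h2
    _ = x := Real.tan_arctan x

/-- The complementary angle `π/2 - arctan (d / y)` decays like `1 / d`. -/
theorem sq_arctan_compl_mul_le {y d : ℝ} (hy1 : 1 ≤ y) (hy2 : y ≤ 2) (hd : 0 ≤ d) :
    (Real.pi / 2 - Real.arctan (d / y)) ^ 2 * (1 + d ^ 2) ≤ 7 := by
  have hy0 : 0 < y := by linarith
  have h0 : 0 ≤ Real.pi / 2 - Real.arctan (d / y) := by
    linarith [Real.arctan_lt_pi_div_two (d / y)]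
  have h1 : Real.pi / 2 - Real.arctan (d / y) ≤ 8 / 5 := by
    have := Real.arctan_nonneg.2 (div_nonneg hd hy0.le)
    linarith [Real.pi_lt_d2]
  have h2 : (Real.pi / 2 - Real.arctan (d / y)) * d ≤ 2 := by
    rcases hd.eq_or_lt with rfl | hd0
    · simp
    · rw [← Real.arctan_inv_of_pos (by positivity), inv_div]
      calc Real.arctan (y / d) * d ≤ y / d * d := by
            gcongr; exact Real.arctan_le_self_of_nonneg (by positivity)
        _ = y := by field_simp
        _ ≤ 2 := hy2
  nlinarith [mul_nonneg h0 hd]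

/-- The integral over `[0, t]` of `P(x) - P(-x)`, twice the odd part of the Poisson kernel
`P(x) = y / (y² + (x - γ)²)`; this is `integral_odd_poisson`. -/
noncomputable def oddPoissonIntegral (y γ t : ℝ) : ℝ :=
  Real.arctan ((t - γ) / y) + 2 * Real.arctan (γ / y) - Real.arctan ((t + γ) / y)

theorem oddPoissonIntegral_neg (y γ t : ℝ) :
    oddPoissonIntegral y (-γ) t = -oddPoissonIntegral y γ t := by
  simp only [oddPoissonIntegral, neg_div, Real.arctan_neg, sub_neg_eq_add, ← sub_eq_add_neg]
  ring

theorem integral_odd_poisson {y : ℝ} (hy : 0 < y) (γ t : ℝ) :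
    ∫ x in (0 : ℝ)..t, (y / (y ^ 2 + (x - γ) ^ 2) - y / (y ^ 2 + (-x - γ) ^ 2)) =
      oddPoissonIntegral y γ t := by
  have hd : ∀ x ∈ Set.uIcc 0 t, HasDerivAt
      (fun x => Real.arctan ((x - γ) / y) - Real.arctan ((x + γ) / y))
      (y / (y ^ 2 + (x - γ) ^ 2) - y / (y ^ 2 + (-x - γ) ^ 2)) x := by
    intro x _
    have h1 := (((hasDerivAt_id x).sub_const γ).div_const y).arctan
    have h2 := (((hasDerivAt_id x).add_const γ).div_const y).arctan
    refine (h1.sub h2).congr_deriv ?_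
    simp only [id]
    have e1 : y ^ 2 + (x - γ) ^ 2 ≠ 0 := by positivity
    have e2 : y ^ 2 + (x + γ) ^ 2 ≠ 0 := by positivity
    rw [show (-x - γ) ^ 2 = (x + γ) ^ 2 by ring]
    have e3 : 1 + ((x - γ) / y) ^ 2 ≠ 0 := by positivity
    have e4 : 1 + ((x + γ) / y) ^ 2 ≠ 0 := by positivity
    field_simp
  have hc : Continuous fun x => (y / (y ^ 2 + (x - γ) ^ 2) - y / (y ^ 2 + (-x - γ) ^ 2)) := by
    refine Continuous.sub (Continuous.div (by fun_prop) (by fun_prop) fun x => ?_)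
      (Continuous.div (by fun_prop) (by fun_prop) fun x => ?_) <;> positivity
  rw [intervalIntegral.integral_eq_sub_of_hasDerivAt hd (hc.intervalIntegrable _ _),
    oddPoissonIntegral]
  simp only [zero_sub, zero_add, neg_div, Real.arctan_neg]
  ring

/-- For `γ` far beyond `t` the odd part of the Poisson kernel is `O(t / γ³)` on `[0, t]`. -/
theorem oddPoissonIntegral_le_of_two_mul_lt {y γ t : ℝ} (hy1 : 1 ≤ y) (hy2 : y ≤ 2) (ht : 0 ≤ t)
    (hγ : 2 * t < γ) :
    |oddPoissonIntegral y γ t| ≤ 32 * t ^ 2 / γ ^ 3 := by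
  have hy0 : 0 < y := by linarith
  have hγ0 : 0 < γ := by linarith
  rw [← integral_odd_poisson hy0]
  have h := intervalIntegral.norm_integral_le_of_norm_le_const (a := 0) (b := t)
    (f := fun x => y / (y ^ 2 + (x - γ) ^ 2) - y / (y ^ 2 + (-x - γ) ^ 2))
    (C := 32 * t / γ ^ 3) fun x hx => by
      rw [Set.uIoc_of_le ht] at hx
      have hx0 := hx.1
      have hxt := hx.2
      have e1 : 0 < y ^ 2 + (x - γ) ^ 2 := by positivity
      have e2 : 0 < y ^ 2 + (-x - γ) ^ 2 := by positivity
      have h1 : γ ^ 2 / 4 ≤ y ^ 2 + (x - γ) ^ 2 := by nlinarith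
      have h2 : γ ^ 2 ≤ y ^ 2 + (-x - γ) ^ 2 := by nlinarith
      have heq : y / (y ^ 2 + (x - γ) ^ 2) - y / (y ^ 2 + (-x - γ) ^ 2) =
          4 * y * x * γ / ((y ^ 2 + (x - γ) ^ 2) * (y ^ 2 + (-x - γ) ^ 2)) := by
        field_simp; ring
      rw [heq, Real.norm_of_nonneg (by positivity)]
      calc 4 * y * x * γ / ((y ^ 2 + (x - γ) ^ 2) * (y ^ 2 + (-x - γ) ^ 2))
          ≤ 4 * 2 * t * γ / (γ ^ 2 / 4 * γ ^ 2) := by gcongr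
        _ = 32 * t / γ ^ 3 := by field_simp; ring
  rw [Real.norm_eq_abs, sub_zero, abs_of_nonneg ht] at h
  refine h.trans (le_of_eq ?_)
  ring

/-- For `γ > 0` the integral `oddPoissonIntegral y γ t` is close to `π` or to `0` according to
whether `γ ≤ t`. The fourth root `T` of `t` and the square root `v` of `1 + γ` replace fractional powers by
polynomials. -/
theorem abs_oddPoissonIntegral_sub_le {y γ t : ℝ} (hy1 : 1 ≤ y) (hy2 : y ≤ 2) {T v : ℝ}
    (hT : 1 ≤ T) (hv : 1 ≤ v) (htT : t = T ^ 4) (hγv : γ = v ^ 2 - 1) (hγ : 0 < γ) :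
    |oddPoissonIntegral y γ t - Real.pi * (if γ ≤ t then 1 else 0)| ≤
      260 * T ^ 3 * (1 / (1 + (t - γ) ^ 2) + 1 / v ^ 3) := by
  have hy0 : 0 < y := by linarith
  have ht1 : 1 ≤ t := by rw [htT]; exact one_le_pow₀ hT
  have hT0 : 0 < T := by linarith
  have hv0 : 0 < v := by linarith
  -- in the near range, compare with the value of each arctangent at infinity
  rcases le_or_gt γ (2 * t) with h2t | h2t
  · set a : ℝ → ℝ := fun d => Real.pi / 2 - Real.arctan (d / y) with ha
    have ha0 : ∀ d, 0 ≤ a d := fun d => by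
      simp only [ha]; linarith [Real.arctan_lt_pi_div_two (d / y)]
    have ha7 : ∀ d, 0 ≤ d → a d ^ 2 * (1 + d ^ 2) ≤ 7 := fun d hd =>
      sq_arctan_compl_mul_le hy1 hy2 hd
    have hmono : a (t + γ) ≤ a γ := by
      simp only [ha]
      have : Real.arctan (γ / y) ≤ Real.arctan ((t + γ) / y) :=
        Real.arctan_mono (by gcongr; linarith)
      linarith
    have hnear : |oddPoissonIntegral y γ t - Real.pi * (if γ ≤ t then 1 else 0)| ≤
        a |t - γ| + 3 * a γ := by
      have hγγ := ha0 γ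
      have h1 := ha0 |t - γ|
      have h2 := ha0 (t + γ)
      split_ifs with h
      · have : oddPoissonIntegral y γ t - Real.pi * 1 = -a |t - γ| - 2 * a γ + a (t + γ) := by
          rw [abs_of_nonneg (by linarith)]
          simp only [oddPoissonIntegral, ha]; ring
        rw [this, abs_le]
        constructor <;> linarith
      · have : oddPoissonIntegral y γ t - Real.pi * 0 = a |t - γ| - 2 * a γ + a (t + γ) := by
          rw [abs_of_nonpos (by linarith)]
          simp only [oddPoissonIntegral, ha, neg_sub]
          rw [show (t - γ) / y = -((γ - t) / y) by ring, Real.arctan_neg]; ring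
        rw [this, abs_le]
        constructor <;> linarith
    have hv2 : v ^ 2 ≤ 3 * T ^ 4 := by linarith
    -- the arithmetic–geometric mean inequality trades the decay `1 / d` for `K / d² + 1 / K`
    have h1 : a |t - γ| ≤ 7 * T ^ 3 * (1 / (1 + (t - γ) ^ 2)) + 1 / T ^ 3 := by
      have h3 := ha7 |t - γ| (abs_nonneg _)
      rw [sq_abs] at h3
      set q := 1 / (1 + (t - γ) ^ 2) with hq
      have hq0 : 0 < q := by positivity
      have h4 : a |t - γ| ^ 2 ≤ 7 * q := by
        rw [hq, mul_one_div, le_div_iff₀ (by positivity)]; exact h3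
      have h5 : 7 * T ^ 3 * q * (1 / T ^ 3) = 7 * q := by field_simp
      by_contra! hcon
      have h6 : 0 < 7 * T ^ 3 * q := by positivity
      have h7 : 0 < 1 / T ^ 3 := by positivity
      nlinarith
    have h2 : a γ ≤ 12 * T ^ 3 * (1 / v ^ 3) := by
      have h3 := ha7 γ hγ.le
      have h4 : a γ * v ^ 2 ≤ 4 := by
        have h5 : (a γ * v ^ 2) ^ 2 ≤ 16 := by
          have h6 : (v ^ 2) ^ 2 ≤ 2 * (1 + γ ^ 2) := by
            rw [hγv]; nlinarith [sq_nonneg (v ^ 2 - 2)]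
          calc (a γ * v ^ 2) ^ 2 = a γ ^ 2 * (v ^ 2) ^ 2 := by ring
            _ ≤ a γ ^ 2 * (2 * (1 + γ ^ 2)) := by gcongr
            _ ≤ 16 := by linarith
        nlinarith [mul_nonneg (ha0 γ) (sq_nonneg v)]
      have h5 : v ≤ 3 * T ^ 3 := by
        have h6 : v ^ 2 ≤ (3 * T ^ 3) ^ 2 := by
          have h7 : T ^ 4 ≤ T ^ 6 := pow_le_pow_right₀ hT (by norm_num)
          nlinarith
        exact (pow_le_pow_iff_left₀ hv0.le (by positivity) two_ne_zero).1 h6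
      rw [mul_one_div, le_div_iff₀ (by positivity)]
      calc a γ * v ^ 3 = a γ * v ^ 2 * v := by ring
        _ ≤ 4 * (3 * T ^ 3) := by gcongr
        _ = 12 * T ^ 3 := by ring
    have h3 : 1 / T ^ 3 ≤ 9 * T ^ 3 * (1 / v ^ 3) := by
      have h6 : v ^ 3 ≤ 9 * T ^ 6 := by
        have h7 : (v ^ 3) ^ 2 ≤ (9 * T ^ 6) ^ 2 := by
          calc (v ^ 3) ^ 2 = (v ^ 2) ^ 3 := by ring
            _ ≤ (3 * T ^ 4) ^ 3 := by gcongr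
            _ ≤ (9 * T ^ 6) ^ 2 := by nlinarith [pow_pos hT0 12]
        exact (pow_le_pow_iff_left₀ (by positivity) (by positivity) two_ne_zero).1 h7
      rw [mul_one_div, div_le_div_iff₀ (by positivity) (by positivity)]
      linarith [h6, show 9 * T ^ 3 * T ^ 3 = 9 * T ^ 6 by ring]
    have h4 : 0 ≤ T ^ 3 * (1 / (1 + (t - γ) ^ 2)) := by positivity
    have h5 : 0 ≤ T ^ 3 * (1 / v ^ 3) := by positivity
    linarith
  · rw [if_neg (by linarith), mul_zero, sub_zero]
    refine (oddPoissonIntegral_le_of_two_mul_lt hy1 hy2 (by linarith) h2t).trans ?_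
    have h1 : 32 * t ^ 2 / γ ^ 3 ≤ 256 * T ^ 3 * (1 / v ^ 3) := by
      have h3 : v ^ 2 / 2 ≤ γ := by linarith
      have h4 : T ^ 2 ≤ v := by
        refine (pow_le_pow_iff_left₀ (by positivity) hv0.le two_ne_zero).1 ?_
        linarith [show (T ^ 2) ^ 2 = T ^ 4 by ring]
      have h5 : T ^ 5 ≤ v ^ 3 := by
        calc T ^ 5 ≤ T ^ 6 := pow_le_pow_right₀ hT (by norm_num)
          _ = (T ^ 2) ^ 3 := by ring
          _ ≤ v ^ 3 := by gcongr
      calc 32 * t ^ 2 / γ ^ 3 ≤ 32 * t ^ 2 / (v ^ 2 / 2) ^ 3 := by gcongr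
        _ = 256 * T ^ 3 * (T ^ 5 / v ^ 6) := by rw [htT]; field_simp; ring
        _ ≤ 256 * T ^ 3 * (v ^ 3 / v ^ 6) := by gcongr
        _ = 256 * T ^ 3 * (1 / v ^ 3) := by field_simp
    have h4 : 0 ≤ T ^ 3 * (1 / (1 + (t - γ) ^ 2)) := by positivity
    have h5 : 0 ≤ T ^ 3 * (1 / v ^ 3) := by positivity
    linarith

/-- Up to a controlled error, `oddPoissonIntegral` is `π` times the signed indicator function of
`|γ| ≤ t`. -/
theorem abs_oddPoissonIntegral_sub_sign_le {y : ℝ} (hy1 : 1 ≤ y) (hy2 : y ≤ 2) (γ : ℝ) {t : ℝ}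
    (ht : 1 ≤ t) :
    |oddPoissonIntegral y γ t - Real.pi * (if |γ| ≤ t then Real.sign γ else 0)| ≤
      260 * t ^ (3 / 4 : ℝ) * (4 * (y / (y ^ 2 + (t - γ) ^ 2) + y / (y ^ 2 + (-t - γ) ^ 2)) +
        (1 + |γ|) ^ (-(3 / 2) : ℝ)) := by
  have ht0 : 0 < t := by linarith
  have hker : ∀ x, 1 / (1 + x ^ 2) ≤ 4 * (y / (y ^ 2 + x ^ 2)) := fun x => by
    rw [mul_div_assoc', div_le_div_iff₀ (by positivity) (by positivity)]
    nlinarith [sq_nonneg x]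
  have hpos : ∀ γ, 0 < γ → |oddPoissonIntegral y γ t - Real.pi * (if γ ≤ t then 1 else 0)| ≤
      260 * t ^ (3 / 4 : ℝ) * (1 / (1 + (t - γ) ^ 2) + (1 + γ) ^ (-(3 / 2) : ℝ)) := by
    intro γ hγ
    have hγ1 : 0 ≤ 1 + γ := by linarith
    have h := abs_oddPoissonIntegral_sub_le (y := y) (γ := γ) (t := t) hy1 hy2
      (T := t ^ (1 / 4 : ℝ)) (v := (1 + γ) ^ (1 / 2 : ℝ)) (Real.one_le_rpow ht (by norm_num))
      (Real.one_le_rpow (by linarith) (by norm_num))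
      (by rw [← Real.rpow_natCast, ← Real.rpow_mul ht0.le]; norm_num)
      (by rw [← Real.rpow_natCast, ← Real.rpow_mul hγ1]; norm_num) hγ
    have e1 : (t ^ (1 / 4 : ℝ)) ^ 3 = t ^ (3 / 4 : ℝ) := by
      rw [← Real.rpow_natCast, ← Real.rpow_mul ht0.le]; norm_num
    have e2 : 1 / ((1 + γ) ^ (1 / 2 : ℝ)) ^ 3 = (1 + γ) ^ (-(3 / 2) : ℝ) := by
      rw [← Real.rpow_natCast, ← Real.rpow_mul hγ1, one_div, ← Real.rpow_neg hγ1]; norm_num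
    rwa [e1, e2] at h
  have ht34 : 0 ≤ 260 * t ^ (3 / 4 : ℝ) := by positivity
  have hy0 : 0 < y := by linarith
  have hp : ∀ x, 0 ≤ y / (y ^ 2 + x ^ 2) := fun x => by positivity
  rcases lt_trichotomy γ 0 with h | h | h
  · have h1 := hpos (-γ) (by linarith)
    rw [oddPoissonIntegral_neg] at h1
    rw [abs_of_neg h, Real.sign_of_neg h]
    have h2 : oddPoissonIntegral y γ t - Real.pi * (if -γ ≤ t then -1 else 0) =
        -(-oddPoissonIntegral y γ t - Real.pi * (if -γ ≤ t then 1 else 0)) := by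
      split_ifs <;> ring
    rw [h2, abs_neg]
    refine h1.trans (mul_le_mul_of_nonneg_left ?_ ht34)
    have h3 := hker (-t - γ)
    have h4 := hp (t - γ)
    rw [show (-t - γ) ^ 2 = (t - -γ) ^ 2 by ring] at h3 ⊢
    linarith
  · rw [h]
    have : oddPoissonIntegral y 0 t = 0 := by simp [oddPoissonIntegral]
    rw [this, Real.sign_zero]
    simp only [ite_self, mul_zero, sub_zero, abs_zero]
    have h1 := hp t
    have h2 := hp (-t)
    positivity
  · have h1 := hpos γ h
    rw [abs_of_pos h, Real.sign_of_pos h]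
    refine h1.trans (mul_le_mul_of_nonneg_left ?_ ht34)
    have h3 := hker (t - γ)
    have h4 := hp (-t - γ)
    linarith

/-! ### Near symmetry of the centres of a sum of Poisson kernels -/

section Truncation

variable {ι E : Type*} [NormedAddCommGroup E] {γ : ι → ℝ}

/-- The sum of the terms `f i` with `|γ i| ≤ T`. As an unconditional sum, it is meaningful when
these terms are summable, for instance when they are finitely many. -/
noncomputable def truncatedSum (γ : ι → ℝ) (f : ι → E) (T : ℝ) : E :=
  ∑' i, if |γ i| ≤ T then f i else 0

theorem truncatedSum_eq_sum {T : ℝ} {S : Finset ι} (hS : ∀ i, |γ i| ≤ T → i ∈ S) (f : ι → E) :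
    truncatedSum γ f T = ∑ i ∈ S, if |γ i| ≤ T then f i else 0 :=
  tsum_eq_sum fun i hi => if_neg fun h => hi (hS i h)

theorem tendsto_truncatedSum [CompleteSpace E] {f : ι → E} (hf : Summable fun i => ‖f i‖) :
    Tendsto (truncatedSum γ f) atTop (𝓝 (∑' i, f i)) := by
  refine tendsto_tsum_of_dominated_convergence hf (fun i => ?_)
    (Eventually.of_forall fun T i => ?_)
  · refine tendsto_const_nhds.congr' ?_
    filter_upwards [eventually_ge_atTop |γ i|] with T hT
    rw [if_pos hT]
  · split_ifs
    · exact le_rfl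
    · simp

/-- A convergent weighted sum bounds the total mass in each window `|γ i| ≤ T`. -/
theorem summable_ite_of_weight {m : ι → ℝ} (hm : ∀ i, 0 ≤ m i)
    (hsum : Summable fun i => m i * (1 + |γ i|) ^ (-(3 / 2) : ℝ)) (T : ℝ) :
    Summable fun i => if |γ i| ≤ T then m i else 0 := by
  refine Summable.of_nonneg_of_le (fun i => ?_) (fun i => ?_)
    (hsum.mul_left ((1 + |T|) ^ (3 / 2 : ℝ)))
  · split_ifs <;> simp [hm i]
  · have h0 : (0 : ℝ) < 1 + |γ i| := by positivity
    split_ifs with h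
    · rw [mul_left_comm, Real.rpow_neg h0.le, ← div_eq_mul_inv]
      refine le_mul_of_one_le_right (hm i) ((one_le_div (by positivity)).2 ?_)
      exact Real.rpow_le_rpow h0.le (by linarith [le_abs_self T]) (by norm_num)
    · have := hm i
      positivity

theorem monotone_truncatedSum {f : ι → ℝ} (hf : ∀ i, 0 ≤ f i)
    (hs : ∀ T, Summable fun i => if |γ i| ≤ T then f i else 0) :
    Monotone (truncatedSum γ f) := fun S T hST =>
  (hs S).tsum_le_tsum (fun i => by
    split_ifs with h1 h2 h2
    · exact le_rfl
    · exact absurd (h1.trans hST) h2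
    · exact hf i
    · exact le_rfl) (hs T)

theorem abs_sign_le_one (x : ℝ) : |Real.sign x| ≤ 1 := by
  rcases Real.sign_apply_eq x with h | h | h <;> rw [h] <;> simp

theorem summable_ite_sign {m : ι → ℝ} (hm : ∀ i, 0 ≤ m i)
    (hsum : Summable fun i => m i * (1 + |γ i|) ^ (-(3 / 2) : ℝ)) (T : ℝ) :
    Summable fun i => if |γ i| ≤ T then m i * Real.sign (γ i) else 0 := by
  refine Summable.of_norm_bounded (summable_ite_of_weight hm hsum T) fun i => ?_
  split_ifs
  · rw [norm_mul, Real.norm_of_nonneg (hm i), Real.norm_eq_abs]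
    exact mul_le_of_le_one_right (hm i) (abs_sign_le_one _)
  · simp

/-- The signed counting function is a difference of two monotone functions. -/
theorem measurable_truncatedSum_sign {m : ι → ℝ} (hm : ∀ i, 0 ≤ m i)
    (hsum : Summable fun i => m i * (1 + |γ i|) ^ (-(3 / 2) : ℝ)) :
    Measurable (truncatedSum γ fun i => m i * Real.sign (γ i)) := by
  have hs := summable_ite_of_weight hm hsum
  have hs' := summable_ite_sign hm hsum
  have hadd : ∀ T, HasSum (fun i => if |γ i| ≤ T then m i * (1 + Real.sign (γ i)) else 0)
      (truncatedSum γ m T + truncatedSum γ (fun i => m i * Real.sign (γ i)) T) := fun T => by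
    refine ((hs T).hasSum.add (hs' T).hasSum).congr_fun fun i => ?_
    split_ifs <;> ring
  have heq : truncatedSum γ (fun i => m i * Real.sign (γ i)) = fun T =>
      truncatedSum γ (fun i => m i * (1 + Real.sign (γ i))) T - truncatedSum γ m T := by
    funext T
    rw [show truncatedSum γ (fun i => m i * (1 + Real.sign (γ i))) T = _ from (hadd T).tsum_eq]
    ring
  rw [heq]
  refine Measurable.sub (monotone_truncatedSum (fun i => ?_) fun T => (hadd T).summable).measurable
    (monotone_truncatedSum hm hs).measurable
  have := abs_le.1 (abs_sign_le_one (γ i))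
  exact mul_nonneg (hm i) (by linarith)

end Truncation

/-- Poisson kernels `y / (y² + (x - γ)²)` with `1 ≤ y ≤ 2` decay in `γ`, locally uniformly in
`x`. -/
theorem poisson_le_weight {y : ℝ} (hy1 : 1 ≤ y) (hy2 : y ≤ 2) (x γ : ℝ) :
    y / (y ^ 2 + (x - γ) ^ 2) ≤ 4 * (1 + |x|) ^ 2 * (1 + |γ|) ^ (-(3 / 2) : ℝ) := by
  have h1 : (1 + |γ|) ^ (-2 : ℝ) ≤ (1 + |γ|) ^ (-(3 / 2) : ℝ) :=
    Real.rpow_le_rpow_of_exponent_le (by linarith [abs_nonneg γ]) (by norm_num)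
  refine le_trans ?_ (mul_le_mul_of_nonneg_left h1 (by positivity))
  rw [Real.rpow_neg (by positivity), Real.rpow_two, ← div_eq_mul_inv]
  have h2 : 1 + |γ| ≤ (1 + |x - γ|) * (1 + |x|) := by
    have h3 : |γ| ≤ |x - γ| + |x| := by
      have := abs_sub_abs_le_abs_sub γ x
      rw [abs_sub_comm] at this; linarith
    nlinarith [mul_nonneg (abs_nonneg (x - γ)) (abs_nonneg x)]
  have h3 : (1 + |x - γ|) ^ 2 ≤ 2 * (1 + (x - γ) ^ 2) := by
    rw [← sq_abs (x - γ)]; nlinarith [sq_nonneg (1 - |x - γ|)]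
  have h4 : (1 + |γ|) ^ 2 ≤ 2 * (1 + (x - γ) ^ 2) * (1 + |x|) ^ 2 := by
    calc (1 + |γ|) ^ 2 ≤ ((1 + |x - γ|) * (1 + |x|)) ^ 2 := by gcongr
      _ = (1 + |x - γ|) ^ 2 * (1 + |x|) ^ 2 := by ring
      _ ≤ _ := by gcongr
  have h5 : y / (y ^ 2 + (x - γ) ^ 2) ≤ 2 / (1 + (x - γ) ^ 2) := by
    gcongr
    nlinarith
  refine h5.trans ?_
  rw [div_le_div_iff₀ (by positivity) (by positivity)]
  linarith

section SignedCount

variable {ι : Type*} [Countable ι] {m y γ : ι → ℝ} {φ : ℝ → ℝ}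

/-- A sum `φ` of Poisson kernels centred at the points `γ i` counts these points. If `φ` and the
primitive of its odd part grow slowly, the points are almost symmetric about the origin: the
signed number of points in `[-t, t]` is `O(t ^ (7/8))`. The function `φ` is given only through its
increments, as the partial fraction expansion of a logarithmic derivative provides them. -/
theorem exists_abs_truncatedSum_sign_le (hm : ∀ i, 0 ≤ m i) (hy1 : ∀ i, 1 ≤ y i)
    (hy2 : ∀ i, y i ≤ 2) (hsum : Summable fun i => m i * (1 + |γ i|) ^ (-(3 / 2) : ℝ))
    (hφ : ∀ t, HasSum (fun i => m i * (y i / (y i ^ 2 + (t - γ i) ^ 2) -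
      y i / (y i ^ 2 + (0 - γ i) ^ 2))) (φ t - φ 0))
    {K : ℝ} (hK : 0 ≤ K) (hφb : ∀ t, |φ t| ≤ K * (1 + |t|) ^ (1 / 8 : ℝ))
    (hφi : ∀ t, |∫ x in (0 : ℝ)..t, (φ x - φ (-x))| ≤ K * (1 + |t|) ^ (1 / 8 : ℝ)) :
    ∃ C : ℝ, 0 ≤ C ∧ ∀ t, 0 ≤ t →
      |truncatedSum γ (fun i => m i * Real.sign (γ i)) t| ≤ C * (1 + t) ^ (7 / 8 : ℝ) := by
  have hy0 : ∀ i, 0 < y i := fun i => by linarith [hy1 i]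
  set W := ∑' i, m i * (1 + |γ i|) ^ (-(3 / 2) : ℝ) with hW
  have hW0 : 0 ≤ W := tsum_nonneg fun i => mul_nonneg (hm i) (by positivity)
  have hp0 : ∀ i x, 0 ≤ y i / (y i ^ 2 + x ^ 2) := fun i x => by
    have := hy0 i; positivity
  have hps : ∀ x, Summable fun i => m i * (y i / (y i ^ 2 + (x - γ i) ^ 2)) := fun x => by
    refine Summable.of_nonneg_of_le (fun i => mul_nonneg (hm i) (hp0 i _)) (fun i => ?_)
      (hsum.mul_left (4 * (1 + |x|) ^ 2))
    rw [mul_left_comm]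
    exact mul_le_mul_of_nonneg_left (poisson_le_weight (hy1 i) (hy2 i) x (γ i)) (hm i)
  -- the kernels are summable, so `φ` is their sum up to the constant `b`
  set b := φ 0 - ∑' i, m i * (y i / (y i ^ 2 + (0 - γ i) ^ 2)) with hb
  have hφ' : ∀ t, HasSum (fun i => m i * (y i / (y i ^ 2 + (t - γ i) ^ 2))) (φ t - b) := fun t => by
    have h := (hφ t).add (hps 0).hasSum
    simp only [mul_sub, sub_add_cancel] at h
    convert h using 1
    rw [hb]; ring
  have hodd : ∀ x, HasSum (fun i => m i * (y i / (y i ^ 2 + (x - γ i) ^ 2) -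
      y i / (y i ^ 2 + (-x - γ i) ^ 2))) (φ x - φ (-x)) := fun x => by
    have h := (hφ' x).sub (hφ' (-x))
    simp only [← mul_sub] at h
    rwa [sub_sub_sub_cancel_right] at h
  have hpc : ∀ i, Continuous fun x : ℝ => y i / (y i ^ 2 + (x - γ i) ^ 2) := fun i =>
    continuous_const.div (by fun_prop) fun x => by
      have := hy0 i; positivity
  have hU : ∀ t, 0 ≤ t → HasSum (fun i => m i * oddPoissonIntegral (y i) (γ i) t)
      (∫ x in (0 : ℝ)..t, (φ x - φ (-x))) := fun t ht => by
    have h := hasSum_intervalIntegral_of_norm_le (x := 0) (y := t)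
      (hsum.mul_left (4 * (1 + t) ^ 2 + 4 * (1 + t) ^ 2))
      (f := fun i x => m i * (y i / (y i ^ 2 + (x - γ i) ^ 2) -
        y i / (y i ^ 2 + (-x - γ i) ^ 2)))
      (fun i => continuous_const.mul ((hpc i).sub ((hpc i).comp continuous_neg)))
      (fun i x hx => by
        rw [Set.uIoc_of_le ht] at hx
        have hxa : |x| ≤ t := by rw [abs_of_pos hx.1]; exact hx.2
        have hxa' : |-x| ≤ t := by rwa [abs_neg]
        have h1 : ∀ z, |z| ≤ t → y i / (y i ^ 2 + (z - γ i) ^ 2) ≤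
            4 * (1 + t) ^ 2 * (1 + |γ i|) ^ (-(3 / 2) : ℝ) := fun z hz =>
          (poisson_le_weight (hy1 i) (hy2 i) z (γ i)).trans (by gcongr)
        rw [norm_mul, Real.norm_of_nonneg (hm i), mul_left_comm]
        refine mul_le_mul_of_nonneg_left ?_ (hm i)
        rw [Real.norm_eq_abs, add_mul]
        refine (abs_sub _ _).trans ?_
        rw [abs_of_nonneg (hp0 i _), abs_of_nonneg (hp0 i _)]
        exact add_le_add (h1 x hxa) (h1 (-x) hxa')) hodd
    simp_rw [intervalIntegral.integral_const_mul, integral_odd_poisson (hy0 _)] at h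
    exact h
  refine ⟨K + 260 * (8 * K + 8 * |b| + W) + 4 * W, by positivity, fun t ht => ?_⟩
  have hone : ∀ p : ℝ, 0 ≤ p → 1 ≤ (1 + t) ^ p := fun p hp =>
    Real.one_le_rpow (by linarith) hp
  have hpow : 0 ≤ (1 + t) ^ (7 / 8 : ℝ) := by positivity
  rcases le_or_gt 1 t with ht1 | ht1
  -- for `t ≥ 1` the error terms sum to `O(t ^ (3/4))` times `φ t + φ (-t) = O(t ^ (1/8))`
  · set B := 260 * t ^ (3 / 4 : ℝ) with hBdef
    have hD := (summable_ite_sign hm hsum t).hasSum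
    have hdiff := (hU t ht).sub (hD.mul_left Real.pi)
    have hbound : HasSum (fun i => B * (4 * (m i * (y i / (y i ^ 2 + (t - γ i) ^ 2)) +
        m i * (y i / (y i ^ 2 + (-t - γ i) ^ 2))) + m i * (1 + |γ i|) ^ (-(3 / 2) : ℝ)))
        (B * (4 * ((φ t - b) + (φ (-t) - b)) + W)) :=
      ((((hφ' t).add (hφ' (-t))).mul_left 4).add hsum.hasSum).mul_left B
    have hle : |(∫ x in (0 : ℝ)..t, (φ x - φ (-x))) -
        Real.pi * truncatedSum γ (fun i => m i * Real.sign (γ i)) t| ≤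
        B * (4 * ((φ t - b) + (φ (-t) - b)) + W) := by
      rw [← Real.norm_eq_abs]
      have htr : truncatedSum γ (fun i => m i * Real.sign (γ i)) t =
        ∑' i, if |γ i| ≤ t then m i * Real.sign (γ i) else 0 := rfl
      rw [htr, ← hdiff.tsum_eq]
      refine tsum_of_norm_bounded hbound fun i => ?_
      have h1 := abs_oddPoissonIntegral_sub_sign_le (hy1 i) (hy2 i) (γ i) ht1
      have h2 : m i * oddPoissonIntegral (y i) (γ i) t -
          Real.pi * (if |γ i| ≤ t then m i * Real.sign (γ i) else 0) =
          m i * (oddPoissonIntegral (y i) (γ i) t -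
            Real.pi * (if |γ i| ≤ t then Real.sign (γ i) else 0)) := by
        split_ifs <;> ring
      rw [h2, norm_mul, Real.norm_of_nonneg (hm i), Real.norm_eq_abs]
      refine (mul_le_mul_of_nonneg_left h1 (hm i)).trans (le_of_eq ?_)
      rw [hBdef]; ring
    have hE : 1 ≤ (1 + t) ^ (1 / 8 : ℝ) := hone _ (by norm_num)
    have h3 := hφb t
    have h4 := hφb (-t)
    have h5 := hφi t
    rw [abs_neg, abs_of_nonneg ht] at h4
    rw [abs_of_nonneg ht] at h3 h5
    set E := (1 + t) ^ (1 / 8 : ℝ) with hEdef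
    have h6 : 4 * ((φ t - b) + (φ (-t) - b)) + W ≤ (8 * K + 8 * |b| + W) * E := by
      have h7 := (le_abs_self _).trans h3
      have h8 := (le_abs_self _).trans h4
      have h9 := neg_abs_le b
      have h10 : |b| ≤ |b| * E := le_mul_of_one_le_right (abs_nonneg b) hE
      have h11 : W ≤ W * E := le_mul_of_one_le_right hW0 hE
      linarith
    have h7 : t ^ (3 / 4 : ℝ) * E ≤ (1 + t) ^ (7 / 8 : ℝ) := by
      have : (1 + t) ^ (7 / 8 : ℝ) = (1 + t) ^ (3 / 4 : ℝ) * E := by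
        rw [hEdef, ← Real.rpow_add (by linarith)]; norm_num
      rw [this]
      gcongr
      linarith
    have h8 : E ≤ (1 + t) ^ (7 / 8 : ℝ) :=
      Real.rpow_le_rpow_of_exponent_le (by linarith) (by norm_num)
    have h9 : B * (4 * ((φ t - b) + (φ (-t) - b)) + W) ≤
        260 * (8 * K + 8 * |b| + W) * (1 + t) ^ (7 / 8 : ℝ) := by
      calc B * (4 * ((φ t - b) + (φ (-t) - b)) + W)
          ≤ B * ((8 * K + 8 * |b| + W) * E) := by gcongr
        _ = 260 * (8 * K + 8 * |b| + W) * (t ^ (3 / 4 : ℝ) * E) := by rw [hBdef]; ring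
        _ ≤ _ := by gcongr
    have h10 : K * E ≤ K * (1 + t) ^ (7 / 8 : ℝ) := by gcongr
    have h11 : 0 ≤ 4 * W * (1 + t) ^ (7 / 8 : ℝ) := by positivity
    set X := truncatedSum γ (fun i => m i * Real.sign (γ i)) t
    have h12 : |X| ≤ |Real.pi * X| := by
      rw [abs_mul, abs_of_pos Real.pi_pos]
      exact le_mul_of_one_le_left (abs_nonneg _) (by linarith [Real.pi_gt_three])
    have h13 : |Real.pi * X| ≤ |∫ x in (0 : ℝ)..t, (φ x - φ (-x))| +
        |(∫ x in (0 : ℝ)..t, (φ x - φ (-x))) - Real.pi * X| := by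
      have := abs_sub (∫ x in (0 : ℝ)..t, (φ x - φ (-x)))
        ((∫ x in (0 : ℝ)..t, (φ x - φ (-x))) - Real.pi * X)
      rwa [sub_sub_cancel] at this
    linarith
  -- for `t < 1` the trivial bound suffices
  · have h1 : |truncatedSum γ (fun i => m i * Real.sign (γ i)) t| ≤ 4 * W := by
      rw [← Real.norm_eq_abs]
      refine tsum_of_norm_bounded (hsum.hasSum.mul_left 4) fun i => ?_
      have h0 : (0 : ℝ) < 1 + |γ i| := by positivity
      split_ifs with h
      · rw [norm_mul, Real.norm_of_nonneg (hm i), Real.norm_eq_abs]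
        have h2 : (1 : ℝ) ≤ 4 * (1 + |γ i|) ^ (-(3 / 2) : ℝ) := by
          rw [Real.rpow_neg h0.le, ← div_eq_mul_inv, one_le_div (by positivity)]
          calc (1 + |γ i|) ^ (3 / 2 : ℝ) ≤ 2 ^ (3 / 2 : ℝ) := by gcongr; linarith
            _ ≤ 2 ^ (2 : ℝ) := Real.rpow_le_rpow_of_exponent_le one_le_two (by norm_num)
            _ = 4 := by norm_num
        have h3 := abs_sign_le_one (γ i)
        have h4 := hm i
        nlinarith [mul_le_mul_of_nonneg_left h2 h4, mul_le_mul_of_nonneg_left h3 h4]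
      · have := hm i
        rw [norm_zero]; positivity
    have h2 := hone (7 / 8) (by norm_num)
    have h3 : 4 * W ≤ 4 * W * (1 + t) ^ (7 / 8 : ℝ) := le_mul_of_one_le_right (by positivity) h2
    have h4 : 0 ≤ (K + 260 * (8 * K + 8 * |b| + W)) * (1 + t) ^ (7 / 8 : ℝ) := by positivity
    linarith

end SignedCount

theorem integral_ite_inv_sq {c T : ℝ} (hc : 0 ≤ c) (hcT : c ≤ T) :
    IntervalIntegrable (fun x : ℝ => if c ≤ x then ((1 + x) ^ 2)⁻¹ else 0) volume 0 T ∧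
      ∫ x in (0 : ℝ)..T, (if c ≤ x then ((1 + x) ^ 2)⁻¹ else 0) = 1 / (1 + c) - 1 / (1 + T) := by
  have hcont : ContinuousOn (fun x : ℝ => ((1 + x) ^ 2)⁻¹) (Set.uIcc c T) := by
    refine ContinuousOn.inv₀ (by fun_prop) fun x hx => ?_
    rw [Set.uIcc_of_le hcT] at hx
    have : 0 < 1 + x := by linarith [hx.1]
    positivity
  have hne : ∀ᵐ x : ℝ, x ≠ c := compl_mem_ae_iff.2 (measure_singleton c)
  have e1 : ∀ᵐ x : ℝ, x ∈ Set.uIoc 0 c →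
      (0 : ℝ) = if c ≤ x then ((1 + x) ^ 2)⁻¹ else 0 := by
    filter_upwards [hne] with x hx hx'
    rw [Set.uIoc_of_le hc] at hx'
    rw [if_neg fun h => hx (le_antisymm hx'.2 h)]
  have e2 : ∀ᵐ x : ℝ, x ∈ Set.uIoc c T →
      ((1 + x) ^ 2)⁻¹ = if c ≤ x then ((1 + x) ^ 2)⁻¹ else 0 := by
    refine Eventually.of_forall fun x hx' => ?_
    rw [Set.uIoc_of_le hcT] at hx'
    rw [if_pos hx'.1.le]
  have i1 : IntervalIntegrable (fun x : ℝ => if c ≤ x then ((1 + x) ^ 2)⁻¹ else 0) volume 0 c :=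
    (intervalIntegrable_const (c := (0 : ℝ))).congr_ae
      ((ae_restrict_iff' measurableSet_uIoc).2 e1)
  have i2 : IntervalIntegrable (fun x : ℝ => if c ≤ x then ((1 + x) ^ 2)⁻¹ else 0) volume c T :=
    hcont.intervalIntegrable.congr_ae ((ae_restrict_iff' measurableSet_uIoc).2 e2)
  refine ⟨i1.trans i2, ?_⟩
  rw [← intervalIntegral.integral_add_adjacent_intervals i1 i2,
    ← intervalIntegral.integral_congr_ae e1, ← intervalIntegral.integral_congr_ae e2,
    intervalIntegral.integral_zero, zero_add]
  have hd : ∀ x ∈ Set.uIcc c T, HasDerivAt (fun x : ℝ => -(1 + x)⁻¹) ((1 + x) ^ 2)⁻¹ x := by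
    intro x hx
    rw [Set.uIcc_of_le hcT] at hx
    have h0 : 1 + x ≠ 0 := by linarith [hx.1]
    refine (((hasDerivAt_id x).const_add 1).inv h0).neg.congr_deriv ?_
    simp only [id]
    field_simp
  rw [intervalIntegral.integral_eq_sub_of_hasDerivAt hd hcont.intervalIntegrable]
  ring

/-- Partial summation: if the signed number of points in `[-t, t]` is `O(t ^ (7/8))`, then the
symmetric sums of `sign γ / (1 + |γ|)` converge. -/
theorem exists_tendsto_truncatedSum_sign_div {ι : Type*} {m γ : ι → ℝ} (hm : ∀ i, 0 ≤ m i)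
    (hfin : ∀ T : ℝ, {i | |γ i| ≤ T}.Finite)
    (hsum : Summable fun i => m i * (1 + |γ i|) ^ (-(3 / 2) : ℝ)) {C : ℝ}
    (hD : ∀ t, 0 ≤ t →
      |truncatedSum γ (fun i => m i * Real.sign (γ i)) t| ≤ C * (1 + t) ^ (7 / 8 : ℝ)) :
    ∃ l : ℝ, Tendsto (truncatedSum γ fun i => m i * (Real.sign (γ i) / (1 + |γ i|))) atTop
      (𝓝 l) := by
  set N := truncatedSum γ fun i => m i * Real.sign (γ i) with hN
  -- summation by parts, with `1 / (1 + |γ|) - 1 / (1 + T) = ∫ (1 + x)⁻²` over `[|γ|, T]`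
  have habel : ∀ T, 0 ≤ T → truncatedSum γ (fun i => m i * (Real.sign (γ i) / (1 + |γ i|))) T =
      N T / (1 + T) + ∫ x in (0 : ℝ)..T, N x * ((1 + x) ^ 2)⁻¹ := by
    intro T hT
    set S := (hfin T).toFinset with hS
    have hmem : ∀ i, i ∈ S ↔ |γ i| ≤ T := fun i => by simp [hS]
    have hint : ∫ x in (0 : ℝ)..T, N x * ((1 + x) ^ 2)⁻¹ =
        ∑ i ∈ S, m i * Real.sign (γ i) * (1 / (1 + |γ i|) - 1 / (1 + T)) := by
      have h1 : ∀ x ∈ Set.uIcc 0 T, N x * ((1 + x) ^ 2)⁻¹ =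
          ∑ i ∈ S, m i * Real.sign (γ i) * (if |γ i| ≤ x then ((1 + x) ^ 2)⁻¹ else 0) := by
        intro x hx
        rw [Set.uIcc_of_le hT] at hx
        rw [hN, truncatedSum_eq_sum (S := S) fun i hi => (hmem i).2 (hi.trans hx.2),
          Finset.sum_mul]
        refine Finset.sum_congr rfl fun i _ => ?_
        split_ifs <;> ring
      rw [intervalIntegral.integral_congr h1, intervalIntegral.integral_finsetSum]
      · refine Finset.sum_congr rfl fun i hi => ?_
        rw [intervalIntegral.integral_const_mul,
          (integral_ite_inv_sq (abs_nonneg _) ((hmem i).1 hi)).2]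
      · exact fun i hi => (integral_ite_inv_sq (abs_nonneg _) ((hmem i).1 hi)).1.const_mul _
    rw [hint, hN, truncatedSum_eq_sum (S := S) fun i => (hmem i).2,
      truncatedSum_eq_sum (S := S) fun i => (hmem i).2, Finset.sum_div, ← Finset.sum_add_distrib]
    refine Finset.sum_congr rfl fun i hi => ?_
    rw [if_pos ((hmem i).1 hi), if_pos ((hmem i).1 hi)]
    ring
  have hlim1 : Tendsto (fun T => N T / (1 + T)) atTop (𝓝 0) := by
    have h0 : Tendsto (fun T : ℝ => C * (1 + T) ^ (-(1 / 8) : ℝ)) atTop (𝓝 0) := by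
      have h1 := (tendsto_rpow_neg_atTop (y := 1 / 8) (by norm_num)).comp
        (tendsto_atTop_add_const_left atTop (1 : ℝ) tendsto_id)
      simpa using h1.const_mul C
    refine squeeze_zero_norm' ?_ h0
    filter_upwards [eventually_ge_atTop 0] with T hT
    have hT1 : 0 < 1 + T := by linarith
    rw [norm_div, Real.norm_of_nonneg hT1.le, div_le_iff₀ hT1, mul_assoc,
      ← Real.rpow_add_one hT1.ne']
    norm_num
    exact hD T hT
  have hintegrable : IntegrableOn (fun x => N x * ((1 + x) ^ 2)⁻¹) (Set.Ioi 0) := by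
    have hdom := (integrableOn_add_rpow_Ioi_of_lt (a := -(9 / 8)) (c := 0) (m := 1) (by norm_num)
      (by norm_num)).const_mul C
    refine Integrable.mono' hdom ?_ ?_
    · exact ((measurable_truncatedSum_sign hm hsum).mul (by fun_prop)).aestronglyMeasurable
    · filter_upwards [self_mem_ae_restrict measurableSet_Ioi] with x hx
      have hx0 : 0 < 1 + x := by linarith [Set.mem_Ioi.1 hx]
      rw [norm_mul, Real.norm_of_nonneg (r := ((1 + x) ^ 2)⁻¹) (by positivity),
        ← div_eq_mul_inv, div_le_iff₀ (by positivity), add_comm x, mul_assoc, ← Real.rpow_two,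
        ← Real.rpow_add hx0]
      norm_num
      exact hD x (le_of_lt hx)
  have hlim2 := intervalIntegral_tendsto_integral_Ioi 0 hintegrable tendsto_id
  refine ⟨0 + ∫ x in Set.Ioi 0, N x * ((1 + x) ^ 2)⁻¹, (hlim1.add hlim2).congr' ?_⟩
  filter_upwards [eventually_ge_atTop 0] with T hT
  rw [habel T hT]
  rfl

/-! ### Sums over the non-trivial zeros -/

/-- A finite sum over the members of `A` that satisfy `p`, as a sum over the subtype `A`. -/
theorem finsum_mem_eq_tsum_ite {α E : Type*} [AddCommMonoid E] [TopologicalSpace E] {A : Set α}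
    {p : α → Prop} [DecidablePred p] (hfin : {a | a ∈ A ∧ p a}.Finite) (g : α → E) :
    ∑ᶠ a ∈ {a | a ∈ A ∧ p a}, g a = ∑' a : A, if p a then g a else 0 := by
  rw [tsum_subtype A fun a => if p a then g a else 0, finsum_mem_def,
    ← tsum_eq_finsum (L := SummationFilter.unconditional α)]
  · congr 1
    funext a
    by_cases h1 : a ∈ A <;> by_cases h2 : p a <;> simp [h1, h2]
  · exact hfin.subset fun a ha => by
      by_contra h
      exact ha (Set.indicator_of_notMem h g)

namespace IsSharpFlat

variable {F : ℂ → ℂ} {D : GammaData}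

theorem finite_zerosUpTo (hF : IsSharpFlat F D) (T : ℝ) : (zerosUpTo F D T).Finite := by
  refine (hF.differentiable_xi.finite_zeros_inter_of_isCompact hF.xi_two_ne_zero
    (isCompact_closedBall 0 (1 + T))).subset fun ρ hρ => ⟨?_, hρ.1⟩
  rw [mem_closedBall_zero_iff]
  refine (Complex.norm_le_abs_re_add_abs_im ρ).trans (add_le_add ?_ hρ.2)
  rw [abs_of_nonneg (hF.re_nonneg hρ.1)]
  exact hF.re_le_one hρ.1

theorem finite_abs_im_le (hF : IsSharpFlat F D) (T : ℝ) :
    {ρ : nontrivialZeros F D | |(ρ : ℂ).im| ≤ T}.Finite :=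
  ((hF.finite_zerosUpTo T).preimage Subtype.val_injective.injOn).subset fun ρ hρ => ⟨ρ.2, hρ⟩

theorem countable_nontrivialZeros (hF : IsSharpFlat F D) : Countable (nontrivialZeros F D) := by
  rw [← Set.countable_univ_iff]
  refine (Set.countable_iUnion fun n : ℕ => (hF.finite_abs_im_le n).countable).mono fun ρ _ => ?_
  exact Set.mem_iUnion.2 (exists_nat_ge |(ρ : ℂ).im|)

/-- The weight depends on the ordinate alone, because the zeros lie in the strip `0 ≤ σ ≤ 1`. -/
theorem summable_weight (hF : IsSharpFlat F D) :
    Summable fun ρ : nontrivialZeros F D =>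
      (zeroMult F D ρ : ℝ) * (1 + |(ρ : ℂ).im|) ^ (-(3 / 2) : ℝ) := by
  obtain ⟨C, hC, hgr⟩ := hF.exists_growth
  have h := (hF.differentiable_xi.summable_zeros_of_growth hF.xi_two_ne_zero hC hgr).mul_left
    ((3 : ℝ) ^ (3 / 2 : ℝ))
  refine Summable.of_nonneg_of_le (fun ρ => by positivity) (fun ρ => ?_) h
  rw [mul_left_comm]
  refine mul_le_mul_of_nonneg_left ?_ (Nat.cast_nonneg _)
  set r : ℝ := 1 + |(ρ : ℂ).im| with hr
  set R : ℝ := 1 + ‖((ρ : ℂ)) - 2‖ with hR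
  have hr0 : 0 < r := by positivity
  have hR0 : 0 < R := by positivity
  have hle : R ≤ 3 * r := by
    have h1 := Complex.norm_le_abs_re_add_abs_im ((ρ : ℂ) - 2)
    have h2 : |((ρ : ℂ) - 2).re| ≤ 2 := by
      have := hF.re_nonneg ρ.2
      have := hF.re_le_one ρ.2
      rw [abs_le]
      constructor <;> simp <;> linarith
    have h3 : ((ρ : ℂ) - 2).im = (ρ : ℂ).im := by simp
    rw [h3] at h1
    linarith [abs_nonneg (ρ : ℂ).im]
  rw [Real.rpow_neg hr0.le, Real.rpow_neg hR0.le, ← div_eq_mul_inv,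
    inv_le_comm₀ (by positivity) (by positivity), inv_div,
    div_le_iff₀ (by positivity), mul_comm, ← Real.mul_rpow (by norm_num) hr0.le]
  exact Real.rpow_le_rpow hR0.le hle (by norm_num)

/-- Terms that are `O(1/γ²)` away from the real axis are summable over the zeros; the finitely many
zeros with `|γ| < 1` are harmless. -/
theorem summable_zeroMult_mul_norm (hF : IsSharpFlat F D) {E : Type*} [NormedAddCommGroup E]
    {f : ℂ → E} {K : ℝ} (hK : 0 ≤ K)
    (hf : ∀ ρ ∈ nontrivialZeros F D, 1 ≤ |ρ.im| → ‖f ρ‖ ≤ K / ρ.im ^ 2) :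
    Summable fun ρ : nontrivialZeros F D => (zeroMult F D ρ : ℝ) * ‖f ρ‖ := by
  refine Summable.of_norm_bounded_eventually (hF.summable_weight.mul_left (K * 4)) ?_
  filter_upwards [(hF.finite_abs_im_le 1).compl_mem_cofinite] with ρ hρ
  have h1 : 1 ≤ |(ρ : ℂ).im| := le_of_lt (not_le.1 hρ)
  rw [Real.norm_of_nonneg (by positivity), mul_left_comm]
  refine mul_le_mul_of_nonneg_left ((hf ρ ρ.2 h1).trans ?_) (Nat.cast_nonneg _)
  rw [div_eq_mul_inv, mul_assoc]
  refine mul_le_mul_of_nonneg_left ?_ hK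
  have h2 : (1 + |(ρ : ℂ).im|) ^ (-2 : ℝ) ≤ (1 + |(ρ : ℂ).im|) ^ (-(3 / 2) : ℝ) :=
    Real.rpow_le_rpow_of_exponent_le (by linarith) (by norm_num)
  refine le_trans ?_ (mul_le_mul_of_nonneg_left h2 (by norm_num))
  rw [Real.rpow_neg (by positivity), Real.rpow_two, ← div_eq_mul_inv, ← sq_abs,
    inv_le_comm₀ (by positivity) (by positivity), inv_div, div_le_iff₀ (by norm_num)]
  nlinarith

theorem liPartialSum_eq (hF : IsSharpFlat F D) (n : ℤ) (T : ℝ) :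
    liPartialSum F D n T = truncatedSum (fun ρ : nontrivialZeros F D => (ρ : ℂ).im)
      (fun ρ => (zeroMult F D ρ : ℂ) * (1 - (1 - 1 / (ρ : ℂ)) ^ n)) T :=
  finsum_mem_eq_tsum_ite (hF.finite_zerosUpTo T) _

theorem zeroCount_eq (hF : IsSharpFlat F D) (T : ℝ) :
    (zeroCount F D T : ℝ) = truncatedSum (fun ρ : nontrivialZeros F D => (ρ : ℂ).im)
      (fun ρ => (zeroMult F D ρ : ℝ)) T := by
  rw [zeroCount, finsum_mem_eq_finite_toFinset_sum _ (hF.finite_zerosUpTo T), Nat.cast_sum,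
    ← finsum_mem_eq_finite_toFinset_sum _ (hF.finite_zerosUpTo T)]
  exact finsum_mem_eq_tsum_ite (hF.finite_zerosUpTo T) fun ρ => (zeroMult F D ρ : ℝ)

theorem re_one_div_sub (t : ℝ) (ρ : ℂ) : (1 / (2 + t * I - ρ)).re =
    (2 - ρ.re) / ((2 - ρ.re) ^ 2 + (t - ρ.im) ^ 2) := by
  rw [one_div, Complex.inv_re, Complex.normSq_apply]
  simp [pow_two]

/-- The zeros are almost symmetric about the real axis, so that the symmetric sums of
`sign γ / (1 + |γ|)`, which does not decay fast enough for absolute convergence, converge. -/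
theorem exists_tendsto_sign_sum (hF : IsSharpFlat F D) :
    ∃ l : ℝ, Tendsto (truncatedSum (fun ρ : nontrivialZeros F D => (ρ : ℂ).im) fun ρ =>
      (zeroMult F D ρ : ℝ) * (Real.sign (ρ : ℂ).im / (1 + |(ρ : ℂ).im|))) atTop (𝓝 l) := by
  have := hF.countable_nontrivialZeros
  obtain ⟨K, hK, hb, hi⟩ := hF.exists_bounds_logDeriv_xi
  obtain ⟨C, hC, hgr⟩ := hF.exists_growth
  have hne : ∀ t : ℝ, completedXi F D (2 + t * I) ≠ 0 := fun t => hF.xi_ne_zero (by simp)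
  obtain ⟨C', -, hC'⟩ := exists_abs_truncatedSum_sign_le
    (m := fun ρ : nontrivialZeros F D => (zeroMult F D ρ : ℝ))
    (y := fun ρ => 2 - (ρ : ℂ).re) (γ := fun ρ => (ρ : ℂ).im)
    (φ := fun t => (logDeriv (completedXi F D) (2 + t * I)).re)
    (fun ρ => Nat.cast_nonneg _) (fun ρ => by linarith [hF.re_le_one ρ.2])
    (fun ρ => by linarith [hF.re_nonneg ρ.2]) hF.summable_weight (fun t => by
      have h := Complex.hasSum_re (hF.differentiable_xi.hasSum_logDeriv_sub hF.xi_two_ne_zero hC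
        hgr (hne t) (hne 0))
      rw [Complex.sub_re] at h
      refine h.congr_fun fun ρ => ?_
      rw [← Complex.ofReal_natCast, Complex.re_ofReal_mul, Complex.sub_re, re_one_div_sub,
        re_one_div_sub]
      rfl) hK hb hi
  exact exists_tendsto_truncatedSum_sign_div (fun ρ => Nat.cast_nonneg _) hF.finite_abs_im_le
    hF.summable_weight hC'

/-- The part of `1/ρ` that is not absolutely summable over the zeros is `-i sign(γ) / (1 + |γ|)`. -/
theorem norm_inv_add_sign_le {ρ : ℂ} (h0 : 0 ≤ ρ.re) (h1 : ρ.re ≤ 1) (hγ : 1 ≤ |ρ.im|) :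
    ‖1 / ρ + I * ((Real.sign ρ.im / (1 + |ρ.im|) : ℝ) : ℂ)‖ ≤ 2 / ρ.im ^ 2 := by
  have hρ : ρ ≠ 0 := by
    rintro rfl
    norm_num at hγ
  have hs : Real.sign ρ.im * ρ.im = |ρ.im| := by
    rcases lt_or_gt_of_ne (abs_pos.1 (by linarith : 0 < |ρ.im|)) with h | h
    · rw [Real.sign_of_neg h, abs_of_neg h]; ring
    · rw [Real.sign_of_pos h, abs_of_pos h]; ring
  have hd : ((1 + |ρ.im| : ℝ) : ℂ) ≠ 0 := Complex.ofReal_ne_zero.2 (by positivity)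
  have heq : 1 / ρ + I * ((Real.sign ρ.im / (1 + |ρ.im|) : ℝ) : ℂ) =
      (1 + I * ((Real.sign ρ.im * ρ.re : ℝ) : ℂ)) / (ρ * ((1 + |ρ.im| : ℝ) : ℂ)) := by
    rw [Complex.ofReal_div, eq_div_iff (mul_ne_zero hρ hd)]
    field_simp
    apply Complex.ext
    · simp; linarith
    · simp; ring
  rw [heq, norm_div, norm_mul, ← sq_abs ρ.im, Complex.norm_real,
    Real.norm_of_nonneg (by positivity)]
  have hnum : ‖1 + I * ((Real.sign ρ.im * ρ.re : ℝ) : ℂ)‖ ≤ 2 := by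
    refine (norm_add_le _ _).trans ?_
    rw [norm_one, norm_mul, Complex.norm_I, Complex.norm_real, one_mul, norm_mul,
      Real.norm_of_nonneg h0, Real.norm_eq_abs]
    nlinarith [abs_sign_le_one ρ.im, abs_nonneg (Real.sign ρ.im)]
  have hden : |ρ.im| ^ 2 ≤ ‖ρ‖ * (1 + |ρ.im|) := by
    have := Complex.abs_im_le_norm ρ
    nlinarith
  exact div_le_div₀ (by norm_num) hnum (by positivity) hden

/-- The limit defining a generalized Li coefficient exists whenever the terms
`1 - (1 - 1/ρ)^n` equal `c / ρ` up to `O(1/γ²)`; the real parts of the terms are then absolutely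
summable. -/
theorem tendsto_liPartialSum (hF : IsSharpFlat F D) {n : ℤ} {c K : ℝ} (hc : 0 ≤ c) (hK : 0 ≤ K)
    (hn : ∀ ρ : ℂ, 1 ≤ |ρ.im| → ‖1 - (1 - 1 / ρ) ^ n - c * (1 / ρ)‖ ≤ K / ρ.im ^ 2) :
    Tendsto (liPartialSum F D n) atTop (𝓝 (liCoeff F D n)) ∧
      HasSum (fun ρ : nontrivialZeros F D =>
        (zeroMult F D ρ : ℝ) * (1 - (1 - 1 / (ρ : ℂ)) ^ n).re) (liCoeff F D n).re := by
  set γ : nontrivialZeros F D → ℝ := fun ρ => (ρ : ℂ).im with hγ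
  set s : nontrivialZeros F D → ℝ := fun ρ =>
    (zeroMult F D ρ : ℝ) * (Real.sign (ρ : ℂ).im / (1 + |(ρ : ℂ).im|)) with hs
  obtain ⟨l, hl⟩ := hF.exists_tendsto_sign_sum
  -- `g` is absolutely summable, and differs from the terms by purely imaginary numbers
  set g : ℂ → ℂ := fun ρ => 1 - (1 - 1 / ρ) ^ n +
    c * I * ((Real.sign ρ.im / (1 + |ρ.im|) : ℝ) : ℂ) with hg
  have hgs : Summable fun ρ : nontrivialZeros F D => ‖(zeroMult F D ρ : ℂ) * g ρ‖ := by
    simp_rw [norm_mul, Complex.norm_natCast]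
    refine hF.summable_zeroMult_mul_norm (f := g) (K := K + c * 2) (by positivity)
      fun ρ hρ h1 => ?_
    have : g ρ = (1 - (1 - 1 / ρ) ^ n - c * (1 / ρ)) +
        c * (1 / ρ + I * ((Real.sign ρ.im / (1 + |ρ.im|) : ℝ) : ℂ)) := by
      rw [hg]; ring
    rw [this, add_div]
    refine (norm_add_le _ _).trans (add_le_add (hn ρ h1) ?_)
    rw [norm_mul, Complex.norm_real, Real.norm_of_nonneg hc, mul_div_assoc]
    exact mul_le_mul_of_nonneg_left
      (norm_inv_add_sign_le (hF.re_nonneg hρ) (hF.re_le_one hρ) h1) hc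
  have heq : ∀ T, liPartialSum F D n T =
      truncatedSum γ (fun ρ => (zeroMult F D ρ : ℂ) * g ρ) T -
        c * I * (truncatedSum γ s T : ℝ) := by
    intro T
    have hmem : ∀ ρ, |γ ρ| ≤ T → ρ ∈ (hF.finite_abs_im_le T).toFinset := fun ρ hρ => by
      simpa using hρ
    rw [hF.liPartialSum_eq, truncatedSum_eq_sum hmem, truncatedSum_eq_sum hmem,
      truncatedSum_eq_sum hmem, Complex.ofReal_sum, Finset.mul_sum, ← Finset.sum_sub_distrib]
    refine Finset.sum_congr rfl fun ρ _ => ?_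
    split_ifs
    · rw [hs, hg]
      push_cast
      ring
    · simp
  have ht : Tendsto (liPartialSum F D n) atTop
      (𝓝 (∑' ρ : nontrivialZeros F D, (zeroMult F D ρ : ℂ) * g ρ - c * I * (l : ℝ))) := by
    rw [funext heq]
    exact (tendsto_truncatedSum hgs).sub
      (((Complex.continuous_ofReal.tendsto l).comp hl).const_mul _)
  have hlim : liCoeff F D n = _ := ht.limUnder_eq
  rw [hlim]
  refine ⟨ht, ?_⟩
  have hre := Complex.hasSum_re hgs.of_norm.hasSum
  have h1 : ∀ x : ℝ, ((c : ℂ) * I * x).re = 0 := fun x => by simp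
  rw [Complex.sub_re, h1, sub_zero]
  refine hre.congr_fun fun ρ => ?_
  rw [← Complex.ofReal_natCast, Complex.re_ofReal_mul, hg, Complex.add_re, h1, add_zero]

/-! ### Comparison with the critical line -/

/-- The reflection `ρ ↦ 1 - conj ρ` of the non-trivial zeros. -/
noncomputable def reflectZero (hF : IsSharpFlat F D) :
    nontrivialZeros F D ≃ nontrivialZeros F D where
  toFun ρ := ⟨1 - starRingEnd ℂ ρ, (hF.xi_reflect_eq_zero_iff ρ).2 ρ.2⟩
  invFun ρ := ⟨1 - starRingEnd ℂ ρ, (hF.xi_reflect_eq_zero_iff ρ).2 ρ.2⟩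
  left_inv ρ := by simp
  right_inv ρ := by simp

/-- Averaging a sum over the zeros with respect to the reflection `ρ ↦ 1 - conj ρ` detects zeros
off the critical line, if each of them makes the average smaller. -/
theorem grh_iff_tsum_eq (hF : IsSharpFlat F D) {u : ℂ → ℝ} {v : ℝ → ℝ} {S : ℝ}
    (hu : HasSum (fun ρ : nontrivialZeros F D => (zeroMult F D ρ : ℝ) * u ρ) S)
    (hv : Summable (ordinateTerm F D v))
    (heq : ∀ ρ ∈ nontrivialZeros F D, ρ.re = 1 / 2 → u ρ = v ρ.im)
    (hlt : ∀ ρ ∈ nontrivialZeros F D, ρ.re ≠ 1 / 2 →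
      u ρ + u (1 - starRingEnd ℂ ρ) < 2 * v ρ.im) :
    GRH F D ↔ S = ∑' ρ, ordinateTerm F D v ρ := by
  constructor
  · intro h
    rw [← hu.tsum_eq]
    exact tsum_congr fun ρ => by rw [ordinateTerm, heq ρ ρ.2 (h ρ ρ.2)]
  · intro h
    by_contra hG
    rw [GRH] at hG
    push Not at hG
    obtain ⟨ρ₀, hρ₀, hne⟩ := hG
    have hu' : HasSum (fun ρ : nontrivialZeros F D => (zeroMult F D ρ : ℝ) *
        (u ρ + u (1 - starRingEnd ℂ ρ))) (S + S) := by
      refine (hu.add (hF.reflectZero.hasSum_iff.2 hu)).congr_fun fun ρ => ?_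
      change _ = _ + (zeroMult F D (1 - starRingEnd ℂ ρ) : ℝ) * u (1 - starRingEnd ℂ ρ)
      rw [hF.zeroMult_reflect, mul_add]
    have hv' : HasSum (fun ρ : nontrivialZeros F D => (zeroMult F D ρ : ℝ) * (2 * v (ρ : ℂ).im))
        (2 * ∑' ρ, ordinateTerm F D v ρ) :=
      (hv.hasSum.mul_left 2).congr_fun fun ρ => by rw [ordinateTerm, mul_left_comm]
    have hle : ∀ ρ : nontrivialZeros F D,
        u ρ + u (1 - starRingEnd ℂ ρ) ≤ 2 * v (ρ : ℂ).im := by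
      intro ρ
      by_cases hρ : (ρ : ℂ).re = 1 / 2
      · have : 1 - starRingEnd ℂ (ρ : ℂ) = ρ := by
          apply Complex.ext
          · simp; linarith
          · simp
        rw [this, heq ρ ρ.2 hρ, two_mul]
      · exact (hlt ρ ρ.2 hρ).le
    have hm : (0 : ℝ) < (zeroMult F D ρ₀ : ℝ) := Nat.cast_pos.2 (hF.zeroMult_pos hρ₀)
    have hlt' := mul_lt_mul_of_pos_left (hlt ρ₀ hρ₀ hne) hm
    have hle' : ∀ ρ : nontrivialZeros F D, (zeroMult F D ρ : ℝ) *
        (u ρ + u (1 - starRingEnd ℂ ρ)) ≤ (zeroMult F D ρ : ℝ) * (2 * v (ρ : ℂ).im) :=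
      fun ρ => mul_le_mul_of_nonneg_left (hle ρ) (Nat.cast_nonneg _)
    have := hasSum_lt (i := (⟨ρ₀, hρ₀⟩ : nontrivialZeros F D)) hle' hlt' hu' hv'
    linarith

/-! ### Integrals against the counting function -/

/-- Integration of a kernel against the counting function `N_F`, term by term: a zero is counted
for `x ≥ |γ|` and so contributes the integral of `k` over the half-line from `|γ|`. The bound on
`k` makes up for the growth `N_F(x) = O(x^(3/2))`. -/
theorem integral_mul_zeroCount (hF : IsSharpFlat F D) {k g : ℝ → ℝ} {K : ℝ} (hK : 0 ≤ K)
    (hk : Continuous k) (hkb : ∀ x, 0 < x → |k x| ≤ K * (1 + x) ^ (-3 : ℝ))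
    (hg : ∀ c, 0 ≤ c → ∫ x in Set.Ioi c, k x = g c) :
    IntegrableOn (fun x => k x * (zeroCount F D x : ℝ)) (Set.Ioi 0) ∧
      ∫ x in Set.Ioi (0 : ℝ), k x * (zeroCount F D x : ℝ) =
        ∑' ρ, ordinateTerm F D (fun γ => g |γ|) ρ := by
  have := hF.countable_nontrivialZeros
  have hW := hF.summable_weight
  set W := ∑' ρ : nontrivialZeros F D,
    (zeroMult F D ρ : ℝ) * (1 + |(ρ : ℂ).im|) ^ (-(3 / 2) : ℝ) with hWdef
  have hfin := summable_ite_of_weight (fun ρ : nontrivialZeros F D =>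
    (Nat.cast_nonneg (zeroMult F D ρ) : (0 : ℝ) ≤ _)) hW
  have hN : ∀ x, 0 < x → (zeroCount F D x : ℝ) ≤ W * (1 + x) ^ (3 / 2 : ℝ) := by
    intro x hx
    rw [hF.zeroCount_eq, hWdef, ← tsum_mul_right]
    refine (hfin x).tsum_le_tsum (fun ρ => ?_) (hW.mul_right _)
    have h0 : (0 : ℝ) < 1 + |(ρ : ℂ).im| := by positivity
    split_ifs with h
    · rw [mul_assoc, Real.rpow_neg h0.le, inv_mul_eq_div]
      exact le_mul_of_one_le_right (Nat.cast_nonneg _) ((one_le_div (by positivity)).2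
        (Real.rpow_le_rpow h0.le (by linarith) (by norm_num)))
    · positivity
  have hmeas : Measurable fun x => (zeroCount F D x : ℝ) := by
    simp_rw [hF.zeroCount_eq]
    exact (monotone_truncatedSum (fun ρ => Nat.cast_nonneg _) hfin).measurable
  have habs : IntegrableOn (fun x => |k x| * (zeroCount F D x : ℝ)) (Set.Ioi 0) := by
    refine Integrable.mono' ((integrableOn_add_rpow_Ioi_of_lt (a := -(3 / 2)) (c := 0) (m := 1)
      (by norm_num) (by norm_num)).const_mul (K * W))
      (hk.abs.measurable.mul hmeas).aestronglyMeasurable ?_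
    filter_upwards [self_mem_ae_restrict measurableSet_Ioi] with x hx
    have hx0 : 0 < 1 + x := by linarith [Set.mem_Ioi.1 hx]
    have hp : (x + 1) ^ (-(3 / 2) : ℝ) = (1 + x) ^ (-3 : ℝ) * (1 + x) ^ (3 / 2 : ℝ) := by
      rw [← Real.rpow_add hx0, add_comm]; norm_num
    rw [Real.norm_of_nonneg (by positivity), hp, mul_mul_mul_comm]
    exact mul_le_mul (hkb x hx) (hN x hx) (Nat.cast_nonneg _) (by positivity)
  have hterm : ∀ x, HasSum (fun ρ : nontrivialZeros F D =>
      |k x| * if |(ρ : ℂ).im| ≤ x then (zeroMult F D ρ : ℝ) else 0)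
      (|k x| * (zeroCount F D x : ℝ)) := fun x => by
    rw [hF.zeroCount_eq]
    exact (hfin x).hasSum.mul_left _
  have hint := hasSum_integral_of_dominated_convergence (μ := volume.restrict (Set.Ioi (0 : ℝ)))
    (F := fun (ρ : nontrivialZeros F D) x =>
      k x * if |(ρ : ℂ).im| ≤ x then (zeroMult F D ρ : ℝ) else 0)
    (f := fun x => k x * (zeroCount F D x : ℝ))
    (fun (ρ : nontrivialZeros F D) x =>
      |k x| * if |(ρ : ℂ).im| ≤ x then (zeroMult F D ρ : ℝ) else 0)
    (fun ρ => (hk.measurable.mul (Measurable.ite measurableSet_Ici measurable_const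
      measurable_const)).aestronglyMeasurable)
    (fun ρ => Eventually.of_forall fun x => by
      rw [norm_mul, Real.norm_eq_abs, Real.norm_of_nonneg (by split_ifs <;> positivity)])
    (Eventually.of_forall fun x => (hterm x).summable)
    (habs.congr (Eventually.of_forall fun x => (hterm x).tsum_eq.symm))
    (Eventually.of_forall fun x => by
      rw [hF.zeroCount_eq]
      exact (hfin x).hasSum.mul_left _)
  refine ⟨habs.mono' (hk.measurable.mul hmeas).aestronglyMeasurable
    (Eventually.of_forall fun x => ?_), ?_⟩
  · rw [norm_mul, Real.norm_eq_abs, Real.norm_of_nonneg (Nat.cast_nonneg _)]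
  · rw [← hint.tsum_eq]
    refine tsum_congr fun ρ => ?_
    have hc : 0 ≤ |(ρ : ℂ).im| := abs_nonneg _
    rw [ordinateTerm, ← hg _ hc]
    have h1 : ∀ x, (k x * if |(ρ : ℂ).im| ≤ x then (zeroMult F D ρ : ℝ) else 0) =
        (zeroMult F D ρ : ℝ) * (Set.Ici |(ρ : ℂ).im|).indicator k x := fun x => by
      by_cases h : |(ρ : ℂ).im| ≤ x
      · rw [if_pos h, Set.indicator_of_mem (Set.mem_Ici.2 h), mul_comm]
      · rw [if_neg h, Set.indicator_of_notMem (by simpa using h), mul_zero, mul_zero]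
    simp_rw [h1]
    rw [integral_const_mul, setIntegral_indicator measurableSet_Ici]
    congr 1
    refine setIntegral_congr_set ?_
    have h2 : Set.Ioi |(ρ : ℂ).im| = Set.Ioi 0 ∩ Set.Ioi |(ρ : ℂ).im| := by
      rw [Set.Ioi_inter_Ioi, max_eq_right hc]
    rw [h2]
    exact (ae_eq_refl _).inter Ioi_ae_eq_Ici.symm

end IsSharpFlat

/-! ### The terms and the kernels for `n = 1` and `n = 2` -/

/-- Two reflected zeros `1/2 ± β + iγ` off the critical line have `Re (1/ρ + 1/ρ')` less than twice
its value at `β = 0`. -/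
theorem re_inv_add_re_inv_reflect_lt {β γ : ℝ} (hβ : β ≠ 0) (hγ : 1 / 3 < γ ^ 2) :
    (1 / 2 + β) / ((1 / 2 + β) ^ 2 + γ ^ 2) + (1 / 2 - β) / ((1 / 2 - β) ^ 2 + γ ^ 2) <
      2 * (2 / (4 * γ ^ 2 + 1)) := by
  have h1 : 0 < (1 / 2 + β) ^ 2 + γ ^ 2 := by positivity
  have h2 : 0 < (1 / 2 - β) ^ 2 + γ ^ 2 := by positivity
  have h3 : 0 < 4 * γ ^ 2 + 1 := by positivity
  have hb : 0 < β ^ 2 := by positivity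
  have key : 2 * (2 / (4 * γ ^ 2 + 1)) - ((1 / 2 + β) / ((1 / 2 + β) ^ 2 + γ ^ 2) +
      (1 / 2 - β) / ((1 / 2 - β) ^ 2 + γ ^ 2)) =
      4 * β ^ 2 * (3 * γ ^ 2 + β ^ 2 - 1 / 4) /
        ((4 * γ ^ 2 + 1) * (((1 / 2 + β) ^ 2 + γ ^ 2) * ((1 / 2 - β) ^ 2 + γ ^ 2))) := by
    field_simp
    ring
  have h4 : 0 < 3 * γ ^ 2 + β ^ 2 - 1 / 4 := by linarith
  rw [← sub_pos, key]
  positivity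

/-- The analogue of `re_inv_add_re_inv_reflect_lt` for `Re (1 - (1 - 1/ρ)²)`, in the form given by
`re_li_two_eq`. -/
theorem re_li_two_add_reflect_lt {β γ : ℝ} (hβ : β ≠ 0) (hγ : 6 < γ ^ 2) :
    (2 * β / ((1 / 2 + β) ^ 2 + γ ^ 2) + 2 * γ ^ 2 / ((1 / 2 + β) ^ 2 + γ ^ 2) ^ 2) +
      (-(2 * β) / ((1 / 2 - β) ^ 2 + γ ^ 2) + 2 * γ ^ 2 / ((1 / 2 - β) ^ 2 + γ ^ 2) ^ 2) <
      2 * (32 * γ ^ 2 / (4 * γ ^ 2 + 1) ^ 2) := by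
  have h1 : 0 < (1 / 2 + β) ^ 2 + γ ^ 2 := by positivity
  have h2 : 0 < (1 / 2 - β) ^ 2 + γ ^ 2 := by positivity
  have h3 : 0 < 4 * γ ^ 2 + 1 := by positivity
  have hb : 0 < β ^ 2 := by positivity
  -- abbreviations in which the difference of the two sides is visibly positive
  obtain ⟨h, hh⟩ : ∃ h, h = γ ^ 2 + 1 / 4 := ⟨_, rfl⟩
  obtain ⟨B, hB⟩ : ∃ B, B = β ^ 2 := ⟨_, rfl⟩
  have key : 2 * (32 * γ ^ 2 / (4 * γ ^ 2 + 1) ^ 2) -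
      ((2 * β / ((1 / 2 + β) ^ 2 + γ ^ 2) + 2 * γ ^ 2 / ((1 / 2 + β) ^ 2 + γ ^ 2) ^ 2) +
      (-(2 * β) / ((1 / 2 - β) ^ 2 + γ ^ 2) + 2 * γ ^ 2 / ((1 / 2 - β) ^ 2 + γ ^ 2) ^ 2)) =
      64 * B * (γ ^ 2 * (h ^ 2 * (2 * h + B - 3) + B * (2 * h + B - 1) ^ 2) +
        h ^ 2 * (h ^ 2 + 2 * h * B + B ^ 2 - B)) /
        ((4 * γ ^ 2 + 1) ^ 2 * (((1 / 2 + β) ^ 2 + γ ^ 2) * ((1 / 2 - β) ^ 2 + γ ^ 2)) ^ 2) := by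
    subst hh hB
    field_simp
    ring
  have hB0 : 0 < B := hB ▸ hb
  have hh0 : 6 < h := by linarith
  have h5 : 0 < 2 * h + B - 3 := by linarith
  have h6 : 0 < h ^ 2 + 2 * h * B + B ^ 2 - B := by nlinarith [sq_nonneg B, sq_nonneg h]
  rw [← sub_pos, key]
  positivity

theorem re_li_one_eq (ρ : ℂ) : (1 - (1 - 1 / ρ) ^ (1 : ℤ)).re = ρ.re / (ρ.re ^ 2 + ρ.im ^ 2) := by
  rw [zpow_one, sub_sub_cancel, one_div, Complex.inv_re, Complex.normSq_apply, pow_two, pow_two]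

theorem re_li_two_eq {ρ : ℂ} (hρ : ρ ≠ 0) : (1 - (1 - 1 / ρ) ^ (2 : ℤ)).re =
    (2 * ρ.re - 1) / (ρ.re ^ 2 + ρ.im ^ 2) + 2 * ρ.im ^ 2 / (ρ.re ^ 2 + ρ.im ^ 2) ^ 2 := by
  have h : ρ.re ^ 2 + ρ.im ^ 2 ≠ 0 := by
    have := (Complex.normSq_pos.2 hρ).ne'
    rwa [Complex.normSq_apply, ← pow_two, ← pow_two] at this
  have h1 : 1 - (1 - 1 / ρ) ^ (2 : ℤ) = 2 * ρ⁻¹ - ρ⁻¹ * ρ⁻¹ := by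
    rw [show (2 : ℤ) = ((2 : ℕ) : ℤ) from rfl, zpow_natCast, one_div]; ring
  rw [h1]
  rw [sub_re, mul_re, mul_re, inv_re, inv_im, Complex.normSq_apply, re_ofNat, im_ofNat,
    ← pow_two, ← pow_two]
  field_simp
  ring

theorem abs_kernel_one_le {x : ℝ} (hx : 0 < x) :
    |x / (4 * x ^ 2 + 1) ^ 2| ≤ 4 * (1 + x) ^ (-3 : ℝ) := by
  rw [abs_of_nonneg (by positivity), Real.rpow_neg (by positivity), ← div_eq_mul_inv,
    div_le_div_iff₀ (by positivity) (by positivity),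
    show (3 : ℝ) = ((3 : ℕ) : ℝ) by norm_num, Real.rpow_natCast]
  have h1 : (1 + x) ^ 2 ≤ 2 * (4 * x ^ 2 + 1) := by nlinarith [sq_nonneg (1 - x), sq_nonneg x]
  calc x * (1 + x) ^ 3 ≤ (1 + x) * (1 + x) ^ 3 := by gcongr; linarith
    _ = ((1 + x) ^ 2) ^ 2 := by ring
    _ ≤ (2 * (4 * x ^ 2 + 1)) ^ 2 := by gcongr
    _ = 4 * (4 * x ^ 2 + 1) ^ 2 := by ring

theorem abs_kernel_two_le {x : ℝ} (hx : 0 < x) :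
    |x * (4 * x ^ 2 - 1) / (4 * x ^ 2 + 1) ^ 3| ≤ 4 * (1 + x) ^ (-3 : ℝ) := by
  refine le_trans ?_ (abs_kernel_one_le hx)
  have h : x * (4 * x ^ 2 - 1) / (4 * x ^ 2 + 1) ^ 3 =
      x / (4 * x ^ 2 + 1) ^ 2 * ((4 * x ^ 2 - 1) / (4 * x ^ 2 + 1)) := by
    field_simp
  rw [h, abs_mul]
  refine mul_le_of_le_one_right (abs_nonneg _) ?_
  rw [abs_div, abs_of_pos (by positivity : 0 < 4 * x ^ 2 + 1), div_le_one (by positivity), abs_le]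
  constructor <;> nlinarith [sq_nonneg x]

theorem tendsto_inv_four_mul_sq_add_one :
    Tendsto (fun x : ℝ => (4 * x ^ 2 + 1)⁻¹) atTop (𝓝 0) := by
  refine tendsto_inv_atTop_zero.comp (tendsto_atTop_add_const_right _ _ ?_)
  exact (tendsto_pow_atTop two_ne_zero).const_mul_atTop (by norm_num)

theorem integrableOn_Ioi_of_abs_le {k : ℝ → ℝ} (hk : Continuous k)
    (hkb : ∀ x, 0 < x → |k x| ≤ 4 * (1 + x) ^ (-3 : ℝ)) {c : ℝ} (hc : 0 ≤ c) :
    IntegrableOn k (Set.Ioi c) := by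
  refine Integrable.mono' ((integrableOn_add_rpow_Ioi_of_lt (a := -3) (c := c) (m := 1)
    (by norm_num) (by linarith)).const_mul 4) hk.aestronglyMeasurable ?_
  filter_upwards [self_mem_ae_restrict measurableSet_Ioi] with x hx
  rw [add_comm]
  exact hkb x (hc.trans_lt hx)

theorem continuous_kernel_one : Continuous fun x : ℝ => x / (4 * x ^ 2 + 1) ^ 2 :=
  continuous_id.div (by fun_prop) fun x => by positivity

theorem continuous_kernel_two :
    Continuous fun x : ℝ => x * (4 * x ^ 2 - 1) / (4 * x ^ 2 + 1) ^ 3 :=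
  Continuous.div (by fun_prop) (by fun_prop) fun x => by positivity

theorem integral_Ioi_kernel_one {c : ℝ} (hc : 0 ≤ c) :
    ∫ x in Set.Ioi c, x / (4 * x ^ 2 + 1) ^ 2 = 1 / (8 * (4 * c ^ 2 + 1)) := by
  have hd : ∀ x : ℝ, HasDerivAt (fun x : ℝ => -(1 / 8) * (4 * x ^ 2 + 1)⁻¹)
      (x / (4 * x ^ 2 + 1) ^ 2) x := fun x => by
    have h0 : 4 * x ^ 2 + 1 ≠ 0 := by positivity
    refine (((((hasDerivAt_id x).pow 2).const_mul 4).add_const 1).inv h0).const_mul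
      (-(1 / 8) : ℝ) |>.congr_deriv ?_
    simp only [id, Pi.pow_apply]
    field_simp
    norm_num
  rw [integral_Ioi_of_hasDerivAt_of_tendsto' (fun x _ => hd x)
    (integrableOn_Ioi_of_abs_le continuous_kernel_one (fun x => abs_kernel_one_le) hc)
    (tendsto_inv_four_mul_sq_add_one.const_mul (-(1 / 8)))]
  field_simp
  ring

theorem integral_Ioi_kernel_two {c : ℝ} (hc : 0 ≤ c) :
    ∫ x in Set.Ioi c, x * (4 * x ^ 2 - 1) / (4 * x ^ 2 + 1) ^ 3 =
      c ^ 2 / (2 * (4 * c ^ 2 + 1) ^ 2) := by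
  -- `-x² / (2 (4x² + 1)²)`, in powers of `1 / (4x² + 1)`
  have hd : ∀ x : ℝ, HasDerivAt (fun x : ℝ => (1 / 8) * ((4 * x ^ 2 + 1)⁻¹ * (4 * x ^ 2 + 1)⁻¹)
      + -(1 / 8) * (4 * x ^ 2 + 1)⁻¹) (x * (4 * x ^ 2 - 1) / (4 * x ^ 2 + 1) ^ 3) x := fun x => by
    have h0 : 4 * x ^ 2 + 1 ≠ 0 := by positivity
    have h1 := ((((hasDerivAt_id x).pow 2).const_mul (4 : ℝ)).add_const 1).inv h0
    refine (((h1.mul h1).const_mul (1 / 8 : ℝ)).add (h1.const_mul (-(1 / 8) : ℝ))).congr_deriv ?_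
    simp only [id, Pi.pow_apply, Pi.inv_apply]
    field_simp
    ring
  have hlim := ((tendsto_inv_four_mul_sq_add_one.mul tendsto_inv_four_mul_sq_add_one).const_mul
    (1 / 8)).add (tendsto_inv_four_mul_sq_add_one.const_mul (-(1 / 8)))
  rw [integral_Ioi_of_hasDerivAt_of_tendsto' (fun x _ => hd x)
    (integrableOn_Ioi_of_abs_le continuous_kernel_two (fun x => abs_kernel_two_le) hc) hlim]
  field_simp
  ring

namespace IsSharpFlat

variable {F : ℂ → ℂ} {D : GammaData}

theorem tendsto_liPartialSum_one (hF : IsSharpFlat F D) :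
    Tendsto (liPartialSum F D 1) atTop (𝓝 (liCoeff F D 1)) ∧
      HasSum (fun ρ : nontrivialZeros F D =>
        (zeroMult F D ρ : ℝ) * (1 - (1 - 1 / (ρ : ℂ)) ^ (1 : ℤ)).re) (liCoeff F D 1).re :=
  hF.tendsto_liPartialSum (c := 1) (K := 0) zero_le_one le_rfl fun ρ _ => by simp

theorem tendsto_liPartialSum_two (hF : IsSharpFlat F D) :
    Tendsto (liPartialSum F D 2) atTop (𝓝 (liCoeff F D 2)) ∧
      HasSum (fun ρ : nontrivialZeros F D =>
        (zeroMult F D ρ : ℝ) * (1 - (1 - 1 / (ρ : ℂ)) ^ (2 : ℤ)).re) (liCoeff F D 2).re :=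
  hF.tendsto_liPartialSum (c := 2) (K := 1) zero_le_two zero_le_one fun ρ h => by
    have h1 : 1 - (1 - 1 / ρ) ^ (2 : ℤ) - ((2 : ℝ) : ℂ) * (1 / ρ) = -(1 / ρ ^ 2) := by
      rw [show (2 : ℤ) = ((2 : ℕ) : ℤ) from rfl, zpow_natCast]
      push_cast
      ring
    have h2 := Complex.abs_im_le_norm ρ
    rw [h1, norm_neg, norm_div, norm_one, norm_pow, ← sq_abs ρ.im]
    gcongr

theorem summable_ordinateTerm (hF : IsSharpFlat F D) {v : ℝ → ℝ} {K : ℝ} (hK : 0 ≤ K)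
    (hv0 : ∀ γ, 0 ≤ v γ) (hv : ∀ γ, 0 < γ ^ 2 → v γ ≤ K / γ ^ 2) :
    Summable (ordinateTerm F D v) := by
  refine (hF.summable_zeroMult_mul_norm (f := fun ρ => v ρ.im) hK fun ρ _ h => ?_).congr
    fun ρ => ?_
  · rw [Real.norm_of_nonneg (hv0 _)]
    exact hv _ (by rw [← sq_abs]; positivity)
  · rw [Real.norm_of_nonneg (hv0 _)]
    rfl

theorem summable_ordinateTerm_one (hF : IsSharpFlat F D) :
    Summable (ordinateTerm F D fun γ => 2 / (4 * γ ^ 2 + 1)) :=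
  hF.summable_ordinateTerm zero_le_one (fun γ => by positivity) fun γ h => by
    rw [div_le_div_iff₀ (by positivity) h]
    linarith

theorem summable_ordinateTerm_two (hF : IsSharpFlat F D) :
    Summable (ordinateTerm F D fun γ => 32 * γ ^ 2 / (4 * γ ^ 2 + 1) ^ 2) :=
  hF.summable_ordinateTerm zero_le_two (fun γ => by positivity) fun γ h => by
    rw [div_le_div_iff₀ (by positivity) h]
    nlinarith

theorem grh_iff_liCoeff_one (hF : IsSharpFlat F D) (hoff : OffLineZerosAbove F D (1 / √3)) :
    GRH F D ↔ (liCoeff F D 1).re =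
      ∑' ρ, ordinateTerm F D (fun γ => 2 / (4 * γ ^ 2 + 1)) ρ := by
  refine hF.grh_iff_tsum_eq (u := fun ρ => (1 - (1 - 1 / ρ) ^ (1 : ℤ)).re)
    hF.tendsto_liPartialSum_one.2 hF.summable_ordinateTerm_one (fun ρ _ h => ?_)
    fun ρ hρ h => ?_
  · rw [re_li_one_eq, h]
    field_simp
    ring
  · have hγ : 1 / 3 < ρ.im ^ 2 := by
      have h := hoff ρ hρ h
      rw [← sq_abs]
      calc (1 / 3 : ℝ) = (1 / √3) ^ 2 := by rw [div_pow, Real.sq_sqrt (by norm_num)]; norm_num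
        _ < |ρ.im| ^ 2 := by gcongr
    have h1 := re_inv_add_re_inv_reflect_lt (sub_ne_zero.2 h) hγ
    rw [add_sub_cancel, show 1 / 2 - (ρ.re - 1 / 2) = 1 - ρ.re by ring] at h1
    rw [re_li_one_eq, re_li_one_eq]
    simpa using h1

theorem grh_iff_liCoeff_two (hF : IsSharpFlat F D) (hoff : OffLineZerosAbove F D √6) :
    GRH F D ↔ (liCoeff F D 2).re =
      ∑' ρ, ordinateTerm F D (fun γ => 32 * γ ^ 2 / (4 * γ ^ 2 + 1) ^ 2) ρ := by
  have hγ : ∀ ρ ∈ nontrivialZeros F D, ρ.re ≠ 1 / 2 → 6 < ρ.im ^ 2 := fun ρ hρ hne => by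
    have h := hoff ρ hρ hne
    rw [← sq_abs]
    calc (6 : ℝ) = √6 ^ 2 := (Real.sq_sqrt (by norm_num)).symm
      _ < |ρ.im| ^ 2 := by gcongr
  -- the origin is off the critical line and has ordinate zero
  have h0 : ∀ ρ ∈ nontrivialZeros F D, ρ ≠ 0 := by
    rintro ρ hρ rfl
    have := hγ 0 hρ (by norm_num)
    norm_num at this
  refine hF.grh_iff_tsum_eq (u := fun ρ => (1 - (1 - 1 / ρ) ^ (2 : ℤ)).re)
    hF.tendsto_liPartialSum_two.2 hF.summable_ordinateTerm_two (fun ρ hρ h => ?_)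
    fun ρ hρ h => ?_
  · rw [re_li_two_eq (h0 ρ hρ), h]
    field_simp
    ring
  · have h1 := re_li_two_add_reflect_lt (sub_ne_zero.2 h) (hγ ρ hρ h)
    rw [add_sub_cancel, show 1 / 2 - (ρ.re - 1 / 2) = 1 - ρ.re by ring,
      show 2 * (ρ.re - 1 / 2) = 2 * ρ.re - 1 by ring,
      show -(2 * ρ.re - 1) = 2 * (1 - ρ.re) - 1 by ring] at h1
    rw [re_li_two_eq (h0 ρ hρ), re_li_two_eq (h0 _ ((hF.xi_reflect_eq_zero_iff ρ).2 hρ))]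
    simpa using h1

end IsSharpFlat

theorem theorem3 (F : ℂ → ℂ) (D : GammaData) (hF : IsSharpFlat F D) :
    (OffLineZerosAbove F D (1 / √3) →
      (∀ T : ℝ, (zerosUpTo F D T).Finite) ∧
      Tendsto (liPartialSum F D 1) atTop (𝓝 (liCoeff F D 1)) ∧
      Summable (ordinateTerm F D fun γ => 2 / (4 * γ ^ 2 + 1)) ∧
      IntegrableOn (fun x : ℝ => x / (4 * x ^ 2 + 1) ^ 2 * (zeroCount F D x : ℝ))
        (Set.Ioi 0) ∧
      (GRH F D ↔ (liCoeff F D 1).re =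
        16 * ∫ x in Set.Ioi (0 : ℝ), x / (4 * x ^ 2 + 1) ^ 2 * (zeroCount F D x : ℝ)) ∧
      (GRH F D ↔ (liCoeff F D 1).re =
        ∑' ρ, ordinateTerm F D (fun γ => 1 - (4 * γ ^ 2 - 1) / (4 * γ ^ 2 + 1)) ρ) ∧
      (GRH F D ↔ (liCoeff F D 1).re =
        ∑' ρ, ordinateTerm F D (fun γ => 2 / (4 * γ ^ 2 + 1)) ρ)) ∧
    (OffLineZerosAbove F D (√6) →
      Tendsto (liPartialSum F D 2) atTop (𝓝 (liCoeff F D 2)) ∧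
      Summable (ordinateTerm F D fun γ => 32 * γ ^ 2 / (4 * γ ^ 2 + 1) ^ 2) ∧
      IntegrableOn
        (fun x : ℝ => x * (4 * x ^ 2 - 1) / (4 * x ^ 2 + 1) ^ 3 * (zeroCount F D x : ℝ))
        (Set.Ioi 0) ∧
      (GRH F D ↔ (liCoeff F D 2).re =
        64 * ∫ x in Set.Ioi (0 : ℝ),
          x * (4 * x ^ 2 - 1) / (4 * x ^ 2 + 1) ^ 3 * (zeroCount F D x : ℝ)) ∧
      (GRH F D ↔ (liCoeff F D 2).re =
        ∑' ρ, ordinateTerm F D (fun γ =>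
          1 - (Polynomial.Chebyshev.T ℝ 2).eval ((4 * γ ^ 2 - 1) / (4 * γ ^ 2 + 1))) ρ) ∧
      (GRH F D ↔ (liCoeff F D 2).re =
        ∑' ρ, ordinateTerm F D (fun γ => 32 * γ ^ 2 / (4 * γ ^ 2 + 1) ^ 2) ρ)) := by
  refine ⟨fun hoff => ?_, fun hoff => ?_⟩
  · have hgrh := hF.grh_iff_liCoeff_one hoff
    obtain ⟨hI, hint⟩ := hF.integral_mul_zeroCount (K := 4) (by norm_num) continuous_kernel_one
      (fun x => abs_kernel_one_le) (fun c hc => integral_Ioi_kernel_one hc)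
    refine ⟨hF.finite_zerosUpTo, hF.tendsto_liPartialSum_one.1, hF.summable_ordinateTerm_one, hI,
      ?_, ?_, hgrh⟩
    · rw [hgrh, hint, ← tsum_mul_left]
      refine Eq.congr_right (tsum_congr fun ρ => ?_)
      simp only [ordinateTerm, sq_abs]
      field_simp
      ring
    · rw [hgrh]
      refine Eq.congr_right (tsum_congr fun ρ => ?_)
      simp only [ordinateTerm]
      field_simp
      ring
  · have hgrh := hF.grh_iff_liCoeff_two hoff
    obtain ⟨hI, hint⟩ := hF.integral_mul_zeroCount (K := 4) (by norm_num) continuous_kernel_two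
      (fun x => abs_kernel_two_le) (fun c hc => integral_Ioi_kernel_two hc)
    refine ⟨hF.tendsto_liPartialSum_two.1, hF.summable_ordinateTerm_two, hI, ?_, ?_, hgrh⟩
    · rw [hgrh, hint, ← tsum_mul_left]
      refine Eq.congr_right (tsum_congr fun ρ => ?_)
      simp only [ordinateTerm, sq_abs]
      field_simp
      ring
    · rw [hgrh]
      refine Eq.congr_right (tsum_congr fun ρ => ?_)
      simp only [ordinateTerm, Polynomial.Chebyshev.T_two, Polynomial.eval_sub,
        Polynomial.eval_mul, Polynomial.eval_pow, Polynomial.eval_X, Polynomial.eval_one,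
        Polynomial.eval_ofNat]
      field_simp
      ring
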